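/- Let $\mathfrak g$ be a simple real Lie algebra with a positive definite $\operatorname{ad}$-invariant inner product $\langle\cdot,\cdot\rangle$ (so $\mathfrak g$ is compact), $\{X_i\}$ an orthonormal basis of $\mathfrak g$, and $L\mathfrak g_{\mathbb C}=\mathfrak g_{\mathbb C}[z,z^{-1}]=L\mathfrak g_{\mathbb C}^-\oplus\mathfrak g_{\mathbb C}\oplus L\mathfrak g_{\mathbb C}^+$ ($z=e^{i\theta}$; negative, zero, positive powers of $z$) the complexified loop algebra with pointwise bracket, complex bilinear inner product $\langle\xi,\eta\rangle=\frac1{2\pi}\int_0^{2\pi}\langle\xi(\theta),\eta(\theta)\rangle\,d\theta$ and rotation derivation $\partial_\theta$. Let $\mathrm{Cl}(L\mathfrak g_{\mathbb C})$ be the Clifford algebra with $\{\xi,\eta\}=2\langle\xi,\eta\rangle$, acting on the spin representation $\mathcal S=\mathbb S\otimes\Lambda^*(L\mathfrak g_{\mathbb C}^+)$, where $\mathbb S$ is any nonzero complex $\mathrm{Cl}(\mathfrak g_{\mathbb C})$-module (for example a spin module): $\xi\in L\mathfrak g_{\mathbb C}^+$ acts by $1\otimes(\xi\wedge\cdot)$,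 $\xi\in L\mathfrak g_{\mathbb C}^-$ by $1\otimes\iota(\xi)$, where $\iota(\xi)$ is the odd derivation with $\iota(\xi)\eta=2\langle\xi,\eta\rangle$, and $\xi\in\mathfrak g_{\mathbb C}$ by $c(\xi)\otimes(-1)^F$, with $F$ the exterior degree. Write $\xi^*=\langle\xi,\cdot\rangle$. The wedge product is normalized by $\xi_1^*\wedge\dots\wedge\xi_p^*(\eta_1,\dots,\eta_p)=\frac1{p!}\det(\langle\xi_i,\eta_j\rangle)$. Let $\mathrm{ch}$ be the Chevalley identification of the Clifford algebra with the exterior algebra, i.e. $\mathrm{ch}(1)=1$ and $\mathrm{ch}(\xi x)=\xi^*\wedge\mathrm{ch}(x)+\iota_\xi\mathrm{ch}(x)$, where $\iota_\xi$ is the odd derivation with $\iota_\xi\eta^*=\langle\xi,\eta\rangle$. Let $n$ be the normal ordering isomorphism from $\mathrm{Cl}(L\mathfrak g_{\mathbb C})$ to finite sums of such wedge products, $n(\omega^+\omega^-)=\mathrm{ch}(\omega^+)\wedge\mathrm{ch}(\omega^-)$ for $\omega^+\in\mathrm{Cl}(\mathfrak g_{\mathbb C}\oplus L\mathfrak g_{\mathbb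 C}^+)$ and $\omega^-\in\mathrm{Cl}(L\mathfrak g_{\mathbb C}^-)$. Let $\Lambda^*(L\mathfrak g_{\mathbb C})^+$ be the completion consisting of the skew-symmetric forms that are formal infinite sums of wedge products of the $(X_iz^k)^*$ in which, for each $N$, only finitely many terms have total negative energy at least $-N$ (the total negative energy of $(X_{i_1}z^{k_1})^*\wedge\dots\wedge(X_{i_p}z^{k_p})^*$ being $\sum_j\min(k_j,0)$). A form $\omega=\sum_a\omega_a$ in this completion is identified with the operator $\sum_a n^{-1}(\omega_a)$ on $\mathcal S$, a sum that is finite on every vector. Consider the forms $d\xi^*(\eta,\zeta)=-\frac12\langle\xi,[\eta,\zeta]\rangle$, $d\partial_\theta^*(\xi,\eta)=\frac12\langle\xi,\partial_\theta\eta\rangle$ and $\Omega(\xi,\eta,\zeta)=-\frac16\langle\xi,[\eta,\zeta]\rangle$. **Theorem.** The Casimir operator $-\frac12\sum_i(\operatorname{ad}X_i)^2$ of the adjoint representation is a scalar $c_{\mathfrak g}\in\mathbb R$. For all $\xi\in L\mathfrak g_{\mathbb C}$ the forms $\xi^*$, $d\xi^*$, $d\partial_\theta^*$, $\Omega$ lie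 in $\Lambda^*(L\mathfrak g_{\mathbb C})^+$ and define operators on $\mathcal S$, where $\xi^*$ acts as the Clifford multiplication by $\xi$. Put $\widetilde{\mathrm{ad}}\,\xi=\frac12d\xi^*$, $\widetilde{\mathrm{ad}}\,\partial_\theta=\frac12d\partial_\theta^*$, $\gamma=\frac14\Omega$ (as operators). In $\operatorname{End}(\mathcal S)$, with the supercommutator, the complex span of the even elements $1$, $\widetilde{\mathrm{ad}}\,\xi$, $\widetilde{\mathrm{ad}}\,\partial_\theta$ and the complex span of the odd elements $\xi^*$, $\gamma$ $(\xi\in L\mathfrak g_{\mathbb C})$ meet only in $0$, and their sum is a Lie superalgebra. For all $\xi,\eta\in L\mathfrak g_{\mathbb C}$: $$\{\xi^*,\eta^*\}=2\langle\xi,\eta\rangle,\qquad [\widetilde{\mathrm{ad}}\,\xi,\eta^*]=[\xi,\eta]^*,\qquad [\widetilde{\mathrm{ad}}\,\xi,\widetilde{\mathrm{ad}}\,\eta]=\widetilde{\mathrm{ad}}\,[\xi,\eta]+ic_{\mathfrak g}\langle\xi,\partial_\theta\eta\rangle,$$ $$[\widetilde{\mathrm{ad}}\,\partial_\theta,\xi^*]=(\partial_\theta\xi)^*,\qquad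 [\widetilde{\mathrm{ad}}\,\partial_\theta,\widetilde{\mathrm{ad}}\,\xi]=\widetilde{\mathrm{ad}}(\partial_\theta\xi),$$ $$\{\gamma,\xi^*\}=\widetilde{\mathrm{ad}}\,\xi,\qquad [\gamma,\widetilde{\mathrm{ad}}\,\xi]=\tfrac12ic_{\mathfrak g}(\partial_\theta\xi)^*,\qquad [\gamma,\widetilde{\mathrm{ad}}\,\partial_\theta]=0,$$ $$\{\gamma,\gamma\}=ic_{\mathfrak g}\,\widetilde{\mathrm{ad}}\,\partial_\theta-\tfrac1{24}c_{\mathfrak g}\dim\mathfrak g .$$ -/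

import Mathlib

open scoped TensorProduct

noncomputable section

namespace LoopClifford

/-! ### The loop algebra, its inner product and the rotation derivation -/

/-- An `ad`-invariant (positive definite, symmetric) inner product on a real Lie algebra. -/
structure InvariantInnerProduct (𝔤 : Type*) [LieRing 𝔤] [LieAlgebra ℝ 𝔤] where
  form : LinearMap.BilinForm ℝ 𝔤
  symm : ∀ x y : 𝔤, form x y = form y x
  pos : ∀ x : 𝔤, x ≠ 0 → 0 < form x x
  invariant : ∀ x y z : 𝔤, form ⁅x, y⁆ z = form x ⁅y, z⁆

/-- The complexification `𝔤_ℂ`. -/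
abbrev Cplx (𝔤 : Type*) [LieRing 𝔤] [LieAlgebra ℝ 𝔤] : Type _ := ℂ ⊗[ℝ] 𝔤

/-- `L𝔤_ℂ = 𝔤_ℂ[z, z⁻¹]`: loops with values in `𝔤_ℂ` and finite Fourier expansion, with the
pointwise bracket. -/
abbrev Loop (𝔤 : Type*) [LieRing 𝔤] [LieAlgebra ℝ 𝔤] : Type _ :=
  LieAlgebra.loopAlgebra ℂ ℤ (Cplx 𝔤)

variable {𝔤 : Type*} [LieRing 𝔤] [LieAlgebra ℝ 𝔤]

/-- A shortcut that makes `⁅·, ·⁆` the bracket of the Lie ring structure. -/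
instance instBracketCplx : Bracket (Cplx 𝔤) (Cplx 𝔤) := LieRingModule.toBracket

/-- The same shortcut for loops. -/
instance instBracketLoop : Bracket (Loop 𝔤) (Loop 𝔤) := LieRingModule.toBracket

/-- The Fourier coefficients of a loop. -/
def fourier : Loop 𝔤 ≃ₗ[ℂ] (ℤ →₀ Cplx 𝔤) :=
  LieAlgebra.LoopAlgebra.toFinsupp ℂ ℤ (Cplx 𝔤)

/-- The `n`-th Fourier coefficient `ξ ↦ ξ_n`. -/
def coeff (n : ℤ) : Loop 𝔤 →ₗ[ℂ] Cplx 𝔤 := Finsupp.lapply n ∘ₗ fourier.toLinearMap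

/-- The loop `X zⁿ`. -/
def mode (n : ℤ) : Cplx 𝔤 →ₗ[ℂ] Loop 𝔤 := fourier.symm.toLinearMap ∘ₗ Finsupp.lsingle n

/-- The Fourier multiplier `∑ ξ_n zⁿ ↦ ∑ a_n ξ_n zⁿ`. -/
def multiplier (a : ℤ → ℂ) : Loop 𝔤 →ₗ[ℂ] Loop 𝔤 :=
  fourier.symm.toLinearMap ∘ₗ (Finsupp.lsum ℂ fun n => a n • Finsupp.lsingle n) ∘ₗ
    fourier.toLinearMap

/-- The derivation `∂_θ`, where `z = e^{iθ}`. -/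
def rot : Loop 𝔤 →ₗ[ℂ] Loop 𝔤 := multiplier fun n => Complex.I * n

/-- The component of a loop of positive energy. -/
def posPart : Loop 𝔤 →ₗ[ℂ] Loop 𝔤 := multiplier fun n => if 0 < n then 1 else 0

/-- The component of a loop of negative energy. -/
def negPart : Loop 𝔤 →ₗ[ℂ] Loop 𝔤 := multiplier fun n => if n < 0 then 1 else 0

variable (𝔤) in
/-- `L𝔤_ℂ⁺`, the loops of positive energy. -/
def LoopPos : Submodule ℂ (Loop 𝔤) := LinearMap.range posPart

variable (𝔤) in
/-- `L𝔤_ℂ⁻`, the loops of negative energy. -/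
def LoopNeg : Submodule ℂ (Loop 𝔤) := LinearMap.range negPart

variable (𝔤) in
/-- `𝔤_ℂ ⊕ L𝔤_ℂ⁺`, the loops of nonnegative energy. -/
def LoopNonneg : Submodule ℂ (Loop 𝔤) := LinearMap.ker negPart

/-- The complex bilinear extension of the inner product to `𝔤_ℂ`. -/
def InvariantInnerProduct.cplx (K : InvariantInnerProduct 𝔤) : LinearMap.BilinForm ℂ (Cplx 𝔤) :=
  LinearMap.BilinForm.baseChange ℂ K.form

/-- The inner product `⟨ξ, η⟩ = (2π)⁻¹ ∫ ⟨ξ(θ), η(θ)⟩ dθ = ∑ₙ ⟨ξ_n, η_{-n}⟩` on `L𝔤_ℂ`. -/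
def InvariantInnerProduct.loop (K : InvariantInnerProduct 𝔤) : LinearMap.BilinForm ℂ (Loop 𝔤) :=
  (Finsupp.lsum ℂ fun n : ℤ => K.cplx.compl₂ (coeff (-n))) ∘ₗ fourier.toLinearMap

variable (K : InvariantInnerProduct 𝔤)

/-! #### Elementary facts -/

theorem fourier_mode (n : ℤ) (X : Cplx 𝔤) : fourier (mode n X) = Finsupp.single n X := by
  simp [mode]

theorem mode_eq_tmul (n : ℤ) (X : Cplx 𝔤) :
    mode n X = AddMonoidAlgebra.single n (1 : ℂ) ⊗ₜ[ℂ] X := by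
  simp [mode, fourier]

theorem coeff_mode (m n : ℤ) (X : Cplx 𝔤) : coeff m (mode n X) = if n = m then X else 0 := by
  simp [coeff, fourier_mode, Finsupp.single_apply]

theorem multiplier_mode (a : ℤ → ℂ) (n : ℤ) (X : Cplx 𝔤) :
    multiplier a (mode n X) = a n • mode n X := by
  simp only [multiplier, mode, LinearMap.comp_apply, LinearEquiv.coe_coe,
    LinearEquiv.apply_symm_apply, Finsupp.lsingle_apply, Finsupp.lsum_single, LinearMap.smul_apply,
    map_smul]

theorem loop_induction {p : Loop 𝔤 → Prop} (ξ : Loop 𝔤) (h0 : p 0)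
    (hadd : ∀ ξ η, p ξ → p η → p (ξ + η)) (hmode : ∀ n X, p (mode n X)) : p ξ := by
  rw [← fourier.symm_apply_apply ξ]
  induction fourier ξ using Finsupp.induction_linear with
  | zero => simpa using h0
  | add f g hf hg => simpa using hadd _ _ hf hg
  | single n X => exact hmode n X

theorem lie_mode (m n : ℤ) (X Y : Cplx 𝔤) : ⁅mode m X, mode n Y⁆ = mode (m + n) ⁅X, Y⁆ := by
  simp only [mode_eq_tmul]
  rw [LieAlgebra.ExtendScalars.bracket_tmul, AddMonoidAlgebra.single_mul_single, one_mul]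

theorem loop_mode (m n : ℤ) (X Y : Cplx 𝔤) :
    K.loop (mode m X) (mode n Y) = if m + n = 0 then K.cplx X Y else 0 := by
  have : n = -m ↔ m + n = 0 := by omega
  simp only [InvariantInnerProduct.loop, LinearMap.comp_apply, LinearEquiv.coe_coe, fourier_mode,
    Finsupp.lsum_single, LinearMap.compl₂_apply, coeff_mode, this]
  split_ifs <;> simp

theorem cplx_symm (X Y : Cplx 𝔤) : K.cplx X Y = K.cplx Y X := by
  induction X using TensorProduct.induction_on with
  | zero => simp
  | add X X' h h' => simp [h, h']
  | tmul a x =>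
    induction Y using TensorProduct.induction_on with
    | zero => simp
    | add Y Y' h h' => simp [h, h']
    | tmul b y => simp [InvariantInnerProduct.cplx, K.symm x y, mul_comm a b]

theorem cplx_invariant (X Y Z : Cplx 𝔤) : K.cplx ⁅X, Y⁆ Z = K.cplx X ⁅Y, Z⁆ := by
  induction X using TensorProduct.induction_on with
  | zero => simp
  | add X X' h h' => simp [add_lie, h, h']
  | tmul a x =>
    induction Y using TensorProduct.induction_on with
    | zero => simp
    | add Y Y' h h' => simp [add_lie, lie_add, h, h']
    | tmul b y =>
      induction Z using TensorProduct.induction_on with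
      | zero => simp
      | add Z Z' h h' => rw [map_add, h, h', lie_add, map_add]
      | tmul c z =>
        simp [InvariantInnerProduct.cplx, K.invariant, mul_assoc]

theorem loop_symm (ξ η : Loop 𝔤) : K.loop ξ η = K.loop η ξ := by
  induction ξ using loop_induction with
  | h0 => simp
  | hadd ξ ξ' h h' => simp [h, h']
  | hmode m X =>
    induction η using loop_induction with
    | h0 => simp
    | hadd ξ ξ' h h' => simp [h, h']
    | hmode n Y => rw [loop_mode, loop_mode, cplx_symm, add_comm]

theorem loop_invariant (ξ η ζ : Loop 𝔤) : K.loop ⁅ξ, η⁆ ζ = K.loop ξ ⁅η, ζ⁆ := by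
  induction ξ using loop_induction with
  | h0 => simp
  | hadd ξ ξ' h h' => simp [add_lie, h, h']
  | hmode m X =>
    induction η using loop_induction with
    | h0 => simp
    | hadd ξ ξ' h h' => simp [add_lie, lie_add, h, h']
    | hmode n Y =>
      induction ζ using loop_induction with
      | h0 => simp
      | hadd ξ ξ' h h' => simp [lie_add, h, h']
      | hmode k Z => simp only [lie_mode, loop_mode, cplx_invariant, add_assoc]

theorem loop_multiplier (a : ℤ → ℂ) (ξ η : Loop 𝔤) :
    K.loop (multiplier a ξ) η = K.loop ξ (multiplier (fun n => a (-n)) η) := by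
  induction ξ using loop_induction with
  | h0 => simp
  | hadd ξ ξ' h h' => simp [h, h']
  | hmode m X =>
    induction η using loop_induction with
    | h0 => simp
    | hadd ξ ξ' h h' => simp only [map_add, h, h']
    | hmode n Y =>
      simp only [multiplier_mode, map_smul, LinearMap.smul_apply, loop_mode]
      split_ifs with h
      · rw [show m = -n by omega]
      · simp

theorem multiplier_add (a b : ℤ → ℂ) (ξ : Loop 𝔤) :
    multiplier a ξ + multiplier b ξ = multiplier (fun n => a n + b n) ξ := by
  induction ξ using loop_induction with
  | h0 => simp
  | hadd ξ ξ' h h' => simp only [map_add, ← h, ← h']; abel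
  | hmode m X => simp only [multiplier_mode, add_smul]

theorem multiplier_smul (c : ℂ) (a : ℤ → ℂ) (ξ : Loop 𝔤) :
    c • multiplier a ξ = multiplier (fun n => c * a n) ξ := by
  induction ξ using loop_induction with
  | h0 => simp
  | hadd ξ ξ' h h' => simp only [map_add, smul_add, ← h, ← h']
  | hmode m X => simp only [multiplier_mode, smul_smul]

theorem multiplier_one (ξ : Loop 𝔤) : multiplier (fun _ => 1) ξ = ξ := by
  induction ξ using loop_induction with
  | h0 => simp
  | hadd ξ ξ' h h' => simp only [map_add, h, h']
  | hmode m X => simp [multiplier_mode]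

theorem multiplier_multiplier (a b : ℤ → ℂ) (ξ : Loop 𝔤) :
    multiplier a (multiplier b ξ) = multiplier (fun n => a n * b n) ξ := by
  induction ξ using loop_induction with
  | h0 => simp
  | hadd ξ ξ' h h' => simp only [map_add, h, h']
  | hmode m X => simp [multiplier_mode, smul_smul, mul_comm]

theorem loop_rot (ξ η : Loop 𝔤) : K.loop ξ (rot η) = -K.loop η (rot ξ) := by
  rw [loop_symm, rot, loop_multiplier, ← map_neg]
  congr 1
  rw [← neg_one_smul ℂ, multiplier_smul]
  congr 2
  ext n
  simp

/-! ### Clifford algebras, the spin representation and normal ordering -/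

/-- `Cl(𝔤_ℂ)`: generated by `𝔤_ℂ` subject to `XY + YX = 2⟨X, Y⟩`. -/
abbrev InvariantInnerProduct.Cl (K : InvariantInnerProduct 𝔤) : Type _ :=
  CliffordAlgebra K.cplx.toQuadraticMap

/-- `Cl(L𝔤_ℂ)`: generated by `L𝔤_ℂ` subject to `ξη + ηξ = 2⟨ξ, η⟩`. -/
abbrev InvariantInnerProduct.LoopCl (K : InvariantInnerProduct 𝔤) : Type _ :=
  CliffordAlgebra K.loop.toQuadraticMap

variable (𝔤) in
/-- The representation space `𝒮 = 𝕊 ⊗ Λ*(L𝔤_ℂ⁺)`. -/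
abbrev SpinSpace (S : Type*) [AddCommGroup S] [Module ℂ S] : Type _ :=
  S ⊗[ℂ] ExteriorAlgebra ℂ (LoopPos 𝔤)

/-- `ξ ↦ ξ⁺`, as a map to `L𝔤_ℂ⁺`. -/
def posProj : Loop 𝔤 →ₗ[ℂ] LoopPos 𝔤 := posPart.rangeRestrict

/-- Exterior multiplication `ε(ξ⁺)` on `Λ*(L𝔤_ℂ⁺)`. -/
def wedgePos (ξ : Loop 𝔤) : Module.End ℂ (ExteriorAlgebra ℂ (LoopPos 𝔤)) :=
  LinearMap.mulLeft ℂ (ExteriorAlgebra.ι ℂ (posProj ξ))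

/-- The functional `η ↦ 2⟨ξ⁻, η⟩` on `L𝔤_ℂ⁺`. -/
def negDual : Loop 𝔤 →ₗ[ℂ] Module.Dual ℂ (LoopPos 𝔤) :=
  LinearMap.lcomp ℂ ℂ (LoopPos 𝔤).subtype ∘ₗ ((2 : ℂ) • K.loop ∘ₗ negPart)

/-- Interior contraction `ι(ξ⁻)` on `Λ*(L𝔤_ℂ⁺)`: the odd derivation with `η ↦ 2⟨ξ⁻, η⟩` for
`η ∈ L𝔤_ℂ⁺`. The factor `2` is the one for which `{ε(η), ι(ξ⁻)} = 2⟨ξ⁻, η⟩`, the Clifford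
relation. -/
def contractNeg (ξ : Loop 𝔤) : Module.End ℂ (ExteriorAlgebra ℂ (LoopPos 𝔤)) :=
  CliffordAlgebra.contractLeft (negDual K ξ)

/-- `(-1)^F` on `Λ*(L𝔤_ℂ⁺)`, with `F` the degree. -/
def parity : Module.End ℂ (ExteriorAlgebra ℂ (LoopPos 𝔤)) :=
  (CliffordAlgebra.involute :
    ExteriorAlgebra ℂ (LoopPos 𝔤) →ₐ[ℂ] ExteriorAlgebra ℂ (LoopPos 𝔤)).toLinearMap

section SpinRepresentation

variable {S : Type*} [AddCommGroup S] [Module ℂ S]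

/-- The operator by which `ξ ∈ L𝔤_ℂ` acts on `𝒮 = 𝕊 ⊗ Λ*(L𝔤_ℂ⁺)`: it is `1 ⊗ ε(ξ)` for positive
energy, `1 ⊗ ι(ξ)` for negative energy, and `c(ξ) ⊗ (-1)^F` for `ξ ∈ 𝔤_ℂ`. -/
def cliffordOp (ρ : K.Cl →ₐ[ℂ] Module.End ℂ S) :
    Loop 𝔤 →ₗ[ℂ] Module.End ℂ (SpinSpace 𝔤 S) where
  toFun ξ :=
    TensorProduct.map LinearMap.id (wedgePos ξ) + TensorProduct.map LinearMap.id (contractNeg K ξ) +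
      TensorProduct.map (ρ (CliffordAlgebra.ι _ (coeff 0 ξ))) parity
  map_add' ξ η := by
    refine TensorProduct.ext' fun s x => ?_
    simp only [wedgePos, contractNeg, parity, map_add, LinearMap.add_apply, TensorProduct.map_tmul,
      LinearMap.mulLeft_apply, add_mul, TensorProduct.tmul_add, TensorProduct.add_tmul,
      LinearMap.id_apply]
    abel
  map_smul' a ξ := by
    refine TensorProduct.ext' fun s x => ?_
    simp [wedgePos, contractNeg, parity, TensorProduct.smul_tmul']

theorem loop_decomp (ξ η : Loop 𝔤) : K.loop ξ η = K.cplx (coeff 0 ξ) (coeff 0 η) +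
    K.loop (negPart ξ) (posPart η) + K.loop (negPart η) (posPart ξ) := by
  induction ξ using loop_induction with
  | h0 => simp
  | hadd ξ ξ' h h' => simp only [map_add, LinearMap.add_apply, h, h']; abel
  | hmode m X =>
    induction η using loop_induction with
    | h0 => simp
    | hadd ξ ξ' h h' => simp only [map_add, LinearMap.add_apply, h, h']; abel
    | hmode n Y =>
      simp only [negPart, posPart, multiplier_mode, map_smul, LinearMap.smul_apply, loop_mode,
        coeff_mode, add_comm n m, cplx_symm K Y X]
      by_cases h : m + n = 0
      · obtain rfl : n = -m := by omega
        rcases lt_trichotomy m 0 with hm | rfl | hm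
        · simp [hm, hm.ne, not_lt.2 hm.le]
        · simp
        · simp [hm, hm.ne', not_lt.2 hm.le]
      · rcases eq_or_ne m 0 with rfl | hm
        · have : n ≠ 0 := by omega
          simp [this]
        · simp [h, hm]

theorem cliffordOp_sq (ρ : K.Cl →ₐ[ℂ] Module.End ℂ S) (ξ : Loop 𝔤) :
    cliffordOp K ρ ξ * cliffordOp K ρ ξ = algebraMap ℂ _ (K.loop.toQuadraticMap ξ) := by
  refine TensorProduct.ext' fun s x => ?_
  have hρ : ρ (CliffordAlgebra.ι _ (coeff 0 ξ)) (ρ (CliffordAlgebra.ι _ (coeff 0 ξ)) s) =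
      K.cplx (coeff 0 ξ) (coeff 0 ξ) • s := by
    rw [← Module.End.mul_apply, ← map_mul, CliffordAlgebra.ι_sq_scalar, AlgHom.commutes]
    rfl
  have hεε : ExteriorAlgebra.ι ℂ (posProj ξ) * (ExteriorAlgebra.ι ℂ (posProj ξ) * x) = 0 := by
    rw [← mul_assoc, ExteriorAlgebra.ι_sq_zero, zero_mul]
  have hιε : CliffordAlgebra.contractLeft (negDual K ξ) (ExteriorAlgebra.ι ℂ (posProj ξ) * x) =
      (2 * K.loop (negPart ξ) (posPart ξ)) • x -
        ExteriorAlgebra.ι ℂ (posProj ξ) * CliffordAlgebra.contractLeft (negDual K ξ) x :=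
    CliffordAlgebra.contractLeft_ι_mul _ _ _
  have hpε : CliffordAlgebra.involute (ExteriorAlgebra.ι ℂ (posProj ξ) * x) =
      -(ExteriorAlgebra.ι ℂ (posProj ξ) * CliffordAlgebra.involute x) := by
    rw [map_mul]
    erw [CliffordAlgebra.involute_ι]
    rw [neg_mul]
  have hpι : ∀ y : ExteriorAlgebra ℂ (LoopPos 𝔤),
      CliffordAlgebra.involute (CliffordAlgebra.contractLeft (negDual K ξ) y) =
      -(CliffordAlgebra.contractLeft (negDual K ξ) (CliffordAlgebra.involute y)) := by
    intro y
    induction y using CliffordAlgebra.left_induction with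
    | algebraMap r => simp
    | add y z hy hz => simp only [map_add, hy, hz, neg_add]
    | ι_mul y m hy =>
      simp only [CliffordAlgebra.contractLeft_ι_mul, map_sub, map_mul, map_smul, hy,
        CliffordAlgebra.involute_ι, neg_mul, map_neg]
      simp only [mul_neg]
      abel
  have hdec : K.loop.toQuadraticMap ξ = K.cplx (coeff 0 ξ) (coeff 0 ξ) +
      2 * K.loop (negPart ξ) (posPart ξ) := by
    rw [LinearMap.BilinMap.toQuadraticMap_apply, loop_decomp]
    ring
  have hpp : CliffordAlgebra.involute (CliffordAlgebra.involute x) = x :=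
    CliffordAlgebra.involute_involute x
  rw [hdec]
  simp only [cliffordOp, LinearMap.coe_mk, AddHom.coe_mk, Module.End.mul_apply, wedgePos,
    contractNeg, parity, LinearMap.add_apply, TensorProduct.map_tmul, LinearMap.id_apply,
    LinearMap.mulLeft_apply, AlgHom.toLinearMap_apply, map_add, hεε, hιε, hpε, hpι, hρ, hpp,
    CliffordAlgebra.contractLeft_contractLeft, TensorProduct.tmul_zero, TensorProduct.tmul_sub,
    TensorProduct.tmul_neg, TensorProduct.tmul_smul, TensorProduct.smul_tmul',
    Module.algebraMap_end_apply]
  abel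

/-- The spin representation of `Cl(L𝔤_ℂ)` on `𝒮 = 𝕊 ⊗ Λ*(L𝔤_ℂ⁺)` obtained from a representation
of `Cl(𝔤_ℂ)` on `𝕊`. -/
def spinRep (ρ : K.Cl →ₐ[ℂ] Module.End ℂ S) :
    K.LoopCl →ₐ[ℂ] Module.End ℂ (SpinSpace 𝔤 S) :=
  CliffordAlgebra.lift _ ⟨cliffordOp K ρ, cliffordOp_sq K ρ⟩

end SpinRepresentation

/-! ### Normal ordering -/

theorem neg_loop_toQuadraticMap :
    (-K.loop).toQuadraticMap = (0 : QuadraticForm ℂ (Loop 𝔤)) - K.loop.toQuadraticMap := by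
  ext ξ
  simp

/-- The Chevalley identification `ch : Cl(L𝔤_ℂ) → Λ*(L𝔤_ℂ)`, determined by `ch 1 = 1` and
`ch (ξ · x) = ξ ∧ ch x + ι_ξ (ch x)`. Here `Λ*(L𝔤_ℂ)` is identified via the inner product with the
finite sums of wedge products `ξ₁* ∧ ⋯ ∧ ξₙ*`. -/
def chevalley : K.LoopCl ≃ₗ[ℂ] ExteriorAlgebra ℂ (Loop 𝔤) :=
  CliffordAlgebra.changeFormEquiv (neg_loop_toQuadraticMap K)

/-- The contraction `⟨ξ⁰, η⟩ + 2⟨ξ⁻, η⟩` of an ordered pair of loops. -/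
def contractionForm : LinearMap.BilinForm ℂ (Loop 𝔤) :=
  K.loop ∘ₗ multiplier fun n => if n < 0 then 2 else if n = 0 then 1 else 0

theorem contractionForm_self (ξ : Loop 𝔤) : contractionForm K ξ ξ = K.loop ξ ξ := by
  set a : ℤ → ℂ := fun n => if n < 0 then 2 else if n = 0 then 1 else 0 with ha
  have h1 : contractionForm K ξ ξ = K.loop (multiplier a ξ) ξ := rfl
  have h2 : contractionForm K ξ ξ = K.loop (multiplier (fun n => a (-n)) ξ) ξ := by
    rw [h1, loop_multiplier, loop_symm]
  have h3 : contractionForm K ξ ξ + contractionForm K ξ ξ = 2 * K.loop ξ ξ := by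
    nth_rw 1 [h1]
    rw [h2, ← LinearMap.add_apply, ← map_add, multiplier_add]
    have : (fun n => a n + a (-n)) = fun n => 2 * (fun _ => (1 : ℂ)) n := by
      ext n
      rcases lt_trichotomy n 0 with h | h | h
      · simp [ha, h, h.ne, not_lt.2 h.le]
      · simp [ha, h]; norm_num
      · simp [ha, h, h.ne', not_lt.2 h.le]
    rw [this, ← multiplier_smul, multiplier_one]
    simp
  linear_combination h3 / 2

theorem neg_contractionForm_toQuadraticMap :
    (-contractionForm K).toQuadraticMap =
      (0 : QuadraticForm ℂ (Loop 𝔤)) - K.loop.toQuadraticMap := by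
  ext ξ
  simp [contractionForm_self]

/-- The normal ordering map `n : Cl(L𝔤_ℂ) → Λ*(L𝔤_ℂ)`, the linear isomorphism with
`n (ω⁺ · ω⁻) = ch ω⁺ ∧ ch ω⁻` for `ω⁺ ∈ Cl(𝔤_ℂ ⊕ L𝔤_ℂ⁺)` and `ω⁻ ∈ Cl(L𝔤_ℂ⁻)` (this is
`normalOrder_mul` below). It is given by `n 1 = 1` and `n (ξ · x) = ξ ∧ n x + ι (n x)`, with `ι` the
interior product with the functional `η ↦ ⟨ξ⁰, η⟩ + 2⟨ξ⁻, η⟩`. -/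
def normalOrder : K.LoopCl ≃ₗ[ℂ] ExteriorAlgebra ℂ (Loop 𝔤) :=
  CliffordAlgebra.changeFormEquiv (neg_contractionForm_toQuadraticMap K)

/-- The restriction of the quadratic form of `L𝔤_ℂ` to a subspace. -/
def quadRestrict (V : Submodule ℂ (Loop 𝔤)) : QuadraticForm ℂ V :=
  QuadraticMap.comp K.loop.toQuadraticMap V.subtype

/-- `Cl(V)` for a subspace `V ⊆ L𝔤_ℂ`. -/
abbrev SubCl (V : Submodule ℂ (Loop 𝔤)) : Type _ :=
  CliffordAlgebra (R := ℂ) (M := V) (quadRestrict K V)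

/-- The inclusion `Cl(V) ⊆ Cl(L𝔤_ℂ)` for a subspace `V ⊆ L𝔤_ℂ`. -/
def clInclusion (V : Submodule ℂ (Loop 𝔤)) :
    SubCl K V →ₐ[ℂ] K.LoopCl :=
  CliffordAlgebra.map (M₁ := V) ⟨V.subtype, fun _ => rfl⟩

theorem clInclusion_ι_mul (V : Submodule ℂ (Loop 𝔤)) (v : V)
    (x : SubCl K V) :
    clInclusion K V (CliffordAlgebra.ι _ v * x) =
      CliffordAlgebra.ι _ (v : Loop 𝔤) * clInclusion K V x := by
  rw [map_mul]
  congr 1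
  exact CliffordAlgebra.map_apply_ι _ _

theorem chevalley_ι_mul (ξ : Loop 𝔤) (x : K.LoopCl) :
    chevalley K (CliffordAlgebra.ι _ ξ * x) = ExteriorAlgebra.ι ℂ ξ * chevalley K x +
      CliffordAlgebra.contractLeft (K.loop ξ) (chevalley K x) := by
  refine (CliffordAlgebra.changeForm_ι_mul (neg_loop_toQuadraticMap K) ξ x).trans ?_
  rw [LinearMap.neg_apply, map_neg, LinearMap.neg_apply, sub_neg_eq_add]
  rfl

theorem normalOrder_ι_mul (ξ : Loop 𝔤) (x : K.LoopCl) :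
    normalOrder K (CliffordAlgebra.ι _ ξ * x) = ExteriorAlgebra.ι ℂ ξ * normalOrder K x +
      CliffordAlgebra.contractLeft (contractionForm K ξ) (normalOrder K x) := by
  refine (CliffordAlgebra.changeForm_ι_mul (neg_contractionForm_toQuadraticMap K) ξ x).trans ?_
  rw [LinearMap.neg_apply, map_neg, LinearMap.neg_apply, sub_neg_eq_add]
  rfl

theorem contractLeft_chevalley_eq_zero (V : Submodule ℂ (Loop 𝔤)) (d : Module.Dual ℂ (Loop 𝔤))
    (hd : ∀ v ∈ V, d v = 0) (x : SubCl K V) :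
    CliffordAlgebra.contractLeft d (chevalley K (clInclusion K V x)) = 0 := by
  have h0 : CliffordAlgebra.contractLeft d (clInclusion K V x) = 0 := by
    induction x using CliffordAlgebra.left_induction with
    | algebraMap r => simp
    | add x y hx hy => simp only [map_add, hx, hy, add_zero]
    | ι_mul x v hx =>
      rw [clInclusion_ι_mul, CliffordAlgebra.contractLeft_ι_mul, hx, hd v v.2, zero_smul, mul_zero,
        sub_zero]
  have h1 := CliffordAlgebra.changeForm_contractLeft (neg_loop_toQuadraticMap K) d (clInclusion K V x)
  rw [h0, map_zero] at h1
  exact h1.symm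

theorem contractionForm_eq (ξ η : Loop 𝔤) : contractionForm K ξ η =
    K.cplx (coeff 0 ξ) (coeff 0 η) + 2 * K.loop (negPart ξ) (posPart η) := by
  induction ξ using loop_induction with
  | h0 => simp
  | hadd ξ ξ' h h' => simp only [map_add, LinearMap.add_apply, h, h']; ring
  | hmode m X =>
    induction η using loop_induction with
    | h0 => simp
    | hadd ξ ξ' h h' => simp only [map_add, h, h']; ring
    | hmode n Y =>
      simp only [contractionForm, LinearMap.comp_apply, negPart, posPart, multiplier_mode, map_smul,
        LinearMap.smul_apply, loop_mode, coeff_mode]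
      by_cases h : m + n = 0
      · obtain rfl : n = -m := by omega
        rcases lt_trichotomy m 0 with hm | rfl | hm
        · simp [hm, hm.ne]
        · simp
        · simp [hm.ne', not_lt.2 hm.le]
      · rcases eq_or_ne m 0 with rfl | hm
        · have : n ≠ 0 := by omega
          simp [this]
        · simp [h, hm]

theorem coeff_zero_of_mem_neg {η : Loop 𝔤} (hη : η ∈ LoopNeg 𝔤) : coeff 0 η = 0 := by
  obtain ⟨ζ, rfl⟩ := hη
  induction ζ using loop_induction with
  | h0 => simp
  | hadd ξ ξ' h h' => simp [h, h']
  | hmode m X =>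
    rw [negPart, multiplier_mode, map_smul, coeff_mode]
    rcases eq_or_ne m 0 with rfl | hm
    · simp
    · simp [hm]

theorem posPart_of_mem_neg {η : Loop 𝔤} (hη : η ∈ LoopNeg 𝔤) : posPart η = 0 := by
  obtain ⟨ζ, rfl⟩ := hη
  induction ζ using loop_induction with
  | h0 => simp
  | hadd ξ ξ' h h' => simp [h, h']
  | hmode m X =>
    rw [negPart, multiplier_mode, map_smul, posPart, multiplier_mode]
    rcases lt_or_ge m 0 with hm | hm
    · simp [not_lt.2 hm.le]
    · simp [not_lt.2 hm]

theorem contractionForm_nonneg {ξ η : Loop 𝔤} (hξ : ξ ∈ LoopNonneg 𝔤) (hη : η ∈ LoopNonneg 𝔤) :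
    contractionForm K ξ η = K.loop ξ η := by
  rw [LoopNonneg, LinearMap.mem_ker] at hξ hη
  simp [contractionForm_eq, loop_decomp K ξ η, hξ, hη]

theorem contractionForm_neg {ξ η : Loop 𝔤} (hξ : ξ ∈ LoopNeg 𝔤) (hη : η ∈ LoopNeg 𝔤) :
    contractionForm K ξ η = 0 ∧ K.loop ξ η = 0 := by
  simp [contractionForm_eq, loop_decomp K ξ η, coeff_zero_of_mem_neg hη, posPart_of_mem_neg hη,
    posPart_of_mem_neg hξ]

theorem contractionForm_nonneg_neg {ξ η : Loop 𝔤} (hξ : ξ ∈ LoopNonneg 𝔤) (hη : η ∈ LoopNeg 𝔤) :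
    contractionForm K ξ η = 0 := by
  rw [LoopNonneg, LinearMap.mem_ker] at hξ
  simp [contractionForm_eq, hξ, coeff_zero_of_mem_neg hη]

theorem contractLeft_mul_of_eq_zero (d : Module.Dual ℂ (Loop 𝔤))
    (x y : ExteriorAlgebra ℂ (Loop 𝔤)) (hy : CliffordAlgebra.contractLeft d y = 0) :
    CliffordAlgebra.contractLeft d (x * y) = CliffordAlgebra.contractLeft d x * y := by
  induction x using CliffordAlgebra.left_induction with
  | algebraMap r => simp [CliffordAlgebra.contractLeft_algebraMap_mul, hy]
  | add x x' hx hx' => rw [add_mul, map_add, map_add, add_mul, hx, hx']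
  | ι_mul x v hx =>
    rw [mul_assoc, CliffordAlgebra.contractLeft_ι_mul, CliffordAlgebra.contractLeft_ι_mul, hx,
      sub_mul, smul_mul_assoc, mul_assoc]

theorem normalOrder_mul (x : SubCl K (LoopNonneg 𝔤))
    (y : SubCl K (LoopNeg 𝔤)) :
    normalOrder K (clInclusion K (LoopNonneg 𝔤) x * clInclusion K (LoopNeg 𝔤) y) =
      chevalley K (clInclusion K (LoopNonneg 𝔤) x) * chevalley K (clInclusion K (LoopNeg 𝔤) y) := by
  induction x using CliffordAlgebra.left_induction with
  | algebraMap r =>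
    have hch : ∀ r : ℂ, chevalley K (algebraMap ℂ _ r) = algebraMap ℂ _ r := fun r =>
      CliffordAlgebra.changeForm_algebraMap (neg_loop_toQuadraticMap K) r
    have hno : ∀ r : ℂ, normalOrder K (algebraMap ℂ _ r) = algebraMap ℂ _ r := fun r =>
      CliffordAlgebra.changeForm_algebraMap (neg_contractionForm_toQuadraticMap K) r
    have hy : normalOrder K (clInclusion K (LoopNeg 𝔤) y) =
        chevalley K (clInclusion K (LoopNeg 𝔤) y) := by
      induction y using CliffordAlgebra.left_induction with
      | algebraMap r => rw [AlgHom.commutes, hch, hno]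
      | add y z hy hz => simp only [map_add, hy, hz]
      | ι_mul y v hy =>
        rw [clInclusion_ι_mul, chevalley_ι_mul, normalOrder_ι_mul, hy,
          contractLeft_chevalley_eq_zero K _ _ fun w hw => (contractionForm_neg K v.2 hw).1,
          contractLeft_chevalley_eq_zero K _ _ fun w hw => (contractionForm_neg K v.2 hw).2]
    have h1 : clInclusion K (LoopNonneg 𝔤) (algebraMap ℂ _ r) = algebraMap ℂ _ r :=
      AlgHom.commutes _ r
    rw [h1, hch]
    have h2 : algebraMap ℂ K.LoopCl r * clInclusion K (LoopNeg 𝔤) y =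
        r • clInclusion K (LoopNeg 𝔤) y := (Algebra.smul_def _ _).symm
    have h3 : algebraMap ℂ (ExteriorAlgebra ℂ (Loop 𝔤)) r *
        chevalley K (clInclusion K (LoopNeg 𝔤) y) =
          r • chevalley K (clInclusion K (LoopNeg 𝔤) y) := (Algebra.smul_def _ _).symm
    exact (congrArg _ h2).trans (((normalOrder K).map_smul r _).trans
      ((congrArg (r • ·) hy).trans h3.symm))
  | add x z hx hz => simp only [map_add, add_mul, hx, hz]
  | ι_mul x v hx =>
    rw [clInclusion_ι_mul, mul_assoc, chevalley_ι_mul, normalOrder_ι_mul, hx,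
      contractLeft_mul_of_eq_zero _ _ _ (contractLeft_chevalley_eq_zero K _ _ (fun w hw =>
        contractionForm_nonneg_neg K v.2 hw) y), add_mul, mul_assoc]
    congr 2
    rw [← sub_eq_zero, ← LinearMap.sub_apply, ← map_sub]
    refine contractLeft_chevalley_eq_zero K _ _ (fun w hw => ?_) x
    rw [LinearMap.sub_apply, sub_eq_zero]
    exact contractionForm_nonneg K v.2 hw

/-! ### Skew forms and their normal ordered operators -/

variable (𝔤) in
/-- Skew-symmetric `p`-linear forms on `L𝔤_ℂ`. -/
abbrev Form (p : ℕ) : Type _ := Loop 𝔤 [⋀^Fin p]→ₗ[ℂ] ℂ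

/-- The 1-form `ξ* = ⟨ξ, ·⟩`. -/
def star (ξ : Loop 𝔤) : Form 𝔤 1 := AlternatingMap.ofSubsingleton ℂ (Loop 𝔤) ℂ 0 (K.loop ξ)

/-- The 2-form `dξ*(η, ζ) = -½⟨ξ, [η, ζ]⟩`. -/
def dStar (ξ : Loop 𝔤) : Form 𝔤 2 where
  toFun v := -(1 / 2) * K.loop ξ ⁅v 0, v 1⁆
  map_update_add' {inst} v i x y := by
    obtain rfl := Subsingleton.elim inst (instDecidableEqFin _)
    fin_cases i <;> simp [add_lie, lie_add, mul_add]
  map_update_smul' {inst} v i c x := by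
    obtain rfl := Subsingleton.elim inst (instDecidableEqFin _)
    fin_cases i <;> simp [mul_left_comm c]
  map_eq_zero_of_eq' v i j h hij := by
    fin_cases i <;> fin_cases j <;> simp_all

/-- The 2-form `d∂_θ*(ξ, η) = ½⟨ξ, ∂_θ η⟩`. -/
def dRotStar : Form 𝔤 2 where
  toFun v := 1 / 2 * K.loop (v 0) (rot (v 1))
  map_update_add' {inst} v i x y := by
    obtain rfl := Subsingleton.elim inst (instDecidableEqFin _)
    fin_cases i <;> simp [mul_add]
  map_update_smul' {inst} v i c x := by
    obtain rfl := Subsingleton.elim inst (instDecidableEqFin _)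
    fin_cases i <;> simp [mul_left_comm c]
  map_eq_zero_of_eq' v i j h hij := by
    have h0 : ∀ ξ, K.loop ξ (rot ξ) = 0 := fun ξ => self_eq_neg.1 (loop_rot K ξ ξ)
    fin_cases i <;> fin_cases j <;> simp_all

/-- The fundamental 3-form `Ω(ξ, η, ζ) = -⅙⟨ξ, [η, ζ]⟩`. -/
def fundamentalForm : Form 𝔤 3 where
  toFun v := -(1 / 6) * K.loop (v 0) ⁅v 1, v 2⁆
  map_update_add' {inst} v i x y := by
    obtain rfl := Subsingleton.elim inst (instDecidableEqFin _)
    fin_cases i <;> simp [add_lie, lie_add, mul_add]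
  map_update_smul' {inst} v i c x := by
    obtain rfl := Subsingleton.elim inst (instDecidableEqFin _)
    fin_cases i <;> simp [mul_left_comm c]
  map_eq_zero_of_eq' v i j h hij := by
    have h0 : ∀ ξ η, K.loop ξ ⁅ξ, η⁆ = 0 := fun ξ η => by rw [← loop_invariant]; simp
    have h1 : ∀ ξ η, K.loop ξ ⁅η, ξ⁆ = 0 := fun ξ η => by rw [← lie_skew, map_neg, h0, neg_zero]
    fin_cases i <;> fin_cases j <;> simp_all

variable (𝔤) in
/-- The degree `p` part of `Λ*(L𝔤_ℂ)⁺`. Since `(Xzᵏ)*` is nonzero only on loops with a nonzero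
Fourier coefficient of index `-k`, a product of 1-forms dual to modes is detected by its values on
modes `X₁ z^{k₁}, …, X_p z^{k_p}`, and its total negative energy is `-∑ max(kⱼ, 0)`. The condition
says that only finitely many such products of each given negative energy occur. -/
def FormPlus (p : ℕ) : Submodule ℂ (Form 𝔤 p) where
  carrier := {ω | ∀ N : ℤ, {k : Fin p → ℤ | ∑ j, max (k j) 0 ≤ N ∧
    ∃ X : Fin p → Cplx 𝔤, ω (fun j => mode (k j) (X j)) ≠ 0}.Finite}
  zero_mem' N := by simp
  add_mem' {ω ω'} h h' N := by
    refine ((h N).union (h' N)).subset ?_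
    rintro k ⟨hk, X, hX⟩
    by_cases h0 : ω (fun j => mode (k j) (X j)) = 0
    · exact Or.inr ⟨hk, X, fun h1 => hX (by simp [h0, h1])⟩
    · exact Or.inl ⟨hk, X, h0⟩
  smul_mem' c ω h N := by
    refine (h N).subset ?_
    rintro k ⟨hk, X, hX⟩
    exact ⟨hk, X, fun h1 => hX (by simp [h1])⟩

section Operators

variable {ι : Type*} (b : Module.Basis ι ℝ 𝔤)

/-- The basis element `Xᵢ zᵏ` of `L𝔤_ℂ`, for a basis `{Xᵢ}` of `𝔤`. -/
def loopBasis (f : ι × ℤ) : Loop 𝔤 := mode f.2 (1 ⊗ₜ[ℝ] b f.1)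

/-- The dual basis element `Xᵢ z⁻ᵏ`, for an orthonormal basis `{Xᵢ}` of `𝔤`. -/
def loopDual (f : ι × ℤ) : Loop 𝔤 := mode (-f.2) (1 ⊗ₜ[ℝ] b f.1)

variable {S : Type*} [AddCommGroup S] [Module ℂ S] (ρ : K.Cl →ₐ[ℂ] Module.End ℂ S)

/-- `n(T) = ω`: the operator `T` on the spin representation is the normal ordered operator of the
`p`-form `ω`. Expanding `ω = ∑ ω(X_{f₁}, …, X_{f_p}) X_{f₁}* ∧ ⋯ ∧ X_{f_p}*` as a formal infinite sum
over the orthonormal basis (with `X_f*` the dual basis), this says that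
`T = ∑ ω(X_{f₁}, …, X_{f_p}) n⁻¹(X_{f₁}* ∧ ⋯ ∧ X_{f_p}*)`, where on each vector of the spin
representation all but finitely many terms of the sum vanish. -/
def IsNormalOrdered {p : ℕ} (ω : Form 𝔤 p) (T : Module.End ℂ (SpinSpace 𝔤 S)) : Prop :=
  ∀ v : SpinSpace 𝔤 S,
    let term : (Fin p → ι × ℤ) → SpinSpace 𝔤 S := fun f =>
      ω (fun j => loopBasis b (f j)) • spinRep K ρ
        ((normalOrder K).symm (ExteriorAlgebra.ιMulti ℂ p fun j => loopDual b (f j))) v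
    (Function.support term).Finite ∧ T v = ∑ᶠ f, term f

/-- The quadratic Casimir operator `Δ_ad = -½ ∑ (ad Xᵢ)²` in the adjoint representation. -/
def casimirAd [Fintype ι] : Module.End ℝ 𝔤 :=
  -(1 / 2 : ℝ) • ∑ i, LieAlgebra.ad ℝ 𝔤 (b i) * LieAlgebra.ad ℝ 𝔤 (b i)

end Operators

/-- `V₀ ⊕ V₁` is a Lie superalgebra inside an associative algebra, with even part `V₀` and odd part
`V₁`, for the supercommutator (which then satisfies the super Jacobi identity). -/
structure IsLieSuperalgebra {A : Type*} [Ring A] [Algebra ℂ A] (V₀ V₁ : Submodule ℂ A) : Prop where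
  disjoint : Disjoint V₀ V₁
  even_even : ∀ x ∈ V₀, ∀ y ∈ V₀, x * y - y * x ∈ V₀
  even_odd : ∀ x ∈ V₀, ∀ y ∈ V₁, x * y - y * x ∈ V₁
  odd_odd : ∀ x ∈ V₁, ∀ y ∈ V₁, x * y + y * x ∈ V₀

end LoopClifford

end

set_option linter.unusedSectionVars false

open scoped TensorProduct

noncomputable section

namespace LoopClifford

variable {𝔤 : Type*} [LieRing 𝔤] [LieAlgebra ℝ 𝔤] (K : InvariantInnerProduct 𝔤)
  {ι : Type*} [Fintype ι] [DecidableEq ι] (b : Module.Basis ι ℝ 𝔤)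

/-! ### Sums over an orthonormal basis -/

/-! The spin representation enters only through three properties, collected in
`PositiveEnergyModule`: the Clifford relations, the vanishing of sufficiently negative modes on each
vector, and generation from the vacuum vectors (those killed by all negative modes) by the positive
modes. They give a rigidity principle, `eq_of_commute` and `eq_of_anticommute`: two operators
coincide if they have the same (anti)commutators with all Clifford multiplications and agree on the
vacuum.

Brackets with a Clifford multiplication follow from Wick contraction of normal ordered monomials
(`op₂_comm_cl`, `op₃_anticomm_cl`) and involve no anomaly. Each remaining bracket is then known up
to an operator that commutes or anticommutes with all Clifford multiplications, and such an operator
is found in one of two ways. It commutes with every quadratic operator, in particular with `adsRot`,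
so it vanishes if it has nonzero energy (`cocycle_mode_of_ne`, `gamma_comm_ads`). In energy zero it
is evaluated on the vacuum, where the formal infinite sums become finite (`ads_mode_vacuum`,
`gamma_vacuum`).

The central term arises from commuting negative modes past `m` pairs of modes, each contributing the
trace of `ad Y ad X`, which is `-2c⟨X, Y⟩` (`ads_quad_vacuum`). On the vacuum `γ` reduces to the
cubic element of the finite dimensional Clifford algebra; its square is computed from the Jacobi
identity and the Casimir eigenvalue (`sum_spin_mul_spin`), which yields `c dim 𝔤 / 24`. That the
Casimir operator is a scalar is a Schur argument over `ℝ`: the Killing form has a real eigenvector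
relative to the inner product, and its eigenspace is an ideal. -/

/-- The basis `b` is orthonormal. -/
def InvariantInnerProduct.IsOrthonormal : Prop :=
  ∀ i j, K.form (b i) (b j) = if i = j then 1 else 0

/-- The basis of `𝔤_ℂ` induced by a basis of `𝔤`. -/
def cplxBasis : Module.Basis ι ℂ (Cplx 𝔤) := Algebra.TensorProduct.basis ℂ b

theorem cplxBasis_apply (i : ι) : cplxBasis b i = 1 ⊗ₜ[ℝ] b i :=
  Algebra.TensorProduct.basis_apply b i

section Orthonormal

variable {K b}

theorem cplx_cplxBasis (hb : K.IsOrthonormal b) (i j : ι) :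
    K.cplx (cplxBasis b i) (cplxBasis b j) = if i = j then 1 else 0 := by
  simp only [cplxBasis_apply, InvariantInnerProduct.cplx, LinearMap.BilinForm.baseChange_tmul,
    hb i j]
  split_ifs <;> simp

theorem sum_cplx_smul (hb : K.IsOrthonormal b) (X : Cplx 𝔤) :
    ∑ i, K.cplx X (cplxBasis b i) • cplxBasis b i = X := by
  conv_rhs => rw [← (cplxBasis b).sum_repr X]
  refine Finset.sum_congr rfl fun i _ => ?_
  congr 1
  conv_lhs => rw [← (cplxBasis b).sum_repr X]
  simp only [map_sum, map_smul, LinearMap.sum_apply, LinearMap.smul_apply, cplx_cplxBasis hb]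
  simp

/-- The tensor `∑ Xₖ ⊗ Xₖ` is invariant. -/
theorem sum_lie_mul (hb : K.IsOrthonormal b) {A : Type*} [Ring A] [Algebra ℂ A]
    (f g : Cplx 𝔤 →ₗ[ℂ] A) (X : Cplx 𝔤) :
    ∑ k, f ⁅X, cplxBasis b k⁆ * g (cplxBasis b k) =
      -∑ k, f (cplxBasis b k) * g ⁅X, cplxBasis b k⁆ := by
  have h1 : ∀ k, f ⁅X, cplxBasis b k⁆ * g (cplxBasis b k) =
      ∑ i, K.cplx ⁅X, cplxBasis b k⁆ (cplxBasis b i) • (f (cplxBasis b i) * g (cplxBasis b k)) := by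
    intro k
    conv_lhs => rw [← sum_cplx_smul hb ⁅X, cplxBasis b k⁆]
    simp [map_sum, Finset.sum_mul]
  have h2 : ∀ i, f (cplxBasis b i) * g ⁅X, cplxBasis b i⁆ =
      ∑ k, K.cplx ⁅X, cplxBasis b i⁆ (cplxBasis b k) • (f (cplxBasis b i) * g (cplxBasis b k)) := by
    intro k
    conv_lhs => rw [← sum_cplx_smul hb ⁅X, cplxBasis b k⁆]
    simp [map_sum, Finset.mul_sum]
  simp only [h1, h2]
  rw [Finset.sum_comm, ← Finset.sum_neg_distrib]
  refine Finset.sum_congr rfl fun i _ => ?_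
  rw [← Finset.sum_neg_distrib]
  refine Finset.sum_congr rfl fun k _ => ?_
  -- What remains is that the matrix of `ad X` in an orthonormal basis is skew.
  rw [← neg_smul]
  congr 1
  rw [← lie_skew, map_neg, LinearMap.neg_apply, cplx_invariant, cplx_symm]

theorem loop_loopBasis_loopDual (hb : K.IsOrthonormal b) (f g : ι × ℤ) :
    K.loop (loopBasis b f) (loopDual b g) = if f = g then 1 else 0 := by
  rw [loopBasis, loopDual, loop_mode, ← cplxBasis_apply, ← cplxBasis_apply, cplx_cplxBasis hb]
  by_cases h1 : f.1 = g.1 <;> by_cases h2 : f.2 = g.2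
  · simp [Prod.ext_iff, h1, h2]
  · simp [Prod.ext_iff, h2, add_neg_eq_zero]
  · simp [Prod.ext_iff, h1]
  · simp [Prod.ext_iff, h1]

end Orthonormal

theorem span_loopBasis : Submodule.span ℂ (Set.range (loopBasis b)) = ⊤ := by
  refine eq_top_iff.2 fun ξ _ => ?_
  induction ξ using loop_induction with
  | h0 => exact zero_mem _
  | hadd ξ η h h' => exact add_mem (h trivial) (h' trivial)
  | hmode n X =>
    have hX : X ∈ Submodule.span ℂ (Set.range (cplxBasis b)) := by simp
    clear * - hX
    induction hX using Submodule.span_induction with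
    | mem x h =>
      obtain ⟨i, rfl⟩ := h
      exact Submodule.subset_span ⟨(i, n), by rw [loopBasis, cplxBasis_apply]⟩
    | zero => simp
    | add x y _ _ hx hy => rw [map_add]; exact add_mem hx hy
    | smul a x _ hx => rw [map_smul]; exact Submodule.smul_mem _ _ hx

theorem span_loopDual : Submodule.span ℂ (Set.range (loopDual b)) = ⊤ := by
  rw [← span_loopBasis b]
  congr 1
  ext ξ
  constructor
  · rintro ⟨f, rfl⟩
    exact ⟨(f.1, -f.2), rfl⟩
  · rintro ⟨f, rfl⟩
    exact ⟨(f.1, -f.2), by simp [loopDual, loopBasis]⟩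

/-- A linear statement about loops can be checked on a basis. -/
theorem ext_loopBasis {M : Type*} [AddCommGroup M] [Module ℂ M] {f g : Loop 𝔤 →ₗ[ℂ] M}
    (h : ∀ a, f (loopBasis b a) = g (loopBasis b a)) : f = g :=
  LinearMap.ext_on_range (span_loopBasis b) h

theorem ext_mode {M : Type*} [AddCommGroup M] [Module ℂ M] {f g : Loop 𝔤 →ₗ[ℂ] M}
    (h : ∀ n X, f (mode n X) = g (mode n X)) : f = g := by
  refine LinearMap.ext fun ξ => ?_
  induction ξ using loop_induction with
  | h0 => simp
  | hadd ξ η h h' => simp [h, h']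
  | hmode n X => exact h n X

section Orthonormal

variable {K b}

/-- By linearity it suffices to take `ξ` in the dual basis, where a single term survives. Finite
support is proved along with the value because `finsum` is additive only on families of finite
support. -/
theorem loop_expansion (hb : K.IsOrthonormal b) {M : Type*} [AddCommGroup M] [Module ℂ M]
    (t : Loop 𝔤 →ₗ[ℂ] M) (ξ : Loop 𝔤) :
    (Function.support fun f => K.loop ξ (loopBasis b f) • t (loopDual b f)).Finite ∧
      ∑ᶠ f, K.loop ξ (loopBasis b f) • t (loopDual b f) = t ξ := by
  have hξ : ξ ∈ Submodule.span ℂ (Set.range (loopDual b)) := by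
    rw [span_loopDual]; trivial
  induction hξ using Submodule.span_induction with
  | mem x h =>
    obtain ⟨g, rfl⟩ := h
    have hs : (Function.support fun f => K.loop (loopDual b g) (loopBasis b f) •
        t (loopDual b f)) ⊆ {g} := by
      intro f hf
      by_contra hfg
      refine hf ?_
      simp only
      rw [loop_symm, loop_loopBasis_loopDual hb, if_neg (Set.mem_singleton_iff.not.1 hfg), zero_smul]
    refine ⟨(Set.finite_singleton g).subset hs, ?_⟩
    rw [finsum_eq_single _ g fun f hf => ?_, loop_symm, loop_loopBasis_loopDual hb, if_pos rfl,
      one_smul]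
    by_contra h
    exact hf (hs h)
  | zero => simp
  | add x y _ _ hx hy =>
    simp only [map_add, LinearMap.add_apply, add_smul]
    refine ⟨(hx.1.union hy.1).subset (Function.support_add _ _), ?_⟩
    rw [finsum_add_distrib hx.1 hy.1, hx.2, hy.2]
  | smul a x _ hx =>
    simp only [map_smul, LinearMap.smul_apply, smul_assoc]
    refine ⟨hx.1.subset (Function.support_const_smul_subset _ _), ?_⟩
    rw [← smul_finsum, hx.2]

end Orthonormal

/-! ### The Casimir operator -/

/-- The factor `-2` undoes the `-½` in the Casimir operator. Bracketing with `1 ⊗ Xₖ` is complex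
linear, so the real identity passes to the complexification. -/
theorem sum_lie_lie {c : ℝ} (hc : casimirAd b = c • (1 : Module.End ℝ 𝔤)) (X : Cplx 𝔤) :
    ∑ k, ⁅cplxBasis b k, ⁅cplxBasis b k, X⁆⁆ = (-2 * c : ℂ) • X := by
  induction X using TensorProduct.induction_on with
  | zero => simp
  | add X Y h h' => simp only [lie_add, Finset.sum_add_distrib, h, h', smul_add]
  | tmul a x =>
    have h := congrArg (fun T : Module.End ℝ 𝔤 => T x) hc
    simp only [casimirAd, LinearMap.smul_apply, LinearMap.sum_apply, Module.End.mul_apply,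
      LieAlgebra.ad_apply, Module.End.one_apply] at h
    have h2 : ∑ i, ⁅b i, ⁅b i, x⁆⁆ = (-2 * c) • x := by
      rw [mul_smul, ← h, smul_smul]; norm_num
    simp only [cplxBasis_apply, LieAlgebra.ExtendScalars.bracket_tmul, one_mul]
    rw [← TensorProduct.tmul_sum, h2, TensorProduct.tmul_smul, TensorProduct.smul_tmul',
      TensorProduct.smul_tmul', Complex.real_smul, smul_eq_mul]
    push_cast
    rfl

/-- The trace form of the adjoint representation. -/
theorem sum_cplx_lie_lie {c : ℝ}
    (hc : casimirAd b = c • (1 : Module.End ℝ 𝔤)) (X Y : Cplx 𝔤) :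
    ∑ k, K.cplx ⁅Y, ⁅X, cplxBasis b k⁆⁆ (cplxBasis b k) = -2 * c * K.cplx X Y := by
  have h1 : ∀ k, K.cplx ⁅Y, ⁅X, cplxBasis b k⁆⁆ (cplxBasis b k) =
      K.cplx Y ⁅cplxBasis b k, ⁅cplxBasis b k, X⁆⁆ := by
    intro k
    rw [cplx_invariant, ← lie_skew (cplxBasis b k) X, lie_neg, lie_skew]
  simp only [h1]
  rw [← map_sum, sum_lie_lie b hc, map_smul, cplx_symm]
  rfl

end LoopClifford

end

noncomputable section

namespace LoopClifford

variable {𝔤 : Type*} [LieRing 𝔤] [LieAlgebra ℝ 𝔤]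

/-! ### Positive energy modules -/

/-- A positive energy module of the Clifford algebra of `L𝔤_ℂ`: negative modes act locally
nilpotently, and the module is generated by the vacuum vectors. -/
structure PositiveEnergyModule (K : InvariantInnerProduct 𝔤) (V : Type*) [AddCommGroup V]
    [Module ℂ V] where
  cl : Loop 𝔤 →ₗ[ℂ] Module.End ℂ V
  clifford : ∀ ξ η, cl ξ * cl η + cl η * cl ξ = (2 * K.loop ξ η) • 1
  exists_energy_bound : ∀ v, ∃ N : ℤ, 0 ≤ N ∧ ∀ n X, N < n → cl (mode (-n) X) v = 0
  eq_top_of_vacuum : ∀ W : Submodule ℂ V, (∀ v, (∀ n X, n < 0 → cl (mode n X) v = 0) → v ∈ W) →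
    (∀ n X, 0 < n → ∀ v ∈ W, cl (mode n X) v ∈ W) → W = ⊤

variable {K : InvariantInnerProduct 𝔤} {V : Type*} [AddCommGroup V] [Module ℂ V]

theorem contractionForm_mode (m n : ℤ) (X Y : Cplx 𝔤) :
    contractionForm K (mode m X) (mode n Y) =
      (if m < 0 then 2 else if m = 0 then 1 else 0) * if m + n = 0 then K.cplx X Y else 0 := by
  rw [contractionForm, LinearMap.comp_apply, multiplier_mode, map_smul, LinearMap.smul_apply,
    loop_mode, smul_eq_mul]

theorem contractionForm_add_swap (ξ η : Loop 𝔤) :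
    contractionForm K ξ η + contractionForm K η ξ = 2 * K.loop ξ η := by
  have h := contractionForm_self K (ξ + η)
  simp only [map_add, LinearMap.add_apply, contractionForm_self] at h
  rw [loop_symm K η ξ] at h
  linear_combination h

/-- A negative mode pairs only with positive modes, and those are discarded from the left argument
of the contraction. Hence an annihilating mode at the right end of a monomial needs no correction.
-/
theorem contractionForm_mode_neg (ξ : Loop 𝔤) {n : ℤ} (hn : 0 < n) (Y : Cplx 𝔤) :
    contractionForm K ξ (mode (-n) Y) = 0 := by
  induction ξ using loop_induction with
  | h0 => simp
  | hadd ξ ξ' h h' => simp [h, h']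
  | hmode m X =>
    rw [contractionForm_mode]
    by_cases h : m + -n = 0
    · rw [if_neg (by omega), if_neg (by omega), zero_mul]
    · rw [if_neg h, mul_zero]

namespace PositiveEnergyModule

variable (P : PositiveEnergyModule K V)

/-- A vacuum vector is annihilated by all negative modes. -/
def IsVacuum (v : V) : Prop := ∀ n X, n < 0 → P.cl (mode n X) v = 0

variable {P} in
theorem IsVacuum.cl_mode {v : V} (hv : P.IsVacuum v) {n : ℤ} (hn : n < 0) (X : Cplx 𝔤) :
    P.cl (mode n X) v = 0 := hv n X hn

theorem cl_swap (ξ η : Loop 𝔤) : P.cl ξ * P.cl η = (2 * K.loop ξ η) • 1 - P.cl η * P.cl ξ :=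
  eq_sub_of_add_eq (P.clifford ξ η)

theorem cl_swap_apply (ξ η : Loop 𝔤) (v : V) :
    P.cl ξ (P.cl η v) = (2 * K.loop ξ η) • v - P.cl η (P.cl ξ v) :=
  congrArg (fun T : Module.End ℂ V => T v) (P.cl_swap ξ η)

variable {P} in
theorem IsVacuum.cl_zero {v : V} (hv : P.IsVacuum v) (X : Cplx 𝔤) :
    P.IsVacuum (P.cl (mode 0 X) v) := by
  intro n Y hn
  rw [cl_swap_apply, hv.cl_mode hn, loop_mode, if_neg (by omega)]
  simp

variable {P} in
theorem IsVacuum.cl_cl_of_neg {v : V} (hv : P.IsVacuum v) {m n : ℤ} (hm : m < 0) (X Y : Cplx 𝔤) :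
    P.cl (mode m X) (P.cl (mode n Y) v) = if m + n = 0 then (2 * K.cplx X Y) • v else 0 := by
  rw [cl_swap_apply, hv.cl_mode hm, loop_mode]
  split_ifs <;> simp

/-- An operator that commutes with the Clifford multiplications is determined on the vacuum. -/
theorem eq_of_commute {T T' : Module.End ℂ V} (h : ∀ ξ, T * P.cl ξ - P.cl ξ * T =
    T' * P.cl ξ - P.cl ξ * T') (hv : ∀ v, P.IsVacuum v → T v = T' v) : T = T' := by
  have := P.eq_top_of_vacuum (LinearMap.ker (T - T')) (fun v h => by simp [hv v h]) ?_
  · rwa [LinearMap.ker_eq_top, sub_eq_zero] at this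
  -- Equal commutators with `cl` make the kernel of `T - T'` stable under the positive modes.
  · intro n X _ v hw
    have h1 := congrArg (fun S : Module.End ℂ V => S v) (h (mode n X))
    simp only [LinearMap.mem_ker, LinearMap.sub_apply, Module.End.mul_apply, sub_eq_zero] at hw h1 ⊢
    rw [hw] at h1
    exact sub_left_injective h1

theorem eq_of_anticommute {T T' : Module.End ℂ V} (h : ∀ ξ, T * P.cl ξ + P.cl ξ * T =
    T' * P.cl ξ + P.cl ξ * T') (hv : ∀ v, P.IsVacuum v → T v = T' v) : T = T' := by
  have := P.eq_top_of_vacuum (LinearMap.ker (T - T')) (fun v h => by simp [hv v h]) ?_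
  · rwa [LinearMap.ker_eq_top, sub_eq_zero] at this
  · intro n X _ v hw
    have h1 := congrArg (fun S : Module.End ℂ V => S v) (h (mode n X))
    simp only [LinearMap.mem_ker, LinearMap.sub_apply, LinearMap.add_apply,
      Module.End.mul_apply, sub_eq_zero] at hw h1 ⊢
    rw [hw] at h1
    exact add_left_injective _ h1

/-! #### Normal ordered monomials -/

/-- The normal ordered product of two loops. -/
def no₂ (ξ η : Loop 𝔤) : Module.End ℂ V := P.cl ξ * P.cl η - contractionForm K ξ η • 1

/-- The normal ordered product of three loops. -/
def no₃ (ξ η ζ : Loop 𝔤) : Module.End ℂ V :=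
  P.cl ξ * P.no₂ η ζ - contractionForm K ξ η • P.cl ζ + contractionForm K ξ ζ • P.cl η

/-- The two contractions add up to `2⟨ξ, η⟩`, exactly the symmetric part of the Clifford product. -/
theorem no₂_swap (ξ η : Loop 𝔤) : P.no₂ ξ η = -P.no₂ η ξ := by
  rw [no₂, no₂, cl_swap, ← contractionForm_add_swap, add_smul]
  abel

theorem no₃_swap_right (ξ η ζ : Loop 𝔤) : P.no₃ ξ η ζ = -P.no₃ ξ ζ η := by
  rw [no₃, no₃, no₂_swap, mul_neg]
  abel

theorem no₃_swap_left (ξ η ζ : Loop 𝔤) : P.no₃ ξ η ζ = -P.no₃ η ξ ζ := by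
  simp only [no₃, no₂, mul_sub, ← mul_assoc, mul_smul_comm, mul_one]
  rw [cl_swap P ξ η, ← contractionForm_add_swap, add_smul, sub_mul, add_mul, smul_mul_assoc,
    smul_mul_assoc, one_mul]
  abel

theorem no₂_mode_neg (ξ : Loop 𝔤) {n : ℤ} (hn : 0 < n) (X : Cplx 𝔤) {v : V}
    (hv : P.cl (mode (-n) X) v = 0) : P.no₂ ξ (mode (-n) X) v = 0 := by
  simp [no₂, contractionForm_mode_neg ξ hn, hv]

theorem no₃_mode_neg (ξ η : Loop 𝔤) {n : ℤ} (hn : 0 < n) (X : Cplx 𝔤) {v : V}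
    (hv : P.cl (mode (-n) X) v = 0) : P.no₃ ξ η (mode (-n) X) v = 0 := by
  simp [no₃, no₂_mode_neg P η hn X hv, contractionForm_mode_neg ξ hn, hv]

/-- The contraction subtracted in `no₂` is central, so the commutator depends only on the inner
product and not on the choice of ordering. -/
theorem no₂_comm_cl (ξ η τ : Loop 𝔤) : P.no₂ ξ η * P.cl τ - P.cl τ * P.no₂ ξ η =
    (2 * K.loop η τ) • P.cl ξ - (2 * K.loop ξ τ) • P.cl η := by
  simp only [no₂, sub_mul, mul_sub, smul_mul_assoc, mul_smul_comm, one_mul, mul_one]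
  rw [mul_assoc, cl_swap P η τ, ← mul_assoc (P.cl τ), cl_swap P τ ξ, loop_symm K τ ξ]
  simp only [sub_mul, mul_sub, smul_mul_assoc, mul_smul_comm, one_mul, mul_one, mul_assoc]
  abel

/-- Removing one factor from a cubic monomial leaves plain products together with the contractions
that complete them to normal ordered ones. -/
theorem no₃_comm_cl (ξ η ζ τ : Loop 𝔤) : P.no₃ ξ η ζ * P.cl τ + P.cl τ * P.no₃ ξ η ζ =
    (2 * K.loop ζ τ) • P.no₂ ξ η - (2 * K.loop η τ) • P.no₂ ξ ζ +
      (2 * K.loop ξ τ) • P.no₂ η ζ := by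
  have h1 := P.no₂_comm_cl η ζ τ
  rw [sub_eq_iff_eq_add] at h1
  rw [no₃]
  simp only [sub_mul, mul_sub, add_mul, mul_add, smul_mul_assoc, mul_smul_comm]
  rw [mul_assoc (P.cl ξ), h1, ← mul_assoc (P.cl τ), cl_swap P τ ξ, cl_swap P τ ζ, cl_swap P τ η,
    loop_symm K τ ξ, loop_symm K τ ζ, loop_symm K τ η]
  simp only [no₂, sub_mul, mul_sub, mul_add, smul_mul_assoc, mul_smul_comm, one_mul,
    mul_one, mul_assoc, smul_sub, smul_smul]
  module

end PositiveEnergyModule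

end LoopClifford

end

noncomputable section

namespace LoopClifford

variable {𝔤 : Type*} [LieRing 𝔤] [LieAlgebra ℝ 𝔤]

/-! ### Forms in the normal ordered completion -/

/-- For a form of fixed total energy a bound on the positive parts of the indices also bounds the
negative parts, so all indices lie in the interval `[M - N, N]`. -/
theorem mem_formPlus_of_sum_eq {p : ℕ} {ω : Form 𝔤 p} (M : ℤ)
    (h : ∀ (k : Fin p → ℤ) (X : Fin p → Cplx 𝔤), ω (fun j => mode (k j) (X j)) ≠ 0 → ∑ j, k j = M) :
    ω ∈ FormPlus 𝔤 p := by
  intro N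
  refine (Set.finite_Icc (fun _ => M - N) (fun _ => N)).subset ?_
  rintro k ⟨hk, X, hX⟩
  have hM := h k X hX
  have h1 : ∑ j, max (-k j) 0 ≤ N - M := by
    have : ∑ j, max (-k j) 0 = ∑ j, max (k j) 0 - ∑ j, k j := by
      rw [← Finset.sum_sub_distrib]
      refine Finset.sum_congr rfl fun j _ => ?_
      omega
    omega
  constructor <;> intro j
  · have := Finset.single_le_sum (f := fun j => max (-k j) 0) (fun i _ => le_max_right _ _)
      (Finset.mem_univ j)
    simp only at this ⊢
    omega
  · have := Finset.single_le_sum (f := fun j => max (k j) 0) (fun i _ => le_max_right _ _)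
      (Finset.mem_univ j)
    simp only at this ⊢
    omega

variable (K : InvariantInnerProduct 𝔤)

theorem star_mem_formPlus (ξ : Loop 𝔤) : star K ξ ∈ FormPlus 𝔤 1 := by
  induction ξ using loop_induction with
  | h0 =>
    convert zero_mem (FormPlus 𝔤 1)
    ext v
    simp [star]
  | hadd ξ η h h' =>
    convert add_mem h h'
    ext v
    simp [star]
  | hmode n X =>
    refine mem_formPlus_of_sum_eq (-n) fun k Y h => ?_
    simp only [star, AlternatingMap.ofSubsingleton_apply_apply, loop_mode, ne_eq, ite_eq_right_iff,
      Classical.not_imp] at h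
    simp only [Finset.univ_unique, Finset.sum_singleton, Fin.default_eq_zero]
    have := h.1
    omega

theorem dStar_apply (ξ : Loop 𝔤) (v : Fin 2 → Loop 𝔤) :
    dStar K ξ v = -(1 / 2) * K.loop ξ ⁅v 0, v 1⁆ := rfl

theorem dRotStar_apply (v : Fin 2 → Loop 𝔤) :
    dRotStar K v = 1 / 2 * K.loop (v 0) (rot (v 1)) := rfl

theorem fundamentalForm_apply (v : Fin 3 → Loop 𝔤) :
    fundamentalForm K v = -(1 / 6) * K.loop (v 0) ⁅v 1, v 2⁆ := rfl

theorem rot_mode (n : ℤ) (X : Cplx 𝔤) : rot (mode n X) = (Complex.I * n) • mode n X :=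
  multiplier_mode _ _ _

/-- `ξ ↦ dξ*` as a linear map. -/
def dStarLinear : Loop 𝔤 →ₗ[ℂ] Form 𝔤 2 where
  toFun := dStar K
  map_add' ξ η := by
    ext v
    simp only [dStar_apply, map_add, LinearMap.add_apply, AlternatingMap.add_apply]
    ring
  map_smul' a ξ := by
    ext v
    simp only [dStar_apply, map_smul, LinearMap.smul_apply, AlternatingMap.smul_apply,
      smul_eq_mul, RingHom.id_apply]
    ring

theorem dStar_mem_formPlus (ξ : Loop 𝔤) : dStar K ξ ∈ FormPlus 𝔤 2 := by
  change dStarLinear K ξ ∈ FormPlus 𝔤 2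
  induction ξ using loop_induction with
  | h0 => simp
  | hadd ξ η h h' => rw [map_add]; exact add_mem h h'
  | hmode n X =>
    refine mem_formPlus_of_sum_eq (-n) fun k Y h => ?_
    change dStar K _ _ ≠ 0 at h
    rw [dStar_apply, lie_mode, loop_mode] at h
    split_ifs at h with h'
    · rw [Fin.sum_univ_two]; omega
    · simp at h

theorem dRotStar_mem_formPlus : dRotStar K ∈ FormPlus 𝔤 2 := by
  refine mem_formPlus_of_sum_eq 0 fun k Y h => ?_
  rw [dRotStar_apply, rot_mode, map_smul, loop_mode] at h
  split_ifs at h with h'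
  · rw [Fin.sum_univ_two]; omega
  · simp at h

theorem fundamentalForm_mem_formPlus : fundamentalForm K ∈ FormPlus 𝔤 3 := by
  refine mem_formPlus_of_sum_eq 0 fun k Y h => ?_
  rw [fundamentalForm_apply, lie_mode, loop_mode] at h
  split_ifs at h with h'
  · rw [Fin.sum_univ_three]; omega
  · simp at h

/-! ### Locally finite sums of normal ordered monomials -/

variable {ι : Type*} [Fintype ι] [DecidableEq ι] (b : Module.Basis ι ℝ 𝔤)

/-- This converts the energy condition into the finiteness used for locally finite sums: if each of
the `p` indices is at most `N`, their positive parts sum to at most `p * max N 0`. -/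
theorem finite_setOf_ne_zero {p : ℕ} {ω : Form 𝔤 p} (hω : ω ∈ FormPlus 𝔤 p) (N : ℤ) :
    {f : Fin p → ι × ℤ | (∀ j, (f j).2 ≤ N) ∧ ω (fun j => loopBasis b (f j)) ≠ 0}.Finite := by
  have hinj : Function.Injective
      fun f : Fin p → ι × ℤ => ((fun j => (f j).1, fun j => (f j).2) : (Fin p → ι) × (Fin p → ℤ)) := by
    intro f g h
    ext j
    · exact congrFun (congrArg Prod.fst h) j
    · exact congrFun (congrArg Prod.snd h) j
  refine Set.Finite.of_finite_image ?_ hinj.injOn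
  refine (Set.finite_univ.prod (hω (p * max N 0))).subset ?_
  rintro _ ⟨f, ⟨hf, hω⟩, rfl⟩
  refine ⟨Set.mem_univ _, ?_, fun j => 1 ⊗ₜ[ℝ] b (f j).1, hω⟩
  calc ∑ j, max (f j).2 0 ≤ ∑ _j : Fin p, max N 0 :=
        Finset.sum_le_sum fun j _ => max_le_max_right 0 (hf j)
    _ = p * max N 0 := by simp

variable {V : Type*} [AddCommGroup V] [Module ℂ V]

/-- A family of operators indexed by tuples of modes, of which each vector is annihilated by those
with a large index. -/
def IsLocallyBounded {p : ℕ} (t : (Fin p → ι × ℤ) → Module.End ℂ V) : Prop :=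
  ∀ v, ∃ N : ℤ, ∀ f j, N < (f j).2 → t f v = 0

theorem IsLocallyBounded.finite_support {p : ℕ} {t : (Fin p → ι × ℤ) → Module.End ℂ V}
    (ht : IsLocallyBounded t) {ω : Form 𝔤 p} (hω : ω ∈ FormPlus 𝔤 p) (v : V) :
    (Function.support fun f => ω (fun j => loopBasis b (f j)) • t f v).Finite := by
  obtain ⟨N, hN⟩ := ht v
  refine (finite_setOf_ne_zero b hω N).subset fun f hf => ⟨fun j => ?_, fun h => hf ?_⟩
  · by_contra h
    refine hf ?_
    simp only
    rw [hN f j (not_le.1 h), smul_zero]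
  · simp only
    rw [h, zero_smul]

/-- The locally finite sum `∑ ω(X_{f₁}, …, X_{f_p}) t_f`. -/
def formSum {p : ℕ} (t : (Fin p → ι × ℤ) → Module.End ℂ V) (ht : IsLocallyBounded t) :
    FormPlus 𝔤 p →ₗ[ℂ] Module.End ℂ V where
  toFun ω :=
    { toFun v := ∑ᶠ f, (ω : Form 𝔤 p) (fun j => loopBasis b (f j)) • t f v
      map_add' v w := by
        simp only [map_add, smul_add]
        exact finsum_add_distrib (ht.finite_support b ω.2 v) (ht.finite_support b ω.2 w)
      map_smul' a v := by
        simp only [map_smul, RingHom.id_apply, smul_finsum]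
        refine finsum_congr fun f => smul_comm _ _ _ }
  map_add' ω ω' := by
    ext v
    simp only [Submodule.coe_add, AlternatingMap.add_apply, add_smul, LinearMap.coe_mk,
      AddHom.coe_mk, LinearMap.add_apply]
    exact finsum_add_distrib (ht.finite_support b ω.2 v) (ht.finite_support b ω'.2 v)
  map_smul' a ω := by
    ext v
    simp only [Submodule.coe_smul, AlternatingMap.smul_apply, smul_assoc, LinearMap.coe_mk,
      AddHom.coe_mk, LinearMap.smul_apply, RingHom.id_apply, smul_finsum]

theorem formSum_apply {p : ℕ} {t : (Fin p → ι × ℤ) → Module.End ℂ V} (ht : IsLocallyBounded t)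
    (ω : FormPlus 𝔤 p) (v : V) :
    formSum b t ht ω v = ∑ᶠ f, (ω : Form 𝔤 p) (fun j => loopBasis b (f j)) • t f v := rfl

theorem map_formSum {p : ℕ} {t : (Fin p → ι × ℤ) → Module.End ℂ V} (ht : IsLocallyBounded t)
    (ω : FormPlus 𝔤 p) (T : Module.End ℂ V) (v : V) :
    T (formSum b t ht ω v) =
      ∑ᶠ f, (ω : Form 𝔤 p) (fun j => loopBasis b (f j)) • T (t f v) := by
  rw [formSum_apply, map_finsum T (ht.finite_support b ω.2 v)]
  exact finsum_congr fun f => map_smul _ _ _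

/-- An operator that commutes with all terms commutes with the sum. -/
theorem commute_formSum {p : ℕ} {t : (Fin p → ι × ℤ) → Module.End ℂ V} (ht : IsLocallyBounded t)
    (ω : FormPlus 𝔤 p) {T : Module.End ℂ V} (hT : ∀ f, T * t f = t f * T) :
    T * formSum b t ht ω = formSum b t ht ω * T := by
  ext v
  rw [Module.End.mul_apply, Module.End.mul_apply, map_formSum, formSum_apply]
  exact finsum_congr fun f => congrArg _ (congrArg (fun S : Module.End ℂ V => S v) (hT f))

theorem finsum_eq_finsum_comp {α β M : Type*} [AddCommMonoid M] {g : β → M} {φ : α → β}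
    (hφ : Function.Injective φ) (hg : ∀ x, g x ≠ 0 → x ∈ Set.range φ) :
    ∑ᶠ x, g x = ∑ᶠ a, g (φ a) := by
  rw [← finsum_mem_range hφ]
  exact finsum_congr fun x => by
    by_cases h : x ∈ Set.range φ
    · simp [h]
    · simp only [h]
      rw [finsum_false]
      exact not_not.1 fun h' => h (hg x h')

variable {K b} in
/-- Summation against `⟨X_{f_j}*, X_g⟩ = δ`. -/
theorem finsum_loopDual_smul (hb : K.IsOrthonormal b) {p : ℕ} (a : (Fin p → ι × ℤ) → ℂ)
    (g : ι × ℤ) (j : Fin p) (s : (Fin p → ι × ℤ) → V) {α : Type*} {φ : α → Fin p → ι × ℤ}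
    (hφ : Function.Injective φ) (h1 : ∀ x, φ x j = g) (h2 : ∀ f, f j = g → f ∈ Set.range φ) :
    ∑ᶠ f, a f • ((2 * K.loop (loopDual b (f j)) (loopBasis b g)) • s f) =
      (2 : ℂ) • ∑ᶠ x, a (φ x) • s (φ x) := by
  rw [finsum_eq_finsum_comp hφ, smul_finsum]
  · refine finsum_congr fun x => ?_
    rw [h1, loop_symm, loop_loopBasis_loopDual hb, if_pos rfl, mul_one, smul_comm]
  · intro f hf
    refine h2 f ?_
    by_contra hfg
    refine hf ?_
    rw [loop_symm, loop_loopBasis_loopDual hb, if_neg (Ne.symm hfg), mul_zero, zero_smul, smul_zero]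

namespace PositiveEnergyModule

variable {K} (P : PositiveEnergyModule K V)

/-- The normal ordered monomials of degree two. -/
def mono₂ (f : Fin 2 → ι × ℤ) : Module.End ℂ V := P.no₂ (loopDual b (f 0)) (loopDual b (f 1))

/-- The normal ordered monomials of degree three. -/
def mono₃ (f : Fin 3 → ι × ℤ) : Module.End ℂ V :=
  P.no₃ (loopDual b (f 0)) (loopDual b (f 1)) (loopDual b (f 2))

theorem exists_cl_loopDual_eq_zero (v : V) :
    ∃ N : ℤ, 0 ≤ N ∧ ∀ f : ι × ℤ, N < f.2 → P.cl (loopDual b f) v = 0 := by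
  obtain ⟨N, h0, hN⟩ := P.exists_energy_bound v
  exact ⟨N, h0, fun f hf => hN _ _ hf⟩

theorem no₂_loopDual_right {v : V} (ξ : Loop 𝔤) {f : ι × ℤ} (hf : 0 < f.2)
    (h : P.cl (loopDual b f) v = 0) : P.no₂ ξ (loopDual b f) v = 0 :=
  P.no₂_mode_neg ξ hf _ h

theorem no₂_loopDual_left {v : V} (ξ : Loop 𝔤) {f : ι × ℤ} (hf : 0 < f.2)
    (h : P.cl (loopDual b f) v = 0) : P.no₂ (loopDual b f) ξ v = 0 := by
  rw [no₂_swap, LinearMap.neg_apply, no₂_loopDual_right b P ξ hf h, neg_zero]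

theorem mono₂_apply_eq_zero {v : V} {f : Fin 2 → ι × ℤ} {j : Fin 2} (hj : 0 < (f j).2)
    (h : P.cl (loopDual b (f j)) v = 0) : P.mono₂ b f v = 0 := by
  fin_cases j
  · exact no₂_loopDual_left b P _ hj h
  · exact no₂_loopDual_right b P _ hj h

/-- Antisymmetry moves the annihilating factor to the right end, where it acts on `v` first and
carries no contraction. -/
theorem mono₃_apply_eq_zero {v : V} {f : Fin 3 → ι × ℤ} {j : Fin 3} (hj : 0 < (f j).2)
    (h : P.cl (loopDual b (f j)) v = 0) : P.mono₃ b f v = 0 := by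
  have key : ∀ (ξ η : Loop 𝔤) (g : ι × ℤ), 0 < g.2 → P.cl (loopDual b g) v = 0 →
      P.no₃ ξ η (loopDual b g) v = 0 := fun ξ η g hg h => P.no₃_mode_neg ξ η hg _ h
  fin_cases j
  · rw [mono₃, no₃_swap_left, no₃_swap_right, neg_neg]
    exact key _ _ _ hj h
  · rw [mono₃, no₃_swap_right, LinearMap.neg_apply, neg_eq_zero]
    exact key _ _ _ hj h
  · exact key _ _ _ hj h

theorem isLocallyBounded_mono₂ : IsLocallyBounded (P.mono₂ b) := by
  intro v
  obtain ⟨N, h0, hN⟩ := P.exists_cl_loopDual_eq_zero b v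
  exact ⟨N, fun f j h => P.mono₂_apply_eq_zero b (h0.trans_lt h) (hN _ h)⟩

theorem isLocallyBounded_mono₃ : IsLocallyBounded (P.mono₃ b) := by
  intro v
  obtain ⟨N, h0, hN⟩ := P.exists_cl_loopDual_eq_zero b v
  exact ⟨N, fun f j h => P.mono₃_apply_eq_zero b (h0.trans_lt h) (hN _ h)⟩

/-- The normal ordered operator of a 2-form. -/
def op₂ : FormPlus 𝔤 2 →ₗ[ℂ] Module.End ℂ V := formSum b (P.mono₂ b) (P.isLocallyBounded_mono₂ b)

/-- The normal ordered operator of a 3-form. -/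
def op₃ : FormPlus 𝔤 3 →ₗ[ℂ] Module.End ℂ V := formSum b (P.mono₃ b) (P.isLocallyBounded_mono₃ b)

variable {b}

/-- The pairing is nonzero only for `f j = g`, so slot `j` is bounded by `g.2`; the other slots are
bounded by assumption. This gives each contraction term finite support, so that the sum of a
commutator may be split. -/
theorem isLocallyBounded_loopDual_smul (hb : K.IsOrthonormal b) {p : ℕ} (g : ι × ℤ) (j : Fin p)
    {t : (Fin p → ι × ℤ) → Module.End ℂ V}
    (ht : ∀ v, ∃ N : ℤ, ∀ f i, i ≠ j → N < (f i).2 → t f v = 0) :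
    IsLocallyBounded fun f => (2 * K.loop (loopDual b (f j)) (loopBasis b g)) • t f := by
  intro v
  obtain ⟨N, hN⟩ := ht v
  refine ⟨max N g.2, fun f i hf => ?_⟩
  by_cases hfg : g = f j
  · have hij : i ≠ j := by
      rintro rfl
      rw [hfg] at hf
      simp at hf
    rw [LinearMap.smul_apply, hN f i hij ((le_max_left _ _).trans_lt hf), smul_zero]
  · simp only
    rw [loop_symm, loop_loopBasis_loopDual hb, if_neg hfg, mul_zero, zero_smul,
      LinearMap.zero_apply]

/-- Contracting slot 1 gives `2ζ`; contracting slot 0 gives another `2ζ`, the minus sign of the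
contraction cancelling that of the skew form. This is the origin of the 4. -/
theorem op₂_comm_cl (hb : K.IsOrthonormal b) (ω : FormPlus 𝔤 2) (g : ι × ℤ) (ζ : Loop 𝔤)
    (h : ∀ v : Fin 2 → Loop 𝔤, v 1 = loopBasis b g → (ω : Form 𝔤 2) v = K.loop ζ (v 0))
    (h' : ∀ v : Fin 2 → Loop 𝔤, v 0 = loopBasis b g → (ω : Form 𝔤 2) v = -K.loop ζ (v 1)) :
    P.op₂ b ω * P.cl (loopBasis b g) - P.cl (loopBasis b g) * P.op₂ b ω = (4 : ℂ) • P.cl ζ := by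
  ext v
  have key : ∀ i j : Fin 2, i ≠ j → IsLocallyBounded fun f : Fin 2 → ι × ℤ =>
      (2 * K.loop (loopDual b (f j)) (loopBasis b g)) • P.cl (loopDual b (f i)) := by
    intro i j hij
    refine isLocallyBounded_loopDual_smul hb g j fun v => ?_
    obtain ⟨N, h0, hN⟩ := P.exists_cl_loopDual_eq_zero b v
    refine ⟨N, fun f i' hi' hf => ?_⟩
    obtain rfl : i' = i := by omega
    exact hN _ hf
  have hsum : (P.op₂ b ω * P.cl (loopBasis b g) - P.cl (loopBasis b g) * P.op₂ b ω) v =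
      ∑ᶠ f : Fin 2 → ι × ℤ, (ω : Form 𝔤 2) (fun j => loopBasis b (f j)) •
        (((2 * K.loop (loopDual b (f 1)) (loopBasis b g)) • P.cl (loopDual b (f 0))) v) -
      ∑ᶠ f : Fin 2 → ι × ℤ, (ω : Form 𝔤 2) (fun j => loopBasis b (f j)) •
        (((2 * K.loop (loopDual b (f 0)) (loopBasis b g)) • P.cl (loopDual b (f 1))) v) := by
    rw [LinearMap.sub_apply, Module.End.mul_apply, Module.End.mul_apply]
    rw [op₂, map_formSum, formSum_apply, ← finsum_sub_distrib, ← finsum_sub_distrib]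
    · refine finsum_congr fun f => ?_
      rw [← smul_sub, ← smul_sub]
      exact congrArg _ (congrArg (fun T : Module.End ℂ V => T v) (P.no₂_comm_cl _ _ _))
    · exact (key 0 1 (by decide)).finite_support b ω.2 v
    · exact (key 1 0 (by decide)).finite_support b ω.2 v
    · exact (P.isLocallyBounded_mono₂ b).finite_support b ω.2 _
    · refine ((P.isLocallyBounded_mono₂ b).finite_support b ω.2 v).subset fun f hf h0 => hf ?_
      simp only at h0 ⊢
      rw [← map_smul, h0, map_zero]
  -- The tuples `![x, g]` are exactly those that survive contraction of slot 1.
  have h0 := finsum_loopDual_smul hb (fun f => (ω : Form 𝔤 2) (fun j => loopBasis b (f j))) g 1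
    (fun f => P.cl (loopDual b (f 0)) v) (φ := fun x => ![x, g])
    (fun x y hxy => congrFun hxy 0) (fun x => rfl)
    (fun f hf => ⟨f 0, by ext i <;> fin_cases i <;> simp [hf]⟩)
  have h1 := finsum_loopDual_smul hb (fun f => (ω : Form 𝔤 2) (fun j => loopBasis b (f j))) g 0
    (fun f => P.cl (loopDual b (f 1)) v) (φ := fun x => ![g, x])
    (fun x y hxy => congrFun hxy 1) (fun x => rfl)
    (fun f hf => ⟨f 1, by ext i <;> fin_cases i <;> simp [hf]⟩)
  rw [hsum]
  simp only [LinearMap.smul_apply]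
  rw [h0, h1]
  have h3 := (loop_expansion hb (P.cl.flip v) ζ).2
  simp only [LinearMap.flip_apply] at h3
  have h4 : ∀ x, (ω : Form 𝔤 2) (fun j => loopBasis b (![x, g] j)) = K.loop ζ (loopBasis b x) :=
    fun x => h _ rfl
  have h5 : ∀ x, (ω : Form 𝔤 2) (fun j => loopBasis b (![g, x] j)) = -K.loop ζ (loopBasis b x) :=
    fun x => h' _ rfl
  simp only [h4, h5, neg_smul, finsum_neg_distrib, Matrix.cons_val_zero, Matrix.cons_val_one]
  rw [h3]
  module

/-- Each of the three slots contributes twice the operator of the contracted form, whence the 6. -/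
theorem op₃_anticomm_cl (hb : K.IsOrthonormal b) (ω : FormPlus 𝔤 3) (g : ι × ℤ)
    (ω' : FormPlus 𝔤 2)
    (h0 : ∀ v : Fin 2 → Loop 𝔤, (ω : Form 𝔤 3) ![loopBasis b g, v 0, v 1] = (ω' : Form 𝔤 2) v)
    (h1 : ∀ v : Fin 2 → Loop 𝔤, (ω : Form 𝔤 3) ![v 0, loopBasis b g, v 1] = -(ω' : Form 𝔤 2) v)
    (h2 : ∀ v : Fin 2 → Loop 𝔤, (ω : Form 𝔤 3) ![v 0, v 1, loopBasis b g] = (ω' : Form 𝔤 2) v) :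
    P.op₃ b ω * P.cl (loopBasis b g) + P.cl (loopBasis b g) * P.op₃ b ω =
      (6 : ℂ) • P.op₂ b ω' := by
  ext v
  have key : ∀ i i' j : Fin 3, i ≠ j → i' ≠ j → i ≠ i' →
      IsLocallyBounded fun f : Fin 3 → ι × ℤ =>
        (2 * K.loop (loopDual b (f j)) (loopBasis b g)) •
          P.no₂ (loopDual b (f i)) (loopDual b (f i')) := by
    intro i i' j hij hij' hii'
    refine isLocallyBounded_loopDual_smul hb g j fun v => ?_
    obtain ⟨N, h0, hN⟩ := P.exists_cl_loopDual_eq_zero b v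
    refine ⟨N, fun f k hk hf => ?_⟩
    have : k = i ∨ k = i' := by omega
    rcases this with rfl | rfl
    · exact P.no₂_loopDual_left b _ (h0.trans_lt hf) (hN _ hf)
    · exact P.no₂_loopDual_right b _ (h0.trans_lt hf) (hN _ hf)
  have hsum : (P.op₃ b ω * P.cl (loopBasis b g) + P.cl (loopBasis b g) * P.op₃ b ω) v =
      ∑ᶠ f : Fin 3 → ι × ℤ, (ω : Form 𝔤 3) (fun j => loopBasis b (f j)) •
        (((2 * K.loop (loopDual b (f 2)) (loopBasis b g)) •
          P.no₂ (loopDual b (f 0)) (loopDual b (f 1))) v) -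
      ∑ᶠ f : Fin 3 → ι × ℤ, (ω : Form 𝔤 3) (fun j => loopBasis b (f j)) •
        (((2 * K.loop (loopDual b (f 1)) (loopBasis b g)) •
          P.no₂ (loopDual b (f 0)) (loopDual b (f 2))) v) +
      ∑ᶠ f : Fin 3 → ι × ℤ, (ω : Form 𝔤 3) (fun j => loopBasis b (f j)) •
        (((2 * K.loop (loopDual b (f 0)) (loopBasis b g)) •
          P.no₂ (loopDual b (f 1)) (loopDual b (f 2))) v) := by
    have k1 := (key 0 1 2 (by decide) (by decide) (by decide)).finite_support b ω.2 v
    have k2 := (key 0 2 1 (by decide) (by decide) (by decide)).finite_support b ω.2 v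
    have k3 := (key 1 2 0 (by decide) (by decide) (by decide)).finite_support b ω.2 v
    rw [LinearMap.add_apply, Module.End.mul_apply, Module.End.mul_apply, op₃, map_formSum,
      formSum_apply, ← finsum_add_distrib, ← finsum_sub_distrib k1 k2, ← finsum_add_distrib _ k3]
    · refine finsum_congr fun f => ?_
      rw [← smul_sub, ← smul_add, ← smul_add]
      have h := congrArg (fun T : Module.End ℂ V => T v) (P.no₃_comm_cl (loopDual b (f 0))
        (loopDual b (f 1)) (loopDual b (f 2)) (loopBasis b g))
      simp only [LinearMap.add_apply, LinearMap.sub_apply, Module.End.mul_apply] at h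
      rw [← h, mono₃]
    · exact (k1.union k2).subset (Function.support_sub _ _)
    · exact (P.isLocallyBounded_mono₃ b).finite_support b ω.2 _
    · refine ((P.isLocallyBounded_mono₃ b).finite_support b ω.2 v).subset fun f hf h0 => hf ?_
      simp only at h0 ⊢
      rw [← map_smul, h0, map_zero]
  have e2 := finsum_loopDual_smul hb (fun f => (ω : Form 𝔤 3) (fun j => loopBasis b (f j))) g 2
    (fun f => P.no₂ (loopDual b (f 0)) (loopDual b (f 1)) v)
    (φ := fun x : Fin 2 → ι × ℤ => ![x 0, x 1, g])
    (fun x y hxy => by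
      ext i <;> fin_cases i
      exacts [congrArg Prod.fst (congrFun hxy 0), congrArg Prod.fst (congrFun hxy 1),
        congrArg Prod.snd (congrFun hxy 0), congrArg Prod.snd (congrFun hxy 1)]) (fun x => rfl)
    (fun f hf => ⟨![f 0, f 1], by ext i <;> fin_cases i <;> simp [hf]⟩)
  have e1 := finsum_loopDual_smul hb (fun f => (ω : Form 𝔤 3) (fun j => loopBasis b (f j))) g 1
    (fun f => P.no₂ (loopDual b (f 0)) (loopDual b (f 2)) v)
    (φ := fun x : Fin 2 → ι × ℤ => ![x 0, g, x 1])
    (fun x y hxy => by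
      ext i <;> fin_cases i
      exacts [congrArg Prod.fst (congrFun hxy 0), congrArg Prod.fst (congrFun hxy 2),
        congrArg Prod.snd (congrFun hxy 0), congrArg Prod.snd (congrFun hxy 2)]) (fun x => rfl)
    (fun f hf => ⟨![f 0, f 2], by ext i <;> fin_cases i <;> simp [hf]⟩)
  have e0 := finsum_loopDual_smul hb (fun f => (ω : Form 𝔤 3) (fun j => loopBasis b (f j))) g 0
    (fun f => P.no₂ (loopDual b (f 1)) (loopDual b (f 2)) v)
    (φ := fun x : Fin 2 → ι × ℤ => ![g, x 0, x 1])
    (fun x y hxy => by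
      ext i <;> fin_cases i
      exacts [congrArg Prod.fst (congrFun hxy 1), congrArg Prod.fst (congrFun hxy 2),
        congrArg Prod.snd (congrFun hxy 1), congrArg Prod.snd (congrFun hxy 2)]) (fun x => rfl)
    (fun f hf => ⟨![f 1, f 2], by ext i <;> fin_cases i <;> simp [hf]⟩)
  have hv : ∀ x y z : ι × ℤ, (fun j => loopBasis b (![x, y, z] j)) =
      ![loopBasis b x, loopBasis b y, loopBasis b z] := by
    intro x y z
    ext j
    fin_cases j <;> rfl
  have h2' := fun x : Fin 2 → ι × ℤ => h2 fun j => loopBasis b (x j)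
  have h1' := fun x : Fin 2 → ι × ℤ => h1 fun j => loopBasis b (x j)
  have h0' := fun x : Fin 2 → ι × ℤ => h0 fun j => loopBasis b (x j)
  rw [hsum]
  simp only [LinearMap.smul_apply]
  rw [e0, e1, e2]
  simp only [hv, h0', h1', h2', neg_smul, finsum_neg_distrib]
  have h6 : P.op₂ b ω' v = ∑ᶠ x : Fin 2 → ι × ℤ, (ω' : Form 𝔤 2) (fun j => loopBasis b (x j)) •
      P.no₂ (loopDual b (x 0)) (loopDual b (x 1)) v := by
    rw [op₂, formSum_apply]
    simp only [mono₂]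
  rw [h6]
  simp only [Matrix.cons_val_zero, Matrix.cons_val_one, Matrix.cons_val]
  module

end PositiveEnergyModule

end LoopClifford

end

noncomputable section

namespace LoopClifford

variable {𝔤 : Type*} [LieRing 𝔤] [LieAlgebra ℝ 𝔤] {K : InvariantInnerProduct 𝔤}
  {ι : Type*} [Fintype ι] [DecidableEq ι] {b : Module.Basis ι ℝ 𝔤}
  {V : Type*} [AddCommGroup V] [Module ℂ V]

namespace PositiveEnergyModule

variable (P : PositiveEnergyModule K V)

/-! ### The operators `½ dξ*`, `½ d∂_θ*` and `¼ Ω` -/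

variable (b)

/-- The operator of `½ dξ*`. -/
def ads : Loop 𝔤 →ₗ[ℂ] Module.End ℂ V :=
  (1 / 2 : ℂ) • P.op₂ b ∘ₗ (dStarLinear K).codRestrict (FormPlus 𝔤 2) (dStar_mem_formPlus K)

/-- The operator of `½ d∂_θ*`. -/
def adsRot : Module.End ℂ V := P.op₂ b ((1 / 2 : ℂ) • ⟨dRotStar K, dRotStar_mem_formPlus K⟩)

/-- The operator of `¼ Ω`. -/
def gamma : Module.End ℂ V :=
  P.op₃ b ((1 / 4 : ℂ) • ⟨fundamentalForm K, fundamentalForm_mem_formPlus K⟩)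

theorem ads_eq (ξ : Loop 𝔤) :
    P.ads b ξ = P.op₂ b ((1 / 2 : ℂ) • ⟨dStar K ξ, dStar_mem_formPlus K ξ⟩) := by
  rw [ads, map_smul]
  rfl

variable {b}

theorem ads_comm_cl (hb : K.IsOrthonormal b) (ξ η : Loop 𝔤) :
    P.ads b ξ * P.cl η - P.cl η * P.ads b ξ = P.cl ⁅ξ, η⁆ := by
  have h : (LinearMap.mulLeft ℂ (P.ads b ξ) - LinearMap.mulRight ℂ (P.ads b ξ)) ∘ₗ P.cl =
      P.cl ∘ₗ (LieAlgebra.ad ℂ (Loop 𝔤) ξ : Module.End ℂ (Loop 𝔤)) := by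
    refine ext_loopBasis b fun g => ?_
    simp only [LinearMap.comp_apply, LinearMap.sub_apply, LinearMap.mulLeft_apply,
      LinearMap.mulRight_apply, LieAlgebra.ad_apply]
    -- The `¼` is the product of the `½` in `½ dξ*` and the `½` in the definition of `dξ*`; it
    -- cancels the 4 of `op₂_comm_cl`.
    rw [ads_eq, P.op₂_comm_cl hb _ g ((1 / 4 : ℂ) • ⁅ξ, loopBasis b g⁆), map_smul, smul_smul]
    · norm_num
    · intro v hv
      simp only [Submodule.coe_smul, AlternatingMap.smul_apply, dStar_apply, smul_eq_mul, map_smul,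
        LinearMap.smul_apply, hv]
      rw [loop_invariant, ← lie_skew (v 0), map_neg]
      ring
    · intro v hv
      simp only [Submodule.coe_smul, AlternatingMap.smul_apply, dStar_apply, smul_eq_mul, map_smul,
        LinearMap.smul_apply, hv]
      rw [loop_invariant]
      ring
  exact congrArg (fun f => f η) h

theorem adsRot_comm_cl (hb : K.IsOrthonormal b) (η : Loop 𝔤) :
    P.adsRot b * P.cl η - P.cl η * P.adsRot b = P.cl (rot η) := by
  have h : (LinearMap.mulLeft ℂ (P.adsRot b) - LinearMap.mulRight ℂ (P.adsRot b)) ∘ₗ P.cl =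
      P.cl ∘ₗ rot := by
    refine ext_loopBasis b fun g => ?_
    simp only [LinearMap.comp_apply, LinearMap.sub_apply, LinearMap.mulLeft_apply,
      LinearMap.mulRight_apply]
    rw [adsRot, P.op₂_comm_cl hb _ g ((1 / 4 : ℂ) • rot (loopBasis b g)), map_smul, smul_smul]
    · norm_num
    · intro v hv
      simp only [Submodule.coe_smul, AlternatingMap.smul_apply, dRotStar_apply, smul_eq_mul,
        map_smul, LinearMap.smul_apply, hv]
      rw [loop_symm]
      ring
    · intro v hv
      simp only [Submodule.coe_smul, AlternatingMap.smul_apply, dRotStar_apply, smul_eq_mul,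
        map_smul, LinearMap.smul_apply, hv]
      rw [loop_rot, loop_symm]
      ring
  exact congrArg (fun f => f η) h

theorem gamma_anticomm_cl (hb : K.IsOrthonormal b) (η : Loop 𝔤) :
    P.gamma b * P.cl η + P.cl η * P.gamma b = P.ads b η := by
  have h : (LinearMap.mulLeft ℂ (P.gamma b) + LinearMap.mulRight ℂ (P.gamma b)) ∘ₗ P.cl =
      P.ads b := by
    refine ext_loopBasis b fun g => ?_
    simp only [LinearMap.comp_apply, LinearMap.add_apply, LinearMap.mulLeft_apply,
      LinearMap.mulRight_apply]
    -- Inserting `X_g` into `¼Ω` gives `-(1/24)⟨X_g, [·,·]⟩`, which is `1/12` of `dX_g*`. Six times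
    -- `1/12` is the `½` of `ads`.
    rw [gamma, P.op₃_anticomm_cl hb _ g
      ((1 / 12 : ℂ) • ⟨dStar K (loopBasis b g), dStar_mem_formPlus K _⟩), ads_eq, ← map_smul,
      smul_smul]
    · norm_num
    all_goals
      intro v
      simp only [Submodule.coe_smul, AlternatingMap.smul_apply, fundamentalForm_apply, dStar_apply,
        smul_eq_mul, Matrix.cons_val_zero, Matrix.cons_val_one, Matrix.cons_val]
    · ring
    · rw [← lie_skew, map_neg, ← loop_invariant, loop_symm]
      ring
    · rw [← loop_invariant, loop_symm]
      ring
  exact congrArg (fun f => f η) h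

/-! ### Action on the vacuum -/

/-- A positive index stands for a negative mode in the dual basis, and that mode annihilates the
vacuum. -/
theorem op₂_vacuum_eq_zero {v : V} (hv : P.IsVacuum v) (ω : FormPlus 𝔤 2)
    (h : ∀ f : Fin 2 → ι × ℤ, (ω : Form 𝔤 2) (fun j => loopBasis b (f j)) ≠ 0 →
      ∃ j, 0 < (f j).2) : P.op₂ b ω v = 0 := by
  rw [op₂, formSum_apply, ← finsum_zero (α := Fin 2 → ι × ℤ)]
  refine finsum_congr fun f => ?_
  by_cases hf : (ω : Form 𝔤 2) (fun j => loopBasis b (f j)) = 0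
  · rw [hf, zero_smul]
  · obtain ⟨j, hj⟩ := h f hf
    rw [P.mono₂_apply_eq_zero b hj (hv _ _ (by omega)), smul_zero]

theorem dStar_loopBasis (n : ℤ) (X : Cplx 𝔤) (f : Fin 2 → ι × ℤ) :
    dStar K (mode n X) (fun j => loopBasis b (f j)) = -(1 / 2) *
      if n + ((f 0).2 + (f 1).2) = 0 then
        K.cplx X ⁅cplxBasis b (f 0).1, cplxBasis b (f 1).1⁆ else 0 := by
  rw [dStar_apply, loopBasis, loopBasis, lie_mode, loop_mode, cplxBasis_apply, cplxBasis_apply]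

theorem ads_mode_neg_vacuum {v : V} (hv : P.IsVacuum v) {n : ℤ} (hn : n < 0) (X : Cplx 𝔤) :
    P.ads b (mode n X) v = 0 := by
  rw [ads_eq, map_smul, LinearMap.smul_apply, P.op₂_vacuum_eq_zero hv, smul_zero]
  intro f hf
  rw [dStar_loopBasis] at hf
  by_contra! h
  have h0 := h 0
  have h1 := h 1
  rw [if_neg (by omega), mul_zero] at hf
  exact hf rfl

/-- A nonzero coefficient requires opposite nonzero indices, because the rotation kills zero modes;
one of the two is therefore positive. -/
theorem adsRot_vacuum {v : V} (hv : P.IsVacuum v) : P.adsRot b v = 0 := by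
  rw [adsRot, map_smul, LinearMap.smul_apply, P.op₂_vacuum_eq_zero hv, smul_zero]
  intro f hf
  simp only [dRotStar_apply] at hf
  rw [loopBasis, loopBasis, rot_mode, map_smul, loop_mode] at hf
  by_contra! h
  have h0 := h 0
  have h1 := h 1
  split_ifs at hf with h2
  · rw [show (f 1).2 = 0 by omega] at hf
    simp at hf
  · simp at hf

variable (b) in
/-- The finite part of `½ dξ*` for `ξ = X zᵐ` that acts on the vacuum. -/
def quad (m : ℕ) (X : Cplx 𝔤) : Module.End ℂ V :=
  (1 / 4 : ℂ) • ∑ a ∈ Finset.range (m + 1), ∑ j,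
    P.cl (mode (m - a) ⁅X, cplxBasis b j⁆) * P.cl (mode a (cplxBasis b j))

theorem loopDual_eq (f : ι × ℤ) : loopDual b f = mode (-f.2) (cplxBasis b f.1) := by
  rw [loopDual, cplxBasis_apply]

/-- On the vacuum only tuples with both indices at most 0 survive. Their sum is `-m`, so they are
`(a - m, -a)` with `0 ≤ a ≤ m`, and the infinite sum becomes finite. -/
theorem ads_mode_vacuum (hb : K.IsOrthonormal b) {v : V} (hv : P.IsVacuum v) (m : ℕ)
    (X : Cplx 𝔤) : P.ads b (mode m X) v = P.quad b m X v := by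
  rw [ads_eq, map_smul, LinearMap.smul_apply, op₂, formSum_apply,
    finsum_eq_finsum_comp (φ := fun x : Fin (m + 1) × ι × ι =>
      ![(x.2.2, (x.1 : ℤ) - m), (x.2.1, -(x.1 : ℤ))])]
  · rw [finsum_eq_sum_of_fintype, Fintype.sum_prod_type, quad, LinearMap.smul_apply,
      LinearMap.sum_apply, Finset.sum_range, Finset.smul_sum, Finset.smul_sum]
    refine Finset.sum_congr rfl fun a _ => ?_
    rw [Fintype.sum_prod_type, LinearMap.sum_apply, Finset.smul_sum, Finset.smul_sum]
    refine Finset.sum_congr rfl fun j _ => ?_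
    conv_rhs => rw [← sum_cplx_smul hb ⁅X, cplxBasis b j⁆]
    simp only [map_sum, map_smul, Finset.sum_mul, LinearMap.sum_apply, smul_mul_assoc,
      LinearMap.smul_apply, Finset.smul_sum]
    refine Finset.sum_congr rfl fun i _ => ?_
    rw [dStar_loopBasis, mono₂, loopDual_eq, loopDual_eq, if_pos (by simp; ring)]
    simp only [Matrix.cons_val_zero, Matrix.cons_val_one, no₂, neg_neg, neg_sub, LinearMap.sub_apply,
      LinearMap.smul_apply, Module.End.one_apply, contractionForm_mode]
    rw [cplx_invariant, ← lie_skew (cplxBasis b i), map_neg, smul_sub]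
    -- A contraction can be nonzero only for `i = j`, where the coefficient `⟨X, [eᵢ, eⱼ]⟩`
    -- vanishes. Normal ordering thus makes no difference here.
    by_cases hij : i = j
    · subst hij
      simp
    · rw [cplx_cplxBasis hb, if_neg hij, ite_self, mul_zero, zero_smul, smul_zero, sub_zero]
      module
  · rintro ⟨a, j, i⟩ ⟨a', j', i'⟩ h
    have h0 := congrFun h 0
    have h1 := congrFun h 1
    simp only [Matrix.cons_val_zero, Matrix.cons_val_one, Prod.mk.injEq] at h0 h1
    obtain rfl := h0.1
    obtain rfl := h1.1
    obtain rfl : a = a' := Fin.ext (by omega)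
    rfl
  · intro f hf
    have hω : dStar K (mode m X) (fun j => loopBasis b (f j)) ≠ 0 := fun h => hf (by
      simp only
      rw [h, zero_smul])
    have hle : ∀ j, (f j).2 ≤ 0 := by
      intro j
      by_contra hj
      refine hf ?_
      simp only
      rw [P.mono₂_apply_eq_zero b (not_le.1 hj) (hv _ _ (by omega)), smul_zero]
    rw [dStar_loopBasis] at hω
    have hsum : (m : ℤ) + ((f 0).2 + (f 1).2) = 0 := by
      by_contra h
      rw [if_neg h, mul_zero] at hω
      exact hω rfl
    have h0 := hle 0
    have h1 := hle 1
    refine ⟨(⟨(-(f 1).2).toNat, by omega⟩, (f 1).1, (f 0).1), ?_⟩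
    ext i
    · fin_cases i <;> simp
    · fin_cases i
      · simp; omega
      · simp; omega

theorem fundamentalForm_loopBasis (f : Fin 3 → ι × ℤ) :
    fundamentalForm K (fun j => loopBasis b (f j)) = -(1 / 6) *
      if (f 0).2 + ((f 1).2 + (f 2).2) = 0 then
        K.cplx (cplxBasis b (f 0).1) ⁅cplxBasis b (f 1).1, cplxBasis b (f 2).1⁆ else 0 := by
  rw [fundamentalForm_apply, loopBasis, loopBasis, loopBasis, lie_mode, loop_mode, cplxBasis_apply,
    cplxBasis_apply, cplxBasis_apply]

theorem quad_zero (X : Cplx 𝔤) : P.quad b 0 X =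
    (1 / 4 : ℂ) • ∑ j, P.cl (mode 0 ⁅X, cplxBasis b j⁆) * P.cl (mode 0 (cplxBasis b j)) := by
  simp [quad]

/-- Surviving tuples have three indices that are at most 0 and sum to 0, so only zero modes act. The
result is the cubic element, written with `ads` so that its brackets can be reused. -/
theorem gamma_vacuum (hb : K.IsOrthonormal b) {v : V} (hv : P.IsVacuum v) :
    P.gamma b v =
      (1 / 6 : ℂ) • ∑ k, P.ads b (mode 0 (cplxBasis b k)) (P.cl (mode 0 (cplxBasis b k)) v) := by
  have h1 : ∀ k, P.ads b (mode 0 (cplxBasis b k)) (P.cl (mode 0 (cplxBasis b k)) v) =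
      ∑ j, ∑ i, (1 / 4 * K.cplx (cplxBasis b i) ⁅cplxBasis b k, cplxBasis b j⁆ : ℂ) •
        P.cl (mode 0 (cplxBasis b i)) (P.cl (mode 0 (cplxBasis b j))
          (P.cl (mode 0 (cplxBasis b k)) v)) := by
    intro k
    have h := P.ads_mode_vacuum hb (hv.cl_zero (cplxBasis b k)) 0 (cplxBasis b k)
    rw [Nat.cast_zero] at h
    rw [h, quad_zero, LinearMap.smul_apply, LinearMap.sum_apply, Finset.smul_sum]
    refine Finset.sum_congr rfl fun j _ => ?_
    conv_lhs => rw [← sum_cplx_smul hb ⁅cplxBasis b k, cplxBasis b j⁆]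
    simp only [map_sum, map_smul, Finset.sum_mul, LinearMap.sum_apply, smul_mul_assoc,
      LinearMap.smul_apply, Finset.smul_sum, smul_smul, Module.End.mul_apply]
    refine Finset.sum_congr rfl fun i _ => ?_
    rw [cplx_symm]
  simp only [h1]
  rw [gamma, map_smul, LinearMap.smul_apply, op₃, formSum_apply,
    finsum_eq_finsum_comp (φ := fun x : ι × ι × ι =>
      ![(x.2.2, (0 : ℤ)), (x.2.1, (0 : ℤ)), (x.1, (0 : ℤ))])]
  · rw [finsum_eq_sum_of_fintype, Fintype.sum_prod_type, Finset.smul_sum, Finset.smul_sum]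
    refine Finset.sum_congr rfl fun k _ => ?_
    rw [Fintype.sum_prod_type, Finset.smul_sum, Finset.smul_sum]
    refine Finset.sum_congr rfl fun j _ => ?_
    rw [Finset.smul_sum, Finset.smul_sum]
    refine Finset.sum_congr rfl fun i _ => ?_
    rw [fundamentalForm_loopBasis, mono₃, loopDual_eq, loopDual_eq, loopDual_eq, if_pos (by simp)]
    simp only [Matrix.cons_val_zero, Matrix.cons_val_one, Matrix.cons_val, no₃, no₂, neg_zero,
      LinearMap.sub_apply, LinearMap.add_apply, LinearMap.smul_apply, Module.End.one_apply,
      Module.End.mul_apply, map_sub, map_smul, contractionForm_mode, cplx_cplxBasis hb]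
    have hjj : ∀ X Y : Cplx 𝔤, K.cplx X ⁅X, Y⁆ = 0 := fun X Y => by
      rw [← cplx_invariant, lie_self, map_zero, LinearMap.zero_apply]
    have hkj : ∀ X Y : Cplx 𝔤, K.cplx X ⁅Y, X⁆ = 0 := fun X Y => by
      rw [← lie_skew, map_neg, hjj, neg_zero]
    rw [← lie_skew (cplxBasis b k), map_neg]
    -- The structure constants vanish whenever two indices coincide, which removes all contraction
    -- terms.
    by_cases h1 : i = j
    · subst h1
      simp [hjj]
    · by_cases h2 : i = k
      · subst h2
        simp [hkj]
      · by_cases h3 : j = k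
        · subst h3
          simp
        · simp only [h1, h2, h3, if_false, ite_self, mul_zero, zero_smul, sub_zero, add_zero]
          module
  · rintro ⟨k, j, i⟩ ⟨k', j', i'⟩ h
    have h0 := congrFun h 0
    have h1 := congrFun h 1
    have h2 := congrFun h 2
    simp only [Matrix.cons_val_zero, Matrix.cons_val_one, Matrix.cons_val, Prod.mk.injEq, and_true]
      at h0 h1 h2
    subst h0 h1 h2
    rfl
  · intro f hf
    have hω : fundamentalForm K (fun j => loopBasis b (f j)) ≠ 0 := fun h => hf (by
      simp only
      rw [h, zero_smul])
    have hle : ∀ j, (f j).2 ≤ 0 := by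
      intro j
      by_contra hj
      refine hf ?_
      simp only
      rw [P.mono₃_apply_eq_zero b (not_le.1 hj) (hv _ _ (by omega)), smul_zero]
    rw [fundamentalForm_loopBasis] at hω
    have hsum : (f 0).2 + ((f 1).2 + (f 2).2) = 0 := by
      by_contra h
      rw [if_neg h, mul_zero] at hω
      exact hω rfl
    have h0 := hle 0
    have h1 := hle 1
    have h2 := hle 2
    refine ⟨((f 2).1, (f 1).1, (f 0).1), ?_⟩
    ext i
    · fin_cases i <;> simp
    · fin_cases i
      · simp; omega
      · simp; omega
      · simp; omega

end PositiveEnergyModule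

end LoopClifford

end

noncomputable section

namespace LoopClifford

variable {𝔤 : Type*} [LieRing 𝔤] [LieAlgebra ℝ 𝔤] {K : InvariantInnerProduct 𝔤}
  {ι : Type*} [Fintype ι] [DecidableEq ι] {b : Module.Basis ι ℝ 𝔤}
  {V : Type*} [AddCommGroup V] [Module ℂ V]

/-! ### Rotation as a derivation of the loop algebra. -/

theorem loop_smul_lie (a : ℂ) (ξ η : Loop 𝔤) : ⁅a • ξ, η⁆ = a • ⁅ξ, η⁆ := smul_lie a ξ η

theorem loop_lie_smul (a : ℂ) (ξ η : Loop 𝔤) : ⁅ξ, a • η⁆ = a • ⁅ξ, η⁆ := lie_smul a ξ η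

theorem rot_lie (ξ η : Loop 𝔤) : rot ⁅ξ, η⁆ = ⁅rot ξ, η⁆ + ⁅ξ, rot η⁆ := by
  induction ξ using loop_induction with
  | h0 => simp
  | hadd ξ ξ' h h' => simp only [add_lie, map_add, h, h']; abel
  | hmode m X =>
    induction η using loop_induction with
    | h0 => simp
    | hadd ξ ξ' h h' => simp only [lie_add, map_add, h, h']; abel
    | hmode n Y =>
      simp only [lie_mode, rot_mode, loop_smul_lie, loop_lie_smul]
      push_cast
      module

theorem rot_mode_zero (X : Cplx 𝔤) : rot (mode 0 X) = 0 := by simp [rot_mode]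

/-! ### The cubic Dirac element in the finite dimensional Clifford algebra -/

section FiniteDimensional

variable {A : Type*} [Ring A] [Algebra ℂ A] {x : Cplx 𝔤 →ₗ[ℂ] A}

/-- Let `T` be the left side. Summing the Jacobi identity against `eₖ eⱼ eₗ` and relabelling gives
three copies of `T` with cyclically permuted Clifford factors. Restoring the order by the Clifford
relations costs only Casimir sums, whence `3T = -12 c dim 𝔤`. -/
theorem sum_mul_sum_mul_lie_lie (hb : K.IsOrthonormal b) {c : ℝ}
    (hc : casimirAd b = c • (1 : Module.End ℝ 𝔤))
    (hx : ∀ X Y, x X * x Y + x Y * x X = algebraMap ℂ A (2 * K.cplx X Y)) :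
    ∑ k, ∑ j, ∑ l, x (cplxBasis b k) * x (cplxBasis b j) * x (cplxBasis b l) *
      x ⁅⁅cplxBasis b k, cplxBasis b j⁆, cplxBasis b l⁆ =
        algebraMap ℂ A (-4 * c * Fintype.card ι) := by
  set e := cplxBasis b with he
  set L : ι → ι → ι → A := fun k j l => x ⁅⁅e k, e j⁆, e l⁆ with hL
  have hjac : ∀ k j l, L k j l + L j l k + L l k j = 0 := by
    intro k j l
    simp only [hL, ← map_add]
    convert map_zero x
    have := lie_jacobi (e k) (e j) (e l)
    rw [← lie_skew ⁅e k, e j⁆, ← lie_skew ⁅e j, e l⁆, ← lie_skew ⁅e l, e k⁆]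
    rw [← neg_eq_zero]
    simp only [neg_add, neg_neg]
    rw [← this]
    abel
  have hcomm : ∀ k j, x (e k) * x (e j) = algebraMap ℂ A (if k = j then 2 else 0) -
      x (e j) * x (e k) := by
    intro k j
    rw [eq_sub_iff_add_eq, hx, he, cplx_cplxBasis hb]
    split_ifs <;> simp
  have hsq : ∀ k, x (e k) * x (e k) = 1 := by
    intro k
    have h := hx (e k) (e k)
    rw [he, cplx_cplxBasis hb, if_pos rfl, ← two_smul ℂ, Algebra.algebraMap_eq_smul_one, mul_one]
      at h
    exact smul_right_injective A (two_ne_zero (α := ℂ)) h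
  have cyc : ∀ G : ι → ι → ι → A, ∑ k, ∑ j, ∑ l, G j l k = ∑ k, ∑ j, ∑ l, G k j l := by
    intro G
    rw [Finset.sum_comm]
    exact Finset.sum_congr rfl fun j _ => Finset.sum_comm
  have t1 : ∀ k j l, x (e l) * x (e k) * x (e j) = x (e k) * x (e j) * x (e l) +
      (if l = k then (2 : ℂ) else 0) • x (e j) - (if l = j then (2 : ℂ) else 0) • x (e k) := by
    intro k j l
    rw [hcomm l k, sub_mul, mul_assoc, hcomm l j, mul_sub, ← Algebra.smul_def, ← mul_assoc,
      ← Algebra.commutes, ← Algebra.smul_def]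
    abel
  have t2 : ∀ k j l, x (e j) * x (e l) * x (e k) = x (e k) * x (e j) * x (e l) +
      (if l = k then (2 : ℂ) else 0) • x (e j) - (if k = j then (2 : ℂ) else 0) • x (e l) := by
    intro k j l
    rw [mul_assoc, hcomm l k, mul_sub, ← Algebra.commutes, ← Algebra.smul_def, ← mul_assoc,
      ← sub_eq_iff_eq_add.2 (eq_sub_iff_add_eq.1 (hcomm k j)).symm, sub_mul, ← Algebra.smul_def]
    abel
  have h1 : ∑ k, ∑ j, ∑ l, x (e k) * x (e j) * x (e l) * L j l k =
      ∑ k, ∑ j, ∑ l, x (e l) * x (e k) * x (e j) * L k j l :=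
    cyc fun k j l => x (e l) * x (e k) * x (e j) * L k j l
  have h2 : ∑ k, ∑ j, ∑ l, x (e k) * x (e j) * x (e l) * L l k j =
      ∑ k, ∑ j, ∑ l, x (e j) * x (e l) * x (e k) * L k j l := by
    rw [← cyc, ← cyc]
  have hsum : ∑ k, ∑ j, ∑ l, x (e k) * x (e j) * x (e l) * (L k j l + L j l k + L l k j) = 0 := by
    simp [hjac]
  simp only [mul_add, Finset.sum_add_distrib] at hsum
  rw [h1, h2] at hsum
  have s1 : ∑ k, ∑ j, ∑ l, x (e l) * x (e k) * x (e j) * L k j l =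
      ∑ k, ∑ j, ∑ l, x (e k) * x (e j) * x (e l) * L k j l +
        (2 : ℂ) • ∑ j, x (e j) * ∑ k, L k j k - (2 : ℂ) • ∑ k, x (e k) * ∑ j, L k j j := by
    have hl : ∀ k j, ∑ l, x (e l) * x (e k) * x (e j) * L k j l =
        ∑ l, x (e k) * x (e j) * x (e l) * L k j l + (2 : ℂ) • (x (e j) * L k j k) -
          (2 : ℂ) • (x (e k) * L k j j) := by
      intro k j
      rw [Finset.sum_congr rfl fun l _ => show _ = x (e k) * x (e j) * x (e l) * L k j l +
        (if l = k then (2 : ℂ) else 0) • (x (e j) * L k j l) -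
          (if l = j then (2 : ℂ) else 0) • (x (e k) * L k j l) by
        rw [t1, sub_mul, add_mul, smul_mul_assoc, smul_mul_assoc]]
      rw [Finset.sum_sub_distrib, Finset.sum_add_distrib]
      simp only [ite_smul, zero_smul, Finset.sum_ite_eq', Finset.mem_univ, if_true]
    simp only [hl, Finset.sum_add_distrib, Finset.sum_sub_distrib, Finset.mul_sum,
      ← Finset.smul_sum]
    rw [Finset.sum_comm (f := fun k j => x (e j) * L k j k)]
  have s2 : ∑ k, ∑ j, ∑ l, x (e j) * x (e l) * x (e k) * L k j l =
      ∑ k, ∑ j, ∑ l, x (e k) * x (e j) * x (e l) * L k j l +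
        (2 : ℂ) • ∑ j, x (e j) * ∑ k, L k j k := by
    have hl : ∀ k j, ∑ l, x (e j) * x (e l) * x (e k) * L k j l =
        ∑ l, x (e k) * x (e j) * x (e l) * L k j l + (2 : ℂ) • (x (e j) * L k j k) := by
      intro k j
      rw [Finset.sum_congr rfl fun l _ => show _ = x (e k) * x (e j) * x (e l) * L k j l +
        (if l = k then (2 : ℂ) else 0) • (x (e j) * L k j l) by
        -- The correction from exchanging `eₖ` and `eⱼ` multiplies `[eₖ, eⱼ]`, hence vanishes for `k
        -- = j`.
        have hkj : (if k = j then (2 : ℂ) else 0) • (x (e l) * L k j l) = 0 := by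
          split_ifs with h
          · subst h
            simp [hL]
          · exact zero_smul _ _
        rw [t2, sub_mul, add_mul, smul_mul_assoc, smul_mul_assoc, hkj, sub_zero]]
      rw [Finset.sum_add_distrib]
      simp only [ite_smul, zero_smul, Finset.sum_ite_eq', Finset.mem_univ, if_true]
    simp only [hl, Finset.sum_add_distrib, Finset.mul_sum, ← Finset.smul_sum]
    rw [Finset.sum_comm (f := fun k j => x (e j) * L k j k)]
  have hcas : ∀ j, ∑ k, L k j k = (2 * c : ℂ) • x (e j) := by
    intro j
    simp only [hL]
    rw [← map_sum, ← map_smul]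
    congr 1
    have h := sum_lie_lie b hc (e j)
    rw [← neg_inj, ← Finset.sum_neg_distrib]
    simp only [lie_skew]
    rw [← he] at h
    rw [h]
    module
  have hcas' : ∀ k, ∑ j, L k j j = (-2 * c : ℂ) • x (e k) := by
    intro k
    simp only [hL]
    rw [← map_sum, ← map_smul]
    congr 1
    have h := sum_lie_lie b hc (e k)
    rw [← he] at h
    rw [← h]
    refine Finset.sum_congr rfl fun j _ => ?_
    rw [← lie_skew, ← lie_skew (e k), lie_neg, neg_neg]
  rw [s1, s2] at hsum
  simp only [hcas, hcas', mul_smul_comm, hsq, Finset.sum_const, Finset.card_univ] at hsum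
  rw [Algebra.algebraMap_eq_smul_one]
  -- The corrections in `s1` and `s2` consist of three Casimir sums, each contributing `4 c dim 𝔤`.
  have h3 : (3 : ℂ) • ∑ k, ∑ j, ∑ l, x (e k) * x (e j) * x (e l) * L k j l =
      (3 : ℂ) • ((-4 * c * Fintype.card ι : ℂ) • (1 : A)) := by
    rw [← sub_eq_zero, ← hsum, ← Nat.cast_smul_eq_nsmul ℂ]
    module
  exact smul_right_injective A (three_ne_zero (α := ℂ)) h3

/-- For fixed `j` and `l`, invariance of `∑ eₖ ⊗ eₖ` moves `ad eⱼ` from the first factor to the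
second, which turns the sum of squares into the quartic expression above. -/
theorem sum_spin_mul_spin (hb : K.IsOrthonormal b) {c : ℝ}
    (hc : casimirAd b = c • (1 : Module.End ℝ 𝔤))
    (hx : ∀ X Y, x X * x Y + x Y * x X = algebraMap ℂ A (2 * K.cplx X Y)) :
    ∑ k, (∑ j, x ⁅cplxBasis b k, cplxBasis b j⁆ * x (cplxBasis b j)) *
      (∑ l, x ⁅cplxBasis b k, cplxBasis b l⁆ * x (cplxBasis b l)) =
        algebraMap ℂ A (-4 * c * Fintype.card ι) := by
  rw [← sum_mul_sum_mul_lie_lie hb hc hx]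
  set e := cplxBasis b with he
  have key : ∀ j l, ∑ k, x ⁅e k, e j⁆ * x (e j) * (x ⁅e k, e l⁆ * x (e l)) =
      ∑ k, x (e k) * x (e j) * x (e l) * x ⁅⁅e k, e j⁆, e l⁆ := by
    intro j l
    have h := sum_lie_mul hb (LinearMap.mulRight ℂ (x (e j)) ∘ₗ x)
      (LinearMap.mulRight ℂ (x (e l)) ∘ₗ x ∘ₗ
        (LieAlgebra.ad ℂ (Cplx 𝔤) (e l) : Module.End ℂ (Cplx 𝔤))) (e j)
    simp only [LinearMap.comp_apply, LinearMap.mulRight_apply, LieAlgebra.ad_apply, ← he] at h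
    calc ∑ k, x ⁅e k, e j⁆ * x (e j) * (x ⁅e k, e l⁆ * x (e l))
        = ∑ k, x ⁅e j, e k⁆ * x (e j) * (x ⁅e l, e k⁆ * x (e l)) := by
          refine Finset.sum_congr rfl fun k _ => ?_
          rw [← lie_skew, ← lie_skew (e k) (e l), map_neg, map_neg]
          simp only [neg_mul, mul_neg, neg_neg]
      _ = _ := h
      _ = _ := by
          rw [← Finset.sum_neg_distrib]
          refine Finset.sum_congr rfl fun k _ => ?_
          -- The element `[eₗ, [eⱼ, eₖ]]` is orthogonal to `eₗ`, so the two anticommute.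
          have h2 := hx ⁅e l, ⁅e j, e k⁆⁆ (e l)
          rw [← cplx_symm, ← cplx_invariant, lie_self, map_zero, LinearMap.zero_apply, mul_zero,
            map_zero, add_eq_zero_iff_eq_neg] at h2
          rw [h2, ← lie_skew (e k) (e j), neg_lie, lie_skew]
          simp only [mul_neg, neg_neg, mul_assoc]
  simp only [Finset.sum_mul_sum]
  rw [Finset.sum_comm]
  conv_rhs => rw [Finset.sum_comm]
  refine Finset.sum_congr rfl fun j _ => ?_
  rw [Finset.sum_comm]
  conv_rhs => rw [Finset.sum_comm]
  exact Finset.sum_congr rfl fun l _ => key j l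

end FiniteDimensional
end LoopClifford

end

noncomputable section

namespace LoopClifford

variable {𝔤 : Type*} [LieRing 𝔤] [LieAlgebra ℝ 𝔤] {K : InvariantInnerProduct 𝔤}
  {ι : Type*} [Fintype ι] [DecidableEq ι] {b : Module.Basis ι ℝ 𝔤}
  {V : Type*} [AddCommGroup V] [Module ℂ V]

namespace PositiveEnergyModule

variable (P : PositiveEnergyModule K V)

/-! ### The brackets -/

variable (b) in
theorem op₂_commute_of_commute {T : Module.End ℂ V} (hT : ∀ ξ, T * P.cl ξ = P.cl ξ * T)
    (ω : FormPlus 𝔤 2) : T * P.op₂ b ω = P.op₂ b ω * T := by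
  refine commute_formSum b _ ω fun f => ?_
  rw [mono₂, no₂, mul_sub, sub_mul, ← mul_assoc, hT, mul_assoc, hT, mul_assoc, mul_smul_comm,
    smul_mul_assoc, one_mul, mul_one]

variable (b) in
-- The two signs from passing a quadratic monomial cancel, so anticommuting with all `cl` also
-- implies commuting with every `op₂`.
theorem op₂_commute_of_anticommute {T : Module.End ℂ V} (hT : ∀ ξ, T * P.cl ξ = -(P.cl ξ * T))
    (ω : FormPlus 𝔤 2) : T * P.op₂ b ω = P.op₂ b ω * T := by
  refine commute_formSum b _ ω fun f => ?_
  rw [mono₂, no₂, mul_sub, sub_mul, ← mul_assoc, hT, neg_mul, mul_assoc, hT, mul_neg, neg_neg,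
    mul_assoc, mul_smul_comm, smul_mul_assoc, one_mul, mul_one]

theorem ads_cl_apply (hb : K.IsOrthonormal b) (ξ η : Loop 𝔤) (v : V) :
    P.ads b ξ (P.cl η v) = P.cl ⁅ξ, η⁆ v + P.cl η (P.ads b ξ v) := by
  have h := congrArg (fun T : Module.End ℂ V => T v) (P.ads_comm_cl hb ξ η)
  exact sub_eq_iff_eq_add.1 h

theorem adsRot_cl_apply (hb : K.IsOrthonormal b) (η : Loop 𝔤) (v : V) :
    P.adsRot b (P.cl η v) = P.cl (rot η) v + P.cl η (P.adsRot b v) := by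
  have h := congrArg (fun T : Module.End ℂ V => T v) (P.adsRot_comm_cl hb η)
  exact sub_eq_iff_eq_add.1 h

theorem gamma_cl_apply (hb : K.IsOrthonormal b) (η : Loop 𝔤) (v : V) :
    P.gamma b (P.cl η v) = P.ads b η v - P.cl η (P.gamma b v) := by
  have h := congrArg (fun T : Module.End ℂ V => T v) (P.gamma_anticomm_cl hb η)
  exact eq_sub_iff_add_eq.2 h

theorem isVacuum_ads (hb : K.IsOrthonormal b) {v : V} (hv : P.IsVacuum v) {m : ℤ} (hm : m ≤ 0)
    (X : Cplx 𝔤) : P.IsVacuum (P.ads b (mode m X) v) := by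
  intro n Y hn
  have h := P.ads_cl_apply hb (mode m X) (mode n Y) v
  rw [lie_mode, hv.cl_mode hn, hv.cl_mode (by omega), map_zero, zero_add] at h
  exact h.symm

/-- The anticommutator of `γ` with a negative mode is `ads` of that mode, which also kills the
vacuum. -/
theorem isVacuum_gamma (hb : K.IsOrthonormal b) {v : V} (hv : P.IsVacuum v) :
    P.IsVacuum (P.gamma b v) := by
  intro n Y hn
  have h := P.gamma_cl_apply hb (mode n Y) v
  rw [hv.cl_mode hn, map_zero, P.ads_mode_neg_vacuum hv hn, zero_sub, eq_comm, neg_eq_zero] at h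
  exact h

theorem adsRot_quad_vacuum (hb : K.IsOrthonormal b) {v : V} (hv : P.IsVacuum v) (m : ℕ)
    (X : Cplx 𝔤) : P.adsRot b (P.quad b m X v) = (Complex.I * m) • P.quad b m X v := by
  simp only [quad, LinearMap.smul_apply, LinearMap.sum_apply, map_smul, map_sum,
    Module.End.mul_apply, Finset.smul_sum]
  refine Finset.sum_congr rfl fun a _ => Finset.sum_congr rfl fun j _ => ?_
  rw [adsRot_cl_apply P hb, adsRot_cl_apply P hb, P.adsRot_vacuum hv, rot_mode, rot_mode]
  simp only [map_smul, map_zero, LinearMap.smul_apply, add_zero]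
  push_cast
  module

theorem adsRot_comm_ads (hb : K.IsOrthonormal b) (ξ : Loop 𝔤) :
    P.adsRot b * P.ads b ξ - P.ads b ξ * P.adsRot b = P.ads b (rot ξ) := by
  have h : (LinearMap.mulLeft ℂ (P.adsRot b) - LinearMap.mulRight ℂ (P.adsRot b)) ∘ₗ P.ads b =
      P.ads b ∘ₗ rot := by
    refine ext_mode fun n X => ?_
    simp only [LinearMap.comp_apply, LinearMap.sub_apply, LinearMap.mulLeft_apply,
      LinearMap.mulRight_apply]
    refine P.eq_of_commute (fun η => ?_) fun v hv => ?_
    · rw [ads_comm_cl P hb]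
      have h1 := P.ads_comm_cl hb (mode n X) (rot η)
      have h2 := P.adsRot_comm_cl hb ⁅mode n X, η⁆
      rw [rot_lie, map_add, ← h1, ← P.ads_comm_cl hb (mode n X) η, ← P.adsRot_comm_cl hb η] at h2
      rw [eq_sub_of_add_eq h2.symm]
      noncomm_ring
    · simp only [LinearMap.sub_apply, Module.End.mul_apply]
      rw [P.adsRot_vacuum hv, map_zero, sub_zero, rot_mode, map_smul, LinearMap.smul_apply]
      rcases lt_or_ge n 0 with hn | hn
      · rw [P.ads_mode_neg_vacuum hv hn, map_zero, smul_zero]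
      · lift n to ℕ using hn
        rw [P.ads_mode_vacuum hb hv, P.adsRot_quad_vacuum hb hv]
        simp
  exact congrArg (fun f => f ξ) h

/-- Anticommuting the bracket with `cl η` reproduces `[adsRot, ads η] = ads (rot η)` and gives zero;
on the vacuum both products vanish because `γ` preserves it. -/
theorem gamma_comm_adsRot (hb : K.IsOrthonormal b) :
    P.gamma b * P.adsRot b - P.adsRot b * P.gamma b = 0 := by
  refine P.eq_of_anticommute (fun η => ?_) fun v hv => ?_
  · have h1 := P.gamma_anticomm_cl hb (rot η)
    have h2 := P.adsRot_comm_ads hb η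
    rw [← h1, ← P.gamma_anticomm_cl hb η, ← P.adsRot_comm_cl hb η] at h2
    rw [zero_mul, mul_zero, add_zero, ← sub_eq_zero.2 h2.symm]
    noncomm_ring
  · simp only [LinearMap.sub_apply, Module.End.mul_apply]
    rw [P.adsRot_vacuum hv, P.adsRot_vacuum (P.isVacuum_gamma hb hv)]
    simp

variable (b) in
/-- The cocycle `[½dξ*, ½dη*] - ½d[ξ, η]*`. -/
def cocycle (ξ η : Loop 𝔤) : Module.End ℂ V :=
  P.ads b ξ * P.ads b η - P.ads b η * P.ads b ξ - P.ads b ⁅ξ, η⁆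

/-- On Clifford generators `ads` acts by the adjoint action, so the Jacobi identity cancels every
contribution. -/
theorem cocycle_comm_cl (hb : K.IsOrthonormal b) (ξ η ζ : Loop 𝔤) :
    P.cocycle b ξ η * P.cl ζ = P.cl ζ * P.cocycle b ξ η := by
  have h1 := P.ads_comm_cl hb ξ ⁅η, ζ⁆
  have h2 := P.ads_comm_cl hb η ⁅ξ, ζ⁆
  have h3 := P.ads_comm_cl hb ⁅ξ, η⁆ ζ
  rw [lie_lie, map_sub, ← h1, ← h2, ← P.ads_comm_cl hb η ζ, ← P.ads_comm_cl hb ξ ζ] at h3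
  rw [cocycle, ← sub_eq_zero, ← sub_eq_zero.2 h3.symm]
  noncomm_ring

theorem adsRot_comm_cocycle (hb : K.IsOrthonormal b) (ξ η : Loop 𝔤) :
    P.adsRot b * P.cocycle b ξ η - P.cocycle b ξ η * P.adsRot b =
      P.cocycle b (rot ξ) η + P.cocycle b ξ (rot η) := by
  have h := P.adsRot_comm_ads hb ⁅ξ, η⁆
  rw [rot_lie, map_add] at h
  simp only [cocycle, ← P.adsRot_comm_ads hb ξ, ← P.adsRot_comm_ads hb η]
  rw [eq_sub_of_add_eq h.symm]
  noncomm_ring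

/-- The cocycle commutes with all `cl`, hence with the quadratic operator `adsRot`; yet that
commutator multiplies it by `i(m + n)`. -/
theorem cocycle_mode_of_ne (hb : K.IsOrthonormal b) {m n : ℤ} (hmn : m + n ≠ 0) (X Y : Cplx 𝔤) :
    P.cocycle b (mode m X) (mode n Y) = 0 := by
  have h := P.adsRot_comm_cocycle hb (mode m X) (mode n Y)
  rw [adsRot, ← P.op₂_commute_of_commute b (P.cocycle_comm_cl hb _ _), sub_self, rot_mode,
    rot_mode] at h
  have h' : (Complex.I * (m + n)) • P.cocycle b (mode m X) (mode n Y) = 0 := by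
    rw [h]
    simp only [cocycle, map_smul, loop_smul_lie, loop_lie_smul, smul_mul_assoc, mul_smul_comm]
    module
  refine (smul_eq_zero.1 h').resolve_left (mul_ne_zero Complex.I_ne_zero ?_)
  exact_mod_cast hmn

theorem ads_quad_vacuum (hb : K.IsOrthonormal b) {c : ℝ}
    (hc : casimirAd b = c • (1 : Module.End ℝ 𝔤)) {v : V} (hv : P.IsVacuum v) (m : ℕ)
    (X Y : Cplx 𝔤) : P.ads b (mode (-m) Y) (P.quad b m X v) =
      P.quad b m X (P.ads b (mode (-m) Y) v) - (m * c * K.cplx X Y) • v +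
        P.ads b (mode 0 ⁅Y, X⁆) v := by
  have h1 : P.ads b (mode (-m) Y) (P.quad b m X v) - P.quad b m X (P.ads b (mode (-m) Y) v) =
      -- `ads` acts as a derivation on the two Clifford factors of `quad`.
      (1 / 4 : ℂ) • ∑ a ∈ Finset.range (m + 1), ∑ j,
        (P.cl (mode (-a) ⁅Y, ⁅X, cplxBasis b j⁆⁆) (P.cl (mode a (cplxBasis b j)) v) +
          P.cl (mode (m - a) ⁅X, cplxBasis b j⁆) (P.cl (mode (a - m) ⁅Y, cplxBasis b j⁆) v)) := by
    simp only [quad, LinearMap.smul_apply, LinearMap.sum_apply, map_smul, map_sum,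
      Module.End.mul_apply]
    rw [← smul_sub, ← Finset.sum_sub_distrib]
    congr 1
    refine Finset.sum_congr rfl fun a _ => ?_
    rw [← Finset.sum_sub_distrib]
    refine Finset.sum_congr rfl fun j _ => ?_
    rw [ads_cl_apply P hb, ads_cl_apply P hb, map_add, lie_mode, lie_mode]
    rw [show -(m : ℤ) + (m - a) = -a by ring, show -(m : ℤ) + a = a - m by ring]
    abel
  -- For positive index the first summand is a full contraction, so the trace form appears. There
  -- are `m` such indices, which with the prefactor `¼` give `-m c ⟨X, Y⟩`.
  have h2 : ∀ a : ℕ, ∑ j, P.cl (mode (-((a + 1 : ℕ) : ℤ)) ⁅Y, ⁅X, cplxBasis b j⁆⁆)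
      (P.cl (mode ((a + 1 : ℕ) : ℤ) (cplxBasis b j)) v) = (-4 * c * K.cplx X Y) • v := by
    intro a
    have : ∀ j, P.cl (mode (-((a + 1 : ℕ) : ℤ)) ⁅Y, ⁅X, cplxBasis b j⁆⁆)
        (P.cl (mode ((a + 1 : ℕ) : ℤ) (cplxBasis b j)) v) =
        (2 * K.cplx ⁅Y, ⁅X, cplxBasis b j⁆⁆ (cplxBasis b j)) • v := by
      intro j
      rw [hv.cl_cl_of_neg (by omega), if_pos (by ring)]
    simp only [this]
    rw [← Finset.sum_smul, ← Finset.mul_sum, sum_cplx_lie_lie K b hc]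
    congr 1
    ring
  have h3 : ∀ a ∈ Finset.range m, ∑ j, P.cl (mode (m - a) ⁅X, cplxBasis b j⁆)
      (P.cl (mode (a - m) ⁅Y, cplxBasis b j⁆) v) = 0 := by
    intro a ha
    rw [Finset.mem_range] at ha
    refine Finset.sum_eq_zero fun j _ => ?_
    rw [hv.cl_mode (by omega), map_zero]
  have h4 := sum_lie_mul hb (P.cl ∘ₗ mode 0 ∘ₗ
    (LieAlgebra.ad ℂ (Cplx 𝔤) X : Module.End ℂ (Cplx 𝔤))) (P.cl ∘ₗ mode 0) Y
  have h5 := P.ads_mode_vacuum hb hv 0 ⁅Y, X⁆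
  rw [Nat.cast_zero] at h5
  -- The uncontracted remainders, at `a = 0` in the first summand and `a = m` in the second, involve
  -- only zero modes and combine to `quad` of `[Y, X]`.
  have h6 : ∑ j, P.cl (mode 0 ⁅Y, ⁅X, cplxBasis b j⁆⁆) (P.cl (mode 0 (cplxBasis b j)) v) +
      ∑ j, P.cl (mode 0 ⁅X, cplxBasis b j⁆) (P.cl (mode 0 ⁅Y, cplxBasis b j⁆) v) =
      ∑ j, P.cl (mode 0 ⁅⁅Y, X⁆, cplxBasis b j⁆) (P.cl (mode 0 (cplxBasis b j)) v) := by
    have h7 := congrArg (fun T : Module.End ℂ V => T v) h4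
    simp only [LinearMap.comp_apply, LieAlgebra.ad_apply, LinearMap.sum_apply, LinearMap.neg_apply,
      Module.End.mul_apply] at h7
    simp only [lie_lie, map_sub, LinearMap.sub_apply, Finset.sum_sub_distrib, h7]
    abel
  rw [eq_add_of_sub_eq' h1, h5, quad_zero]
  simp only [Finset.sum_add_distrib]
  rw [Finset.sum_range_succ', Finset.sum_range_succ (fun a : ℕ => ∑ j, P.cl (mode (m - a) _) _),
    Finset.sum_eq_zero h3]
  simp only [h2, Nat.cast_zero, neg_zero, sub_self, zero_add, add_assoc, h6, Finset.sum_const,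
    Finset.card_range, LinearMap.smul_apply, LinearMap.sum_apply, Module.End.mul_apply]
  module

/-- As `-m ≤ 0`, applying `ads (mode (-m) Y)` gives a vacuum vector again, so in both orders `ads
(mode m X)` may be replaced by `quad`. -/
theorem ads_comm_ads_vacuum (hb : K.IsOrthonormal b) {c : ℝ}
    (hc : casimirAd b = c • (1 : Module.End ℝ 𝔤)) {v : V} (hv : P.IsVacuum v) (m : ℕ)
    (X Y : Cplx 𝔤) :
    P.cocycle b (mode m X) (mode (-m) Y) v = (m * c * K.cplx X Y) • v := by
  simp only [cocycle, LinearMap.sub_apply, Module.End.mul_apply]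
  rw [P.ads_mode_vacuum hb hv, P.ads_mode_vacuum hb (P.isVacuum_ads hb hv (by omega) Y),
    P.ads_quad_vacuum hb hc hv, lie_mode, add_neg_cancel, ← lie_skew X Y, map_neg, map_neg,
    LinearMap.neg_apply]
  abel

theorem cocycle_eq (hb : K.IsOrthonormal b) {c : ℝ}
    (hc : casimirAd b = c • (1 : Module.End ℝ 𝔤)) (ξ η : Loop 𝔤) :
    P.cocycle b ξ η = (Complex.I * c * K.loop ξ (rot η)) • 1 := by
  have key : ∀ (m : ℕ) (X Y : Cplx 𝔤), P.cocycle b (mode m X) (mode (-m) Y) =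
      (m * c * K.cplx X Y) • 1 := by
    intro m X Y
    refine P.eq_of_commute (fun ζ => ?_) fun v hv => ?_
    · rw [P.cocycle_comm_cl hb, smul_mul_assoc, mul_smul_comm, one_mul, mul_one, sub_self, sub_self]
    · rw [P.ads_comm_ads_vacuum hb hc hv]
      rfl
  induction ξ using loop_induction with
  | h0 => simp [cocycle]
  | hadd ξ ξ' h h' =>
    simp only [map_add, LinearMap.add_apply, mul_add, add_smul, ← h, ← h']
    simp only [cocycle, map_add, add_lie, add_mul, mul_add]
    abel
  | hmode m X =>
    induction η using loop_induction with
    | h0 => simp [cocycle]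
    | hadd η η' h h' =>
      simp only [map_add, mul_add, add_smul, ← h, ← h']
      simp only [cocycle, map_add, lie_add, add_mul, mul_add]
      abel
    | hmode n Y =>
      rw [rot_mode, map_smul, loop_mode]
      by_cases hmn : m + n = 0
      · obtain rfl : n = -m := by omega
        rw [if_pos hmn]
        rcases le_total 0 m with hm | hm
        · lift m to ℕ using hm
          rw [key]
          congr 1
          push_cast
          rw [smul_eq_mul]
          linear_combination (m * c * K.cplx X Y : ℂ) * Complex.I_sq
        -- The vacuum computation covers nonnegative `m`; the other sign follows from skewness of
        -- the cocycle.
        · obtain ⟨k, rfl⟩ : ∃ k : ℕ, m = -k := ⟨m.natAbs, by omega⟩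
          have h := key k Y X
          have h' : P.cocycle b (mode (-k) X) (mode k Y) =
              -P.cocycle b (mode k Y) (mode (-k) X) := by
            rw [cocycle, cocycle, ← lie_skew, map_neg]
            abel
          rw [neg_neg, h', h, ← neg_smul, cplx_symm]
          congr 1
          push_cast
          rw [smul_eq_mul]
          linear_combination -(k * c * K.cplx X Y : ℂ) * Complex.I_sq
      · rw [if_neg hmn, P.cocycle_mode_of_ne hb hmn]
        simp

theorem ads_comm_ads (hb : K.IsOrthonormal b) {c : ℝ}
    (hc : casimirAd b = c • (1 : Module.End ℝ 𝔤)) (ξ η : Loop 𝔤) :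
    P.ads b ξ * P.ads b η - P.ads b η * P.ads b ξ =
      P.ads b ⁅ξ, η⁆ + (Complex.I * c * K.loop ξ (rot η)) • 1 := by
  rw [← P.cocycle_eq hb hc, cocycle]
  abel

theorem ads_zero_comm_ads_zero (hb : K.IsOrthonormal b) {c : ℝ}
    (hc : casimirAd b = c • (1 : Module.End ℝ 𝔤)) (X Y : Cplx 𝔤) :
    P.ads b (mode 0 X) * P.ads b (mode 0 Y) =
      P.ads b (mode 0 ⁅X, Y⁆) + P.ads b (mode 0 Y) * P.ads b (mode 0 X) := by
  have h := P.ads_comm_ads hb hc (mode 0 X) (mode 0 Y)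
  rw [rot_mode_zero, map_zero, mul_zero, zero_smul, add_zero, lie_mode, add_zero] at h
  exact sub_eq_iff_eq_add.1 h

/-- Zero modes have no central term, so bracketing with `ads (mode 0 X)` rotates both factors of the
invariant tensor `∑ Xₖ ⊗ Xₖ`. -/
theorem sum_ads_cl_comm_ads (hb : K.IsOrthonormal b) {c : ℝ}
    (hc : casimirAd b = c • (1 : Module.End ℝ 𝔤)) (X : Cplx 𝔤) :
    P.ads b (mode 0 X) * ∑ k, P.ads b (mode 0 (cplxBasis b k)) * P.cl (mode 0 (cplxBasis b k)) =
      (∑ k, P.ads b (mode 0 (cplxBasis b k)) * P.cl (mode 0 (cplxBasis b k))) *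
        P.ads b (mode 0 X) := by
  have h := sum_lie_mul hb (P.ads b ∘ₗ mode 0) (P.cl ∘ₗ mode 0) X
  simp only [LinearMap.comp_apply] at h
  rw [← sub_eq_zero, Finset.mul_sum, Finset.sum_mul, ← Finset.sum_sub_distrib]
  rw [← add_eq_zero_iff_eq_neg, ← Finset.sum_add_distrib] at h
  rw [← h]
  refine Finset.sum_congr rfl fun k _ => ?_
  have h1 := P.ads_comm_cl hb (mode 0 X) (mode 0 (cplxBasis b k))
  rw [lie_mode, add_zero] at h1
  rw [← h1, ← mul_assoc, P.ads_zero_comm_ads_zero hb hc X]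
  noncomm_ring

theorem gamma_comm_ads (hb : K.IsOrthonormal b) {c : ℝ}
    (hc : casimirAd b = c • (1 : Module.End ℝ 𝔤)) (ξ : Loop 𝔤) :
    P.gamma b * P.ads b ξ - P.ads b ξ * P.gamma b =
      (1 / 2 * Complex.I * c : ℂ) • P.cl (rot ξ) := by
  -- By the super Jacobi identity the left side is minus the central term of `[ads ξ, ads η]`, which
  -- moving `rot` across the inner product turns into the right side.
  have hanti : ∀ ξ η, (P.gamma b * P.ads b ξ - P.ads b ξ * P.gamma b) * P.cl η +
      P.cl η * (P.gamma b * P.ads b ξ - P.ads b ξ * P.gamma b) =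
        ((1 / 2 * Complex.I * c : ℂ) • P.cl (rot ξ)) * P.cl η +
          P.cl η * ((1 / 2 * Complex.I * c : ℂ) • P.cl (rot ξ)) := by
    intro ξ η
    rw [smul_mul_assoc, mul_smul_comm, ← smul_add, P.clifford, loop_symm K _ η,
      ← neg_eq_iff_eq_neg.2 (loop_rot K ξ η), smul_smul]
    have h1 := P.ads_comm_ads hb hc ξ η
    have h2 := P.gamma_anticomm_cl hb ⁅ξ, η⁆
    rw [← P.ads_comm_cl hb] at h2
    rw [← h2, ← P.gamma_anticomm_cl hb η] at h1
    rw [← sub_eq_zero, ← sub_eq_zero.2 h1.symm]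
    rw [show (1 / 2 * Complex.I * c * (2 * -K.loop ξ (rot η)) : ℂ) =
      -(Complex.I * c * K.loop ξ (rot η)) by ring, neg_smul]
    noncomm_ring
  have h : (LinearMap.mulLeft ℂ (P.gamma b) - LinearMap.mulRight ℂ (P.gamma b)) ∘ₗ P.ads b =
      (1 / 2 * Complex.I * c : ℂ) • P.cl ∘ₗ rot := by
    refine ext_mode fun n X => ?_
    simp only [LinearMap.comp_apply, LinearMap.sub_apply, LinearMap.mulLeft_apply,
      LinearMap.mulRight_apply, LinearMap.smul_apply]
    rcases eq_or_ne n 0 with rfl | hn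
    · refine P.eq_of_anticommute (hanti _) fun v hv => ?_
      have h1 := congrArg (fun T : Module.End ℂ V => T v) (P.sum_ads_cl_comm_ads hb hc X)
      simp only [Module.End.mul_apply, LinearMap.sum_apply] at h1
      rw [rot_mode_zero, map_zero, smul_zero, LinearMap.sub_apply, Module.End.mul_apply,
        Module.End.mul_apply, P.gamma_vacuum hb hv, P.gamma_vacuum hb (P.isVacuum_ads hb hv le_rfl X),
        map_smul, h1, sub_self, LinearMap.zero_apply]
    -- In nonzero energy no vacuum computation is needed: the defect `D` anticommutes with all `cl`,
    -- hence commutes with `adsRot`, while `hDR` says that it has weight `i n`.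
    · set D := P.gamma b * P.ads b (mode n X) - P.ads b (mode n X) * P.gamma b -
        (1 / 2 * Complex.I * c : ℂ) • P.cl (rot (mode n X)) with hD
      have hDc : ∀ η, D * P.cl η = -(P.cl η * D) := by
        intro η
        rw [← add_eq_zero_iff_eq_neg, hD, sub_mul, mul_sub, ← sub_eq_zero.2 (hanti (mode n X) η)]
        abel
      have hDR : P.adsRot b * D - D * P.adsRot b = (Complex.I * n) • D := by
        have h1 := P.gamma_comm_adsRot hb
        have h2 := sub_eq_zero.2 (P.adsRot_comm_ads hb (mode n X))
        have h3 := sub_eq_zero.2 (P.adsRot_comm_cl hb (mode n X))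
        rw [rot_mode, map_smul] at h2 h3
        rw [hD, rot_mode, map_smul, smul_smul]
        generalize P.adsRot b = R, P.gamma b = g, P.ads b (mode n X) = a, P.cl (mode n X) = x,
          Complex.I * (n : ℂ) = r, 1 / 2 * Complex.I * (c : ℂ) = s at h1 h2 h3 ⊢
        have h4 : R * (g * a - a * g - (s * r) • x) - (g * a - a * g - (s * r) • x) * R -
            r • (g * a - a * g - (s * r) • x) =
            g * (R * a - a * R - r • a) - (R * a - a * R - r • a) * g -
              (s * r) • (R * x - x * R - r • x) - (g * R - R * g) * a + a * (g * R - R * g) := by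
          simp only [mul_sub, sub_mul, mul_smul_comm, smul_mul_assoc, mul_assoc]
          module
        rw [← sub_eq_zero, h4, h1, h2, h3]
        simp
      rw [adsRot, P.op₂_commute_of_anticommute b hDc, sub_self, eq_comm, smul_eq_zero] at hDR
      exact sub_eq_zero.1 (hDR.resolve_left (mul_ne_zero Complex.I_ne_zero (by exact_mod_cast hn)))
  exact congrArg (fun f => f ξ) h

theorem gamma_sq_vacuum (hb : K.IsOrthonormal b) {c : ℝ}
    (hc : casimirAd b = c • (1 : Module.End ℝ 𝔤)) {v : V} (hv : P.IsVacuum v) :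
    P.gamma b (P.gamma b v) + P.gamma b (P.gamma b v) =
      (-(1 / 24 * c * Fintype.card ι) : ℂ) • v := by
  have hcomm : ∀ (X : Cplx 𝔤) (w : V), P.gamma b (P.ads b (mode 0 X) w) =
      P.ads b (mode 0 X) (P.gamma b w) := by
    intro X w
    have h := P.gamma_comm_ads hb hc (mode 0 X)
    rw [rot_mode_zero, map_zero, smul_zero] at h
    exact sub_eq_zero.1 (congrArg (fun T : Module.End ℂ V => T w) h)
  -- One `γ` is expanded by the cubic formula and the other is moved through it, producing `ads`
  -- from the Clifford factor. The leftover `-γ²` makes the anticommutator `{γ, γ}` appear.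
  have h1 : P.gamma b (P.gamma b v) =
      (1 / 6 : ℂ) • ∑ k, P.ads b (mode 0 (cplxBasis b k)) (P.ads b (mode 0 (cplxBasis b k)) v) -
        P.gamma b (P.gamma b v) := by
    conv_lhs => rw [P.gamma_vacuum hb hv]
    rw [P.gamma_vacuum hb (P.isVacuum_gamma hb hv), ← smul_sub, ← Finset.sum_sub_distrib, map_smul,
      map_sum]
    congr 1
    refine Finset.sum_congr rfl fun k _ => ?_
    rw [hcomm, P.gamma_cl_apply hb, map_sub]
  have h2 : ∀ (w : V), P.IsVacuum w → ∀ X, P.ads b (mode 0 X) w = P.quad b 0 X w := by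
    intro w hw X
    simpa using P.ads_mode_vacuum hb hw 0 X
  have h3 := sum_spin_mul_spin (A := Module.End ℂ V) (x := P.cl ∘ₗ mode 0) hb hc (fun X Y => by
    rw [LinearMap.comp_apply, LinearMap.comp_apply, P.clifford, loop_mode, add_zero, if_pos rfl]
    rfl)
  have h4 : ∑ k, P.ads b (mode 0 (cplxBasis b k)) (P.ads b (mode 0 (cplxBasis b k)) v) =
      (-(1 / 4 * c * Fintype.card ι) : ℂ) • v := by
    -- The `1/16` is the square of the `¼` in `quad`.
    have h5 := congrArg (fun T : Module.End ℂ V => (1 / 16 : ℂ) • T v) h3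
    simp only [LinearMap.comp_apply, LinearMap.sum_apply, Module.End.mul_apply,
      Module.algebraMap_end_apply, smul_smul] at h5
    rw [show (-(1 / 4 * c * Fintype.card ι) : ℂ) = 1 / 16 * (-4 * c * Fintype.card ι) by ring, ← h5,
      Finset.smul_sum]
    refine Finset.sum_congr rfl fun k _ => ?_
    rw [h2 _ (P.isVacuum_ads hb hv le_rfl _), h2 _ hv, quad_zero]
    simp only [LinearMap.smul_apply, LinearMap.sum_apply, Module.End.mul_apply, map_smul, smul_smul]
    norm_num
  rw [eq_sub_iff_add_eq, h4, smul_smul] at h1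
  rw [h1]
  congr 1
  ring

/-- Since `[γ², η] = [γ, {γ, η}] = [γ, ads η]`, the commutators with `cl η` agree, and only the
constant has to be read off on the vacuum. -/
theorem gamma_sq (hb : K.IsOrthonormal b) {c : ℝ}
    (hc : casimirAd b = c • (1 : Module.End ℝ 𝔤)) :
    P.gamma b * P.gamma b + P.gamma b * P.gamma b =
      (Complex.I * c) • P.adsRot b - (1 / 24 * c * Fintype.card ι : ℂ) • 1 := by
  refine P.eq_of_commute (fun η => ?_) fun v hv => ?_
  · have h1 := P.gamma_comm_ads hb hc η
    rw [← P.gamma_anticomm_cl hb η] at h1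
    have h2 : (Complex.I * c) • P.cl (rot η) =
        (2 : ℂ) • ((1 / 2 * Complex.I * c : ℂ) • P.cl (rot η)) := by
      rw [smul_smul]
      congr 1
      ring
    rw [sub_mul, mul_sub, smul_mul_assoc, mul_smul_comm, smul_mul_assoc, mul_smul_comm, one_mul,
      mul_one, sub_sub_sub_cancel_right, ← smul_sub, P.adsRot_comm_cl hb, h2, ← h1, two_smul]
    noncomm_ring
  · rw [LinearMap.add_apply, Module.End.mul_apply, P.gamma_sq_vacuum hb hc hv, LinearMap.sub_apply,
      LinearMap.smul_apply, P.adsRot_vacuum hv, smul_zero, zero_sub, LinearMap.smul_apply,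
      Module.End.one_apply, neg_smul]

end PositiveEnergyModule
end LoopClifford

end

noncomputable section

namespace LoopClifford

variable {𝔤 : Type*} [LieRing 𝔤] [LieAlgebra ℝ 𝔤] {K : InvariantInnerProduct 𝔤}
  {ι : Type*} [Fintype ι] [DecidableEq ι] {b : Module.Basis ι ℝ 𝔤}
  {V : Type*} [AddCommGroup V] [Module ℂ V]

theorem exists_loop_mode_eq_zero (K : InvariantInnerProduct 𝔤) (η : Loop 𝔤) :
    ∃ N : ℤ, ∀ n X, N < |n| → K.loop η (mode n X) = 0 := by
  induction η using loop_induction with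
  | h0 => exact ⟨0, fun n X _ => by simp⟩
  | hadd ξ η h h' =>
    obtain ⟨N, hN⟩ := h
    obtain ⟨M, hM⟩ := h'
    refine ⟨max N M, fun n X hn => ?_⟩
    rw [map_add, LinearMap.add_apply, hN n X ((le_max_left _ _).trans_lt hn),
      hM n X ((le_max_right _ _).trans_lt hn), add_zero]
  | hmode m Y =>
    refine ⟨|m|, fun n X hn => ?_⟩
    rw [loop_mode, if_neg]
    intro h
    rw [eq_neg_of_add_eq_zero_left h, abs_neg] at hn
    exact hn.false

namespace PositiveEnergyModule

variable (P : PositiveEnergyModule K V)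

/-! ### The Lie superalgebra -/

variable (b) in
/-- The span of the even operators. -/
def evenPart : Submodule ℂ (Module.End ℂ V) :=
  Submodule.span ℂ ({1} ∪ Set.range (P.ads b) ∪ {P.adsRot b})

variable (b) in
/-- The span of the odd operators. -/
def oddPart : Submodule ℂ (Module.End ℂ V) :=
  Submodule.span ℂ (Set.range P.cl ∪ {P.gamma b})

theorem mem_evenPart {x : Module.End ℂ V} :
    x ∈ P.evenPart b ↔ ∃ (a : ℂ) (ξ : Loop 𝔤) (r : ℂ), x = a • 1 + P.ads b ξ + r • P.adsRot b := by
  rw [evenPart, Submodule.span_union, Submodule.span_union, ← LinearMap.coe_range,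
    Submodule.span_eq]
  simp only [Submodule.mem_sup, Submodule.mem_span_singleton, LinearMap.mem_range]
  constructor
  · rintro ⟨_, ⟨_, ⟨a, rfl⟩, _, ⟨ξ, rfl⟩, rfl⟩, _, ⟨r, rfl⟩, rfl⟩
    exact ⟨a, ξ, r, rfl⟩
  · rintro ⟨a, ξ, r, rfl⟩
    exact ⟨_, ⟨_, ⟨a, rfl⟩, _, ⟨ξ, rfl⟩, rfl⟩, _, ⟨r, rfl⟩, rfl⟩

theorem mem_oddPart {x : Module.End ℂ V} :
    x ∈ P.oddPart b ↔ ∃ (η : Loop 𝔤) (s : ℂ), x = P.cl η + s • P.gamma b := by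
  rw [oddPart, Submodule.span_union, ← LinearMap.coe_range, Submodule.span_eq]
  simp only [Submodule.mem_sup, Submodule.mem_span_singleton, LinearMap.mem_range]
  constructor
  · rintro ⟨_, ⟨η, rfl⟩, _, ⟨s, rfl⟩, rfl⟩
    exact ⟨η, s, rfl⟩
  · rintro ⟨η, s, rfl⟩
    exact ⟨_, ⟨η, rfl⟩, _, ⟨s, rfl⟩, rfl⟩

/-- Let `x` lie in both spans and let `n` be large. Apply the mode `Z z⁻ⁿ` to `x (Z zⁿ u)`, expanded
once by the commutator and once by the anticommutator with `Z zⁿ`. As `[Z zⁿ, Z z⁻ⁿ] = 0`, all other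
terms drop out and `4 x u = -2 r i n u`. Two consecutive values of `n` then force `x u = 0`. -/
theorem disjoint_evenPart_oddPart (hb : K.IsOrthonormal b) [Nonempty ι] :
    Disjoint (P.evenPart b) (P.oddPart b) := by
  rw [Submodule.disjoint_def]
  intro x hx hx'
  obtain ⟨a, ξ, r, hev⟩ := P.mem_evenPart.1 hx
  obtain ⟨η, s, hod⟩ := P.mem_oddPart.1 hx'
  refine LinearMap.ext fun u => ?_
  obtain ⟨i⟩ := ‹Nonempty ι›
  set Z := cplxBasis b i with hZ
  obtain ⟨N₁, -, h1⟩ := P.exists_energy_bound u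
  obtain ⟨N₂, -, h2⟩ := P.exists_energy_bound (x u)
  obtain ⟨N₃, h3⟩ := exists_loop_mode_eq_zero K η
  have key : ∀ n : ℤ, N₁ < n → N₂ < n → N₃ < n →
      (4 : ℂ) • x u = -(2 * r * Complex.I * n) • u := by
    intro n hn1 hn2 hn3
    have hlie : ⁅mode n Z, mode (-n) Z⁆ = 0 := by rw [lie_mode, lie_self, map_zero]
    have hZZ : K.loop (mode (-n) Z) (mode n Z) = 1 := by
      rw [loop_mode, neg_add_cancel, if_pos rfl, hZ, cplx_cplxBasis hb, if_pos rfl]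
    have hE : x (P.cl (mode n Z) u) =
        P.cl (mode n Z) (x u) + P.cl (⁅ξ, mode n Z⁆ + (r * (Complex.I * n)) • mode n Z) u := by
      simp only [hev, LinearMap.add_apply, LinearMap.smul_apply, Module.End.one_apply, map_add,
        map_smul]
      rw [P.ads_cl_apply hb, P.adsRot_cl_apply hb, rot_mode, map_smul, LinearMap.smul_apply]
      module
    have hO : x (P.cl (mode n Z) u) = -P.cl (mode n Z) (x u) + s • P.ads b (mode n Z) u := by
      simp only [hod, LinearMap.add_apply, LinearMap.smul_apply, map_add, map_smul]
      rw [P.gamma_cl_apply hb, P.cl_swap_apply, h3 n Z (hn3.trans_le (le_abs_self n))]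
      module
    have hzz : P.cl (mode (-n) Z) (P.cl (mode n Z) (x u)) = (2 : ℂ) • x u := by
      rw [P.cl_swap_apply, hZZ, h2 n Z hn2, map_zero, mul_one, sub_zero]
    have hzE : P.cl (mode (-n) Z) (P.cl (⁅ξ, mode n Z⁆ + (r * (Complex.I * n)) • mode n Z) u) =
        (2 * (r * (Complex.I * n))) • u := by
      rw [P.cl_swap_apply, h1 n Z hn1, map_zero, sub_zero, map_add, map_smul, hZZ,
        loop_symm K _ ⁅ξ, _⁆, loop_invariant, hlie, map_zero, zero_add, smul_eq_mul, mul_one]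
    have hzO : P.cl (mode (-n) Z) (P.ads b (mode n Z) u) = 0 := by
      have h := P.ads_cl_apply hb (mode n Z) (mode (-n) Z) u
      rw [h1 n Z hn1, hlie] at h
      simpa using h.symm
    have h := congrArg (P.cl (mode (-n) Z)) (hE.symm.trans hO)
    rw [map_add (P.cl (mode (-n) Z)), map_add (P.cl (mode (-n) Z)), map_neg, map_smul, hzz, hzE, hzO,
      smul_zero, add_zero] at h
    calc (4 : ℂ) • x u = ((2 : ℂ) • x u + (2 * (r * (Complex.I * n))) • u) + (2 : ℂ) • x u -
          (2 * (r * (Complex.I * n))) • u := by module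
      _ = -(2 * r * Complex.I * n) • u := by rw [h]; module
  set n : ℤ := max N₁ (max N₂ N₃) + 1 with hn
  have e1 := key n (by omega) (by omega) (by omega)
  have e2 := key (n + 1) (by omega) (by omega) (by omega)
  rw [LinearMap.zero_apply]
  have e3 : (4 : ℂ) • x u = 0 := by
    have e4 : (2 * r * Complex.I) • u = 0 := by
      rw [e1] at e2
      rw [← sub_eq_zero.2 e2]
      push_cast
      module
    rw [e1, mul_comm, neg_smul, mul_smul, e4, smul_zero, neg_zero]
  exact (smul_eq_zero.1 e3).resolve_left (by norm_num)

theorem isLieSuperalgebra (hb : K.IsOrthonormal b) [Nonempty ι] {c : ℝ}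
    (hc : casimirAd b = c • (1 : Module.End ℝ 𝔤)) :
    IsLieSuperalgebra (P.evenPart b) (P.oddPart b) where
  disjoint := P.disjoint_evenPart_oddPart hb
  even_even := by
    intro x hx y hy
    obtain ⟨a, ξ, r, rfl⟩ := P.mem_evenPart.1 hx
    obtain ⟨a', η, r', rfl⟩ := P.mem_evenPart.1 hy
    have h1 := eq_add_of_sub_eq (P.ads_comm_ads hb hc ξ η)
    have h2 := eq_add_of_sub_eq (P.adsRot_comm_ads hb ξ)
    have h3 := eq_add_of_sub_eq (P.adsRot_comm_ads hb η)
    refine P.mem_evenPart.2 ⟨Complex.I * c * K.loop ξ (rot η),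
      ⁅ξ, η⁆ - r' • rot ξ + r • rot η, 0, ?_⟩
    simp only [add_mul, mul_add, smul_mul_assoc, mul_smul_comm, one_mul, mul_one, map_add, map_sub,
      map_smul, h1, h2, h3]
    module
  even_odd := by
    intro x hx y hy
    obtain ⟨a, ξ, r, rfl⟩ := P.mem_evenPart.1 hx
    obtain ⟨η, s, rfl⟩ := P.mem_oddPart.1 hy
    have h1 := eq_add_of_sub_eq (P.ads_comm_cl hb ξ η)
    have h2 := eq_add_of_sub_eq (P.adsRot_comm_cl hb η)
    have h3 := eq_add_of_sub_eq (P.gamma_comm_ads hb hc ξ)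
    have h4 := sub_eq_zero.1 (P.gamma_comm_adsRot hb)
    refine P.mem_oddPart.2 ⟨⁅ξ, η⁆ + r • rot η - (s * (1 / 2 * Complex.I * c)) • rot ξ, 0, ?_⟩
    simp only [add_mul, mul_add, smul_mul_assoc, mul_smul_comm, one_mul, mul_one, map_add, map_sub,
      map_smul, h1, h2, h3, h4]
    module
  odd_odd := by
    intro x hx y hy
    obtain ⟨ξ, r, rfl⟩ := P.mem_oddPart.1 hx
    obtain ⟨η, s, rfl⟩ := P.mem_oddPart.1 hy
    have h1 := eq_sub_of_add_eq (P.clifford ξ η)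
    have h2 := eq_sub_of_add_eq (P.gamma_anticomm_cl hb ξ)
    have h3 := eq_sub_of_add_eq (P.gamma_anticomm_cl hb η)
    have h4 := P.gamma_sq hb hc
    rw [← two_smul ℂ] at h4
    refine P.mem_evenPart.2 ⟨2 * K.loop ξ η - r * s * (1 / 24 * c * Fintype.card ι),
      s • ξ + r • η, r * s * (Complex.I * c), ?_⟩
    -- Replacing `i c` times `adsRot` by its expression in `γ²`, rather than solving for `adsRot`,
    -- requires no assumption that `c` is nonzero.
    have h5 : (r * s * (Complex.I * c)) • P.adsRot b = (r * s) • ((2 : ℂ) • (P.gamma b * P.gamma b) +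
        (1 / 24 * c * Fintype.card ι : ℂ) • 1) := by
      rw [h4]
      module
    rw [h5]
    simp only [add_mul, mul_add, smul_mul_assoc, mul_smul_comm, map_add, map_smul, h1, h2, h3]
    module

end PositiveEnergyModule
end LoopClifford

end

noncomputable section

namespace LoopClifford

variable {𝔤 : Type*} [LieRing 𝔤] [LieAlgebra ℝ 𝔤] (K : InvariantInnerProduct 𝔤)
  {ι : Type*} [Fintype ι] [DecidableEq ι] (b : Module.Basis ι ℝ 𝔤)
  {S : Type*} [AddCommGroup S] [Module ℂ S] (ρ : K.Cl →ₐ[ℂ] Module.End ℂ S)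

/-! ### The spin representation has positive energy -/

theorem cliffordOp_tmul (ξ : Loop 𝔤) (s : S) (x : ExteriorAlgebra ℂ (LoopPos 𝔤)) :
    cliffordOp K ρ ξ (s ⊗ₜ x) = s ⊗ₜ[ℂ] (ExteriorAlgebra.ι ℂ (posProj ξ) * x) +
      s ⊗ₜ[ℂ] CliffordAlgebra.contractLeft (negDual K ξ) x +
        ρ (CliffordAlgebra.ι _ (coeff 0 ξ)) s ⊗ₜ[ℂ] (parity x : ExteriorAlgebra ℂ (LoopPos 𝔤)) :=
  rfl

theorem ι_zero_mul (x : ExteriorAlgebra ℂ (LoopPos 𝔤)) : ExteriorAlgebra.ι ℂ 0 * x = 0 := by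
  rw [LinearMap.map_zero, zero_mul]

theorem rho_ι_zero_apply (s : S) :
    ρ (CliffordAlgebra.ι K.cplx.toQuadraticMap 0) s = 0 := by
  rw [LinearMap.map_zero, map_zero, LinearMap.zero_apply]

theorem mul_add_mul_eq_of_sq {M A : Type*} [AddCommGroup M] [Module ℂ M] [Ring A] [Algebra ℂ A]
    (f : M →ₗ[ℂ] A) (B : LinearMap.BilinForm ℂ M) (hB : ∀ x y, B x y = B y x)
    (h : ∀ x, f x * f x = algebraMap ℂ A (B x x)) (x y : M) :
    f x * f y + f y * f x = (2 * B x y) • 1 := by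
  have hxy := h (x + y)
  simp only [map_add, add_mul, mul_add, LinearMap.add_apply, h, hB y x] at hxy
  rw [← Algebra.algebraMap_eq_smul_one, two_mul, map_add]
  rw [← sub_eq_zero] at hxy ⊢
  rw [← hxy]
  abel

theorem posProj_coe (ξ : Loop 𝔤) : (posProj ξ : Loop 𝔤) = posPart ξ := rfl

theorem negDual_apply (ξ : Loop 𝔤) (p : LoopPos 𝔤) :
    negDual K ξ p = 2 * K.loop (negPart ξ) p := rfl

theorem cliffordOp_mode_neg_tmul {n : ℤ} (hn : n < 0) (X : Cplx 𝔤) (s : S)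
    (x : ExteriorAlgebra ℂ (LoopPos 𝔤)) : cliffordOp K ρ (mode n X) (s ⊗ₜ x) =
      s ⊗ₜ[ℂ] CliffordAlgebra.contractLeft (negDual K (mode n X)) x := by
  have h1 : posProj (mode n X) = 0 := by
    ext1
    rw [posProj_coe, posPart, multiplier_mode, if_neg (by omega), zero_smul]
    rfl
  have h2 : coeff 0 (mode n X) = 0 := by rw [coeff_mode, if_neg hn.ne]
  rw [cliffordOp_tmul, h1, h2, ι_zero_mul, rho_ι_zero_apply, TensorProduct.zero_tmul,
    TensorProduct.tmul_zero, zero_add, add_zero]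

theorem cliffordOp_posPart_tmul (ξ : Loop 𝔤) (s : S) (x : ExteriorAlgebra ℂ (LoopPos 𝔤)) :
    cliffordOp K ρ (posPart ξ) (s ⊗ₜ x) =
      s ⊗ₜ[ℂ] (ExteriorAlgebra.ι ℂ (posProj ξ) * x) := by
  have h1 : posProj (posPart ξ) = posProj ξ := by
    ext1
    rw [posProj_coe, posProj_coe, posPart, multiplier_multiplier]
    congr 2
    ext n
    split_ifs <;> simp
  have h2 : negPart (posPart ξ) = 0 := by
    clear h1
    induction ξ using loop_induction with
    | h0 => simp
    | hadd ξ η h h' => rw [map_add, map_add, h, h', add_zero]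
    | hmode n X =>
      rw [posPart, negPart, multiplier_mode, map_smul, multiplier_mode]
      rcases lt_or_ge 0 n with hn | hn
      · rw [if_neg (by omega : ¬ n < 0), zero_smul, smul_zero]
      · rw [if_neg (by omega : ¬ 0 < n), zero_smul]
  have h3 : coeff 0 (posPart ξ) = 0 := by
    clear h1 h2
    induction ξ using loop_induction with
    | h0 => simp
    | hadd ξ η h h' => rw [map_add, map_add, h, h', add_zero]
    | hmode n X =>
      rw [posPart, multiplier_mode, map_smul, coeff_mode]
      by_cases hn : n = 0
      · simp [hn]
      · rw [if_neg hn, smul_zero]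
  have h4 : negDual K (posPart ξ) = 0 := by
    ext p
    rw [negDual_apply, h2, map_zero, LinearMap.zero_apply, mul_zero, LinearMap.zero_apply]
  rw [cliffordOp_tmul, h1, h3, h4, rho_ι_zero_apply, LinearMap.map_zero, LinearMap.zero_apply,
    TensorProduct.zero_tmul, TensorProduct.tmul_zero, add_zero, add_zero]

theorem exists_negDual_mode_eq_zero (p : LoopPos 𝔤) :
    ∃ N : ℤ, 0 ≤ N ∧ ∀ n X, N < n → negDual K (mode (-n) X) p = 0 := by
  obtain ⟨N, hN⟩ := exists_loop_mode_eq_zero K (p : Loop 𝔤)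
  refine ⟨max N 0, le_max_right _ _, fun n X hn => ?_⟩
  have h0 : 0 < n := (le_max_right _ _).trans_lt hn
  rw [negDual_apply, negPart, multiplier_mode, if_pos (by omega), one_smul, loop_symm,
    hN _ _ (by rw [abs_neg, abs_of_pos h0]; exact (le_max_left _ _).trans_lt hn), mul_zero]

/-- The spin representation as a positive energy module. -/
def spinModule : PositiveEnergyModule K (SpinSpace 𝔤 S) where
  cl := cliffordOp K ρ
  clifford := mul_add_mul_eq_of_sq _ _ (loop_symm K) (cliffordOp_sq K ρ)
  exists_energy_bound v := by
    induction v using TensorProduct.induction_on with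
    | zero => exact ⟨0, le_rfl, fun n X _ => map_zero _⟩
    | add v w hv hw =>
      obtain ⟨N, h0, hN⟩ := hv
      obtain ⟨M, -, hM⟩ := hw
      refine ⟨max N M, h0.trans (le_max_left _ _), fun n X hn => ?_⟩
      rw [map_add, hN n X ((le_max_left _ _).trans_lt hn), hM n X ((le_max_right _ _).trans_lt hn),
        add_zero]
    | tmul s x =>
      suffices h : ∃ N : ℤ, 0 ≤ N ∧ ∀ n X, N < n →
          CliffordAlgebra.contractLeft (negDual K (mode (-n) X)) x = 0 by
        obtain ⟨N, h0, hN⟩ := h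
        refine ⟨N, h0, fun n X hn => ?_⟩
        rw [cliffordOp_mode_neg_tmul K ρ (by omega), hN n X hn, TensorProduct.tmul_zero]
      induction x using CliffordAlgebra.left_induction with
      | algebraMap r => exact ⟨0, le_rfl, fun n X _ => CliffordAlgebra.contractLeft_algebraMap _ _ r⟩
      | add x y hx hy =>
        obtain ⟨N, h0, hN⟩ := hx
        obtain ⟨M, -, hM⟩ := hy
        refine ⟨max N M, h0.trans (le_max_left _ _), fun n X hn => ?_⟩
        rw [map_add, hN n X ((le_max_left _ _).trans_lt hn),
          hM n X ((le_max_right _ _).trans_lt hn), add_zero]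
      | ι_mul x p hx =>
        obtain ⟨N, h0, hN⟩ := hx
        obtain ⟨M, -, hM⟩ := exists_negDual_mode_eq_zero K p
        refine ⟨max N M, h0.trans (le_max_left _ _), fun n X hn => ?_⟩
        rw [CliffordAlgebra.contractLeft_ι_mul, hN n X ((le_max_left _ _).trans_lt hn),
          hM n X ((le_max_right _ _).trans_lt hn), zero_smul, mul_zero, sub_zero]
  eq_top_of_vacuum W hvac hpos := by
    have hstable : ∀ (ξ : Loop 𝔤), ∀ v ∈ W, cliffordOp K ρ (posPart ξ) v ∈ W := by
      intro ξ v hv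
      induction ξ using loop_induction with
      | h0 => simp
      | hadd ξ η h h' =>
        rw [map_add, map_add, LinearMap.add_apply]
        exact add_mem h h'
      | hmode n X =>
        rw [posPart, multiplier_mode]
        split_ifs with hn
        · rw [one_smul]
          exact hpos n X hn v hv
        · simp
    refine eq_top_iff.2 fun v _ => ?_
    induction v using TensorProduct.induction_on with
    | zero => exact zero_mem _
    | add v w hv hw => exact add_mem (hv trivial) (hw trivial)
    | tmul s x =>
      induction x using CliffordAlgebra.left_induction with
      | algebraMap r =>
        -- Vectors of `𝕊 ⊗ 1` are vacuum, since contractions kill constants; the positive modes then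
        -- create the rest by exterior multiplication.
        refine hvac _ fun n X hn => ?_
        rw [cliffordOp_mode_neg_tmul K ρ hn]
        erw [CliffordAlgebra.contractLeft_algebraMap]
        rw [TensorProduct.tmul_zero]
      | add x y hx hy =>
        rw [TensorProduct.tmul_add]
        exact add_mem (hx trivial) (hy trivial)
      | ι_mul x p hx =>
        obtain ⟨_, ξ, rfl⟩ := p
        have h := hstable ξ _ (hx trivial)
        rw [cliffordOp_posPart_tmul] at h
        exact h

/-! ### Normal ordered operators on the spin representation -/

theorem spinRep_ι (ξ : Loop 𝔤) :
    spinRep K ρ (CliffordAlgebra.ι K.loop.toQuadraticMap ξ) = (spinModule K ρ).cl ξ :=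
  CliffordAlgebra.lift_ι_apply _ _ _

/-- The recursion for `normalOrder`, solved for the exterior product, is the recursion by which
`no₂` and `no₃` are defined. -/
theorem normalOrder_symm_ι_mul (ξ : Loop 𝔤) (y : ExteriorAlgebra ℂ (Loop 𝔤)) :
    (normalOrder K).symm (ExteriorAlgebra.ι ℂ ξ * y) =
      CliffordAlgebra.ι K.loop.toQuadraticMap ξ * (normalOrder K).symm y -
        (normalOrder K).symm (CliffordAlgebra.contractLeft (contractionForm K ξ) y) := by
  rw [LinearEquiv.symm_apply_eq, map_sub, normalOrder_ι_mul, LinearEquiv.apply_symm_apply,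
    LinearEquiv.apply_symm_apply, add_sub_cancel_right]

theorem normalOrder_symm_one : (normalOrder K).symm 1 = 1 := by
  rw [LinearEquiv.symm_apply_eq]
  exact (CliffordAlgebra.changeForm_one (neg_contractionForm_toQuadraticMap K)).symm

theorem normalOrder_symm_ι (ξ : Loop 𝔤) :
    (normalOrder K).symm (ExteriorAlgebra.ι ℂ ξ) = CliffordAlgebra.ι K.loop.toQuadraticMap ξ := by
  have h := normalOrder_symm_ι_mul K ξ 1
  rw [mul_one, normalOrder_symm_one, mul_one, CliffordAlgebra.contractLeft_one, map_zero,
    sub_zero] at h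
  exact h

theorem normalOrder_symm_ι_mul_ι (ξ η : Loop 𝔤) :
    (normalOrder K).symm (ExteriorAlgebra.ι ℂ ξ * ExteriorAlgebra.ι ℂ η) =
      CliffordAlgebra.ι K.loop.toQuadraticMap ξ * CliffordAlgebra.ι K.loop.toQuadraticMap η -
        contractionForm K ξ η • 1 := by
  have h : CliffordAlgebra.contractLeft (contractionForm K ξ) (ExteriorAlgebra.ι ℂ η) =
      contractionForm K ξ η • 1 := by
    rw [← Algebra.algebraMap_eq_smul_one]
    exact CliffordAlgebra.contractLeft_ι _ _ _
  rw [normalOrder_symm_ι_mul, normalOrder_symm_ι, h, map_smul, normalOrder_symm_one]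

theorem spinRep_normalOrder_symm_one (v : Fin 1 → Loop 𝔤) :
    spinRep K ρ ((normalOrder K).symm (ExteriorAlgebra.ιMulti ℂ 1 v)) =
      (spinModule K ρ).cl (v 0) := by
  rw [← spinRep_ι, ← normalOrder_symm_ι, ExteriorAlgebra.ιMulti_apply]
  simp

theorem spinRep_normalOrder_symm_two (v : Fin 2 → Loop 𝔤) :
    spinRep K ρ ((normalOrder K).symm (ExteriorAlgebra.ιMulti ℂ 2 v)) =
      (spinModule K ρ).no₂ (v 0) (v 1) := by
  have h : ExteriorAlgebra.ιMulti ℂ 2 v =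
      ExteriorAlgebra.ι ℂ (v 0) * ExteriorAlgebra.ι ℂ (v 1) := by
    rw [ExteriorAlgebra.ιMulti_apply]
    simp
  rw [h, normalOrder_symm_ι_mul_ι, map_sub, map_mul, map_smul, map_one, spinRep_ι, spinRep_ι]
  rfl

theorem spinRep_normalOrder_symm_three (v : Fin 3 → Loop 𝔤) :
    spinRep K ρ ((normalOrder K).symm (ExteriorAlgebra.ιMulti ℂ 3 v)) =
      (spinModule K ρ).no₃ (v 0) (v 1) (v 2) := by
  have h : ExteriorAlgebra.ιMulti ℂ 3 v = ExteriorAlgebra.ι ℂ (v 0) *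
      (ExteriorAlgebra.ι ℂ (v 1) * ExteriorAlgebra.ι ℂ (v 2)) := by
    rw [ExteriorAlgebra.ιMulti_apply]
    simp
  have h1 : CliffordAlgebra.contractLeft (contractionForm K (v 0))
      (ExteriorAlgebra.ι ℂ (v 1) * ExteriorAlgebra.ι ℂ (v 2)) =
        contractionForm K (v 0) (v 1) • ExteriorAlgebra.ι ℂ (v 2) -
          contractionForm K (v 0) (v 2) • ExteriorAlgebra.ι ℂ (v 1) := by
    refine (CliffordAlgebra.contractLeft_ι_mul _ _ _).trans ?_
    congr 1
    refine (congrArg _ (CliffordAlgebra.contractLeft_ι _ _ _)).trans ?_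
    rw [← Algebra.commutes, ← Algebra.smul_def]
  rw [h, normalOrder_symm_ι_mul, h1, map_sub (normalOrder K).symm, map_smul, map_smul,
    normalOrder_symm_ι_mul_ι, normalOrder_symm_ι, normalOrder_symm_ι]
  simp only [map_sub, map_mul, map_smul, map_one, spinRep_ι]
  rw [PositiveEnergyModule.no₃, PositiveEnergyModule.no₂]
  abel

end LoopClifford

end

noncomputable section

namespace LoopClifford

variable {𝔤 : Type*} [LieRing 𝔤] [LieAlgebra ℝ 𝔤] {K : InvariantInnerProduct 𝔤}
  {ι : Type*} [Fintype ι] [DecidableEq ι] {b : Module.Basis ι ℝ 𝔤}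
  {S : Type*} [AddCommGroup S] [Module ℂ S] (ρ : K.Cl →ₐ[ℂ] Module.End ℂ S)

/-! ### The operators as normal ordered operators of forms. -/

theorem isNormalOrdered_formSum {p : ℕ} {t : (Fin p → ι × ℤ) → Module.End ℂ (SpinSpace 𝔤 S)}
    (ht : IsLocallyBounded t)
    (h : ∀ v : Fin p → ι × ℤ, spinRep K ρ ((normalOrder K).symm
      (ExteriorAlgebra.ιMulti ℂ p fun j => loopDual b (v j))) = t v) (ω : FormPlus 𝔤 p) :
    IsNormalOrdered K b ρ (ω : Form 𝔤 p) (formSum b t ht ω) := by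
  intro v
  simp only [h]
  exact ⟨ht.finite_support b ω.2 v, formSum_apply b ht ω v⟩

theorem isNormalOrdered_op₂ (ω : FormPlus 𝔤 2) :
    IsNormalOrdered K b ρ (ω : Form 𝔤 2) ((spinModule K ρ).op₂ b ω) :=
  isNormalOrdered_formSum ρ ((spinModule K ρ).isLocallyBounded_mono₂ b)
    (fun f => spinRep_normalOrder_symm_two K ρ fun j => loopDual b (f j)) ω

theorem isNormalOrdered_op₃ (ω : FormPlus 𝔤 3) :
    IsNormalOrdered K b ρ (ω : Form 𝔤 3) ((spinModule K ρ).op₃ b ω) :=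
  isNormalOrdered_formSum ρ ((spinModule K ρ).isLocallyBounded_mono₃ b)
    (fun f => spinRep_normalOrder_symm_three K ρ fun j => loopDual b (f j)) ω

variable (b) in
theorem isNormalOrdered_ads (ξ : Loop 𝔤) :
    IsNormalOrdered K b ρ ((1 / 2 : ℂ) • dStar K ξ) ((spinModule K ρ).ads b ξ) := by
  have h := isNormalOrdered_op₂ (b := b) ρ ((1 / 2 : ℂ) • ⟨dStar K ξ, dStar_mem_formPlus K ξ⟩)
  rw [← PositiveEnergyModule.ads_eq, Submodule.coe_smul] at h
  exact h

variable (b) in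
theorem isNormalOrdered_adsRot :
    IsNormalOrdered K b ρ ((1 / 2 : ℂ) • dRotStar K) ((spinModule K ρ).adsRot b) := by
  have h := isNormalOrdered_op₂ (b := b) ρ ((1 / 2 : ℂ) • ⟨dRotStar K, dRotStar_mem_formPlus K⟩)
  rw [← PositiveEnergyModule.adsRot, Submodule.coe_smul] at h
  exact h

variable (b) in
theorem isNormalOrdered_gamma :
    IsNormalOrdered K b ρ ((1 / 4 : ℂ) • fundamentalForm K) ((spinModule K ρ).gamma b) := by
  have h := isNormalOrdered_op₃ (b := b) ρ
    ((1 / 4 : ℂ) • ⟨fundamentalForm K, fundamentalForm_mem_formPlus K⟩)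
  rw [← PositiveEnergyModule.gamma, Submodule.coe_smul] at h
  exact h

theorem finsum_fin_one {α M : Type*} [AddCommMonoid M] {g : α → M} (hg : g.support.Finite) :
    (Function.support fun f : Fin 1 → α => g (f 0)).Finite ∧
      ∑ᶠ f : Fin 1 → α, g (f 0) = ∑ᶠ x, g x :=
  ⟨hg.preimage (Equiv.funUnique (Fin 1) α).injective.injOn,
    finsum_comp_equiv (Equiv.funUnique (Fin 1) α)⟩

theorem isNormalOrdered_star (hb : K.IsOrthonormal b) (ξ : Loop 𝔤) :
    IsNormalOrdered K b ρ (star K ξ) ((spinModule K ρ).cl ξ) := by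
  intro v
  have h := loop_expansion hb ((spinModule K ρ).cl.flip v) ξ
  simp only [spinRep_normalOrder_symm_one]
  simp only [LinearMap.flip_apply] at h
  have h' := finsum_fin_one h.1
  rw [h.2] at h'
  exact ⟨h'.1, h'.2.symm⟩

/-! ### The Casimir operator of a simple Lie algebra -/

theorem repr_eq_form (hb : K.IsOrthonormal b) (x : 𝔤) (i : ι) : b.repr x i = K.form (b i) x := by
  conv_rhs => rw [← b.sum_repr x]
  rw [map_sum, Finset.sum_eq_single i (fun j _ hj => ?_) (fun h => absurd (Finset.mem_univ i) h),
    map_smul, hb i i, if_pos rfl, smul_eq_mul, mul_one]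
  rw [map_smul, hb i j, if_neg hj.symm, smul_zero]

theorem killingForm_eq_sum (hb : K.IsOrthonormal b) (x y : 𝔤) :
    killingForm ℝ 𝔤 x y = -∑ i, K.form ⁅b i, x⁆ ⁅b i, y⁆ := by
  rw [LieModule.traceForm_apply_apply, LinearMap.trace_eq_matrix_trace ℝ b, Matrix.trace,
    ← Finset.sum_neg_distrib]
  refine Finset.sum_congr rfl fun i _ => ?_
  rw [Matrix.diag_apply, LinearMap.toMatrix_apply, repr_eq_form hb]
  simp only [LinearMap.comp_apply, LieModule.toEnd_apply_apply]
  rw [← K.invariant, ← lie_skew y, map_neg]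

/-- Since `ad` is skew for the inner product, both sides are half the sum of `⟨[Xᵢ, x], [Xᵢ, y]⟩`.
-/
theorem form_casimirAd (hb : K.IsOrthonormal b) (x y : 𝔤) :
    K.form (casimirAd b x) y = -(1 / 2) * killingForm ℝ 𝔤 x y := by
  rw [killingForm_eq_sum hb]
  simp only [casimirAd, LinearMap.smul_apply, LinearMap.sum_apply, map_smul, map_sum,
    Module.End.mul_apply, LieAlgebra.ad_apply, smul_eq_mul]
  congr 1
  rw [← Finset.sum_neg_distrib]
  refine Finset.sum_congr rfl fun i _ => ?_
  rw [← lie_skew, map_neg, LinearMap.neg_apply, K.invariant]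

/-- In an orthonormal basis the Killing form is a real symmetric matrix, so it has a real
eigenvector; this replaces algebraic closedness in Schur's lemma. -/
theorem exists_killingForm_eigenvector [Nonempty ι] (hb : K.IsOrthonormal b) :
    ∃ (a : ℝ) (x : 𝔤), x ≠ 0 ∧ ∀ y, killingForm ℝ 𝔤 y x = a * K.form y x := by
  let A : Matrix ι ι ℝ := fun i j => killingForm ℝ 𝔤 (b i) (b j)
  have hA : A.IsHermitian := by
    ext i j
    exact LieModule.traceForm_comm ℝ 𝔤 𝔤 (b j) (b i)
  obtain ⟨j⟩ := ‹Nonempty ι›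
  set u : ι → ℝ := ⇑(hA.eigenvectorBasis j) with hu
  have hAu := hA.mulVec_eigenvectorBasis j
  rw [← hu] at hAu
  refine ⟨hA.eigenvalues j, ∑ i, u i • b i, fun h0 => ?_, fun y => ?_⟩
  · have hu0 : u = 0 := by
      ext i
      have h1 := congrArg (fun x => b.repr x i) h0
      simpa [Finsupp.single_apply] using h1
    refine hA.eigenvectorBasis.orthonormal.ne_zero j ?_
    ext i
    exact congrFun hu0 i
  · have h1 : ∀ i, killingForm ℝ 𝔤 (b i) (∑ i, u i • b i) =
        hA.eigenvalues j * K.form (b i) (∑ i, u i • b i) := by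
      intro i
      have h2 := congrFun hAu i
      rw [Matrix.mulVec, dotProduct] at h2
      rw [← repr_eq_form hb, map_sum, map_sum]
      simp only [map_smul, smul_eq_mul, Module.Basis.repr_self, Finsupp.smul_single, mul_one,
        Finsupp.coe_finsetSum, Finset.sum_apply, Finsupp.single_apply, Finset.sum_ite_eq',
        Finset.mem_univ, if_true]
      rw [Pi.smul_apply, smul_eq_mul] at h2
      rw [← h2]
      exact Finset.sum_congr rfl fun k _ => mul_comm _ _
    have h3 : (killingForm ℝ 𝔤).flip (∑ i, u i • b i) =
        hA.eigenvalues j • K.form.flip (∑ i, u i • b i) := b.ext h1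
    exact congrArg (fun f => f y) h3

/-- The eigenspace of the Killing form is an ideal by invariance of both forms and is nonzero, hence
is everything. The Casimir operator represents `-½` of the Killing form, so its eigenvalue is `-½a`.
-/
theorem exists_casimirAd_eq_smul [LieAlgebra.IsSimple ℝ 𝔤] [Nonempty ι] (hb : K.IsOrthonormal b) :
    ∃ c : ℝ, casimirAd b = c • (1 : Module.End ℝ 𝔤) := by
  obtain ⟨a, x, hx, hax⟩ := exists_killingForm_eigenvector hb
  let I : LieIdeal ℝ 𝔤 :=
    { carrier := {x | ∀ y, killingForm ℝ 𝔤 y x = a * K.form y x}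
      zero_mem' := fun y => by simp
      add_mem' := fun h h' y => by rw [map_add, map_add, h y, h' y, mul_add]
      smul_mem' := fun r x h y => by
        rw [map_smul, map_smul, h y, smul_eq_mul, smul_eq_mul, mul_left_comm]
      lie_mem := fun {z x} h y => by
        rw [← LieModule.traceForm_apply_lie_apply, ← K.invariant]
        exact h ⁅y, z⁆ }
  have hI : I = ⊤ := by
    refine (LieAlgebra.IsSimple.eq_bot_or_eq_top I).resolve_left fun h => hx ?_
    have hxI : x ∈ I := hax
    rw [h] at hxI
    exact (LieSubmodule.mem_bot x).1 hxI
  refine ⟨-(1 / 2) * a, LinearMap.ext fun z => ?_⟩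
  by_contra hne
  obtain ⟨w, hw⟩ : ∃ w, w = casimirAd b z - (-(1 / 2) * a) • z := ⟨_, rfl⟩
  have hpos : 0 < K.form w w := K.pos w fun h => hne (sub_eq_zero.1 (hw.symm.trans h))
  have hz : z ∈ I := by
    rw [hI]
    exact LieSubmodule.mem_top z
  refine hpos.ne' ?_
  have h1 : killingForm ℝ 𝔤 w z = a * K.form w z := hz w
  -- Only one copy of the defect `w` is expanded; pairing it with `w` gives zero, contradicting
  -- positive definiteness.
  nth_rw 1 [hw]
  rw [map_sub, LinearMap.sub_apply, form_casimirAd hb, LieModule.traceForm_comm, h1, map_smul,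
    LinearMap.smul_apply, K.symm z w, smul_eq_mul]
  ring

theorem nonempty_of_isSimple [LieAlgebra.IsSimple ℝ 𝔤] (b : Module.Basis ι ℝ 𝔤) : Nonempty ι := by
  by_contra h
  rw [not_nonempty_iff] at h
  have : Subsingleton 𝔤 := b.repr.toEquiv.subsingleton
  exact LieAlgebra.IsSimple.non_abelian (R := ℝ) (L := 𝔤) ⟨fun x y => Subsingleton.elim _ _⟩

end LoopClifford
end

/-! ### The theorem on the spin representation. -/

set_option maxHeartbeats 1000000 in
theorem mainTheorem5 {𝔤 : Type*} [LieRing 𝔤] [LieAlgebra ℝ 𝔤] [LieAlgebra.IsSimple ℝ 𝔤]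
    (K : LoopClifford.InvariantInnerProduct 𝔤)
    {ι : Type*} [Fintype ι] [DecidableEq ι] (b : Module.Basis ι ℝ 𝔤)
    (hb : ∀ i j, K.form (b i) (b j) = if i = j then 1 else 0)
    {S : Type*} [AddCommGroup S] [Module ℂ S] [Nontrivial S]
    (ρ : K.Cl →ₐ[ℂ] Module.End ℂ S) :
    -- the quadratic Casimir operator acts on the adjoint representation by a scalar `c`
    ∃ c : ℝ, LoopClifford.casimirAd b = c • (1 : Module.End ℝ 𝔤) ∧
    -- the forms `ξ*`, `dξ*`, `d∂_θ*`, `Ω` lie in the normal ordered completion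
    (∀ ξ, LoopClifford.star K ξ ∈ LoopClifford.FormPlus 𝔤 1) ∧
    (∀ ξ, LoopClifford.dStar K ξ ∈ LoopClifford.FormPlus 𝔤 2) ∧
    LoopClifford.dRotStar K ∈ LoopClifford.FormPlus 𝔤 2 ∧
    LoopClifford.fundamentalForm K ∈ LoopClifford.FormPlus 𝔤 3 ∧
    -- their normal ordered operators `cl ξ = ξ*`, `ads ξ = ½ dξ*`, `adsRot = ½ d∂_θ*`, `γ = ¼ Ω`
    ∃ (cl ads : LoopClifford.Loop 𝔤 →ₗ[ℂ] Module.End ℂ (LoopClifford.SpinSpace 𝔤 S))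
      (adsRot γ : Module.End ℂ (LoopClifford.SpinSpace 𝔤 S)),
      (∀ ξ, cl ξ = LoopClifford.spinRep K ρ (CliffordAlgebra.ι K.loop.toQuadraticMap ξ)) ∧
      (∀ ξ, LoopClifford.IsNormalOrdered K b ρ (LoopClifford.star K ξ) (cl ξ)) ∧
      (∀ ξ, LoopClifford.IsNormalOrdered K b ρ ((1 / 2 : ℂ) • LoopClifford.dStar K ξ) (ads ξ)) ∧
      LoopClifford.IsNormalOrdered K b ρ ((1 / 2 : ℂ) • LoopClifford.dRotStar K) adsRot ∧
      LoopClifford.IsNormalOrdered K b ρ ((1 / 4 : ℂ) • LoopClifford.fundamentalForm K) γ ∧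
      -- they span a Lie superalgebra
      LoopClifford.IsLieSuperalgebra
        (Submodule.span ℂ ({1} ∪ Set.range ads ∪ {adsRot}))
        (Submodule.span ℂ (Set.range cl ∪ {γ})) ∧
      -- with the brackets
      (∀ ξ η, cl ξ * cl η + cl η * cl ξ = (2 * K.loop ξ η) • 1) ∧
      (∀ ξ η, ads ξ * cl η - cl η * ads ξ = cl ⁅ξ, η⁆) ∧
      (∀ ξ η, ads ξ * ads η - ads η * ads ξ =
        ads ⁅ξ, η⁆ + (Complex.I * c * K.loop ξ (LoopClifford.rot η)) • 1) ∧
      (∀ ξ, adsRot * cl ξ - cl ξ * adsRot = cl (LoopClifford.rot ξ)) ∧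
      (∀ ξ, adsRot * ads ξ - ads ξ * adsRot = ads (LoopClifford.rot ξ)) ∧
      (∀ ξ, γ * cl ξ + cl ξ * γ = ads ξ) ∧
      (∀ ξ, γ * ads ξ - ads ξ * γ = (1 / 2 * Complex.I * c : ℂ) • cl (LoopClifford.rot ξ)) ∧
      γ * adsRot - adsRot * γ = 0 ∧
      γ * γ + γ * γ =
        (Complex.I * c) • adsRot - (1 / 24 * c * Module.finrank ℝ 𝔤 : ℂ) • 1 := by
  have hne := LoopClifford.nonempty_of_isSimple b
  refine (LoopClifford.exists_casimirAd_eq_smul (K := K) hb).imp fun c hc => ?_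
  refine ⟨hc, LoopClifford.star_mem_formPlus K, LoopClifford.dStar_mem_formPlus K,
    LoopClifford.dRotStar_mem_formPlus K, LoopClifford.fundamentalForm_mem_formPlus K, ?_⟩
  have hads := LoopClifford.isNormalOrdered_ads b ρ
  have hrot := LoopClifford.isNormalOrdered_adsRot b ρ
  have hgamma := LoopClifford.isNormalOrdered_gamma b ρ
  have hcl := LoopClifford.spinRep_ι K ρ
  have hstar := LoopClifford.isNormalOrdered_star (b := b) ρ hb
  -- Beyond the identification with normal ordered operators, only the axioms of a positive energy
  -- module are used.
  generalize LoopClifford.spinModule K ρ = P at hads hrot hgamma hcl hstar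
  refine ⟨P.cl, P.ads b, P.adsRot b, P.gamma b, fun ξ => (hcl ξ).symm, hstar, hads, hrot, hgamma,
    P.isLieSuperalgebra hb hc, P.clifford, P.ads_comm_cl hb, P.ads_comm_ads hb hc,
    P.adsRot_comm_cl hb, P.adsRot_comm_ads hb, P.gamma_anticomm_cl hb, P.gamma_comm_ads hb hc,
    P.gamma_comm_adsRot hb, ?_⟩
  rw [Module.finrank_eq_card_basis b]
  exact P.gamma_sq hb hc
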